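/- All homology and cohomology groups are singular with integer coefficients; "$n$-manifold" means Hausdorff second countable topological $n$-manifold without boundary, not necessarily compact, and $n\ge 3$. **Definitions.** Let $X$ be an oriented $n$-manifold. For $V\subseteq X$ with compact boundary put $$C_*(X,\partial_\infty V)=\varprojlim_K C_*(X,V\setminus K),\qquad C^*(X,\partial_\infty V)=\varinjlim_K C^*(X,V\setminus K),$$ where $K$ runs over the compact subsets of $X$, and let $H_*(X,\partial_\infty V)$, $H^*(X,\partial_\infty V)$ be the corresponding (co)homology groups; write $\partial_\infty X=\partial_\infty V$ for $V=X$. Let $[X]\in H_n(X,\partial_\infty X)$ be the fundamental class, i.e. the class restricting to the local orientation generator of $H_n(X,X\setminus\{x\})\cong\mathbb Z$ for every $x\in X$. Put $V^c=X\setminus V$. A class $\tau\in H_2(X,\partial_\infty V)$ is *spherical* if for every closed $\Omega\subseteq X$ such that $\overline{\Omega\,\Delta\,V^c}$ is compact, the restriction $\tau|_\Omega\in H_2(X,X\setminus\Omega)$ lies in the image of the Hurewicz map $\pi_2(X,X\setminus\Omega)\to H_2(X,X\setminus\Omega)$ (the subgroup generated by the classes of maps of discs $(D^2,S^1)\to(X,X\setminus\Omega)$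 and of maps of spheres $S^2\to X$); otherwise $\tau$ is *aspherical*. We say that $(V;\beta_1,\dots,\beta_{n-2})$ is *SYS data* for $X$ if $V\subseteq X$ has compact boundary, $\beta_1\in H^1(X,\partial_\infty V^c)$, $\beta_2,\dots,\beta_{n-2}\in H^1(X)$, and the class $[X]\frown(\beta_1\smile\cdots\smile\beta_{n-2})\in H_2(X,\partial_\infty V)$ is aspherical. $X$ is *SYS* if it has SYS data, and *open SYS* if moreover it is non-compact. For a continuous map $f:M\to N$ of oriented $n$-manifolds let $S_\infty=\bigcap_{K\subseteq M\text{ compact}}\overline{f(M\setminus K)}$. The map $f$ is *quasi-proper of degree $d\in\mathbb Z$* if $S_\infty$ is a discrete subset of $N$ and the composition $$H_n(M,\partial_\infty M)\to H_n(f^{-1}(N\setminus S_\infty),\partial_\infty)\xrightarrow{f_*}H_n(N\setminus S_\infty,\partial_\infty)$$ of restriction and push-forward (over $N\setminus S_\infty$ the map $f$ is proper) sends $[M]$ to $d\,[N\setminus S_\infty]$, where $[N\setminus S_\infty]$ is the restriction of $[N]$. **Proposition.** Let $M$ and $N$ be oriented $n$-manifolds, $n\ge3$, and let $f:M\to N$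 be a quasi-proper map of degree $\pm1$. If $N$ is SYS, then $M$ is SYS; and if $N$ is non-compact, then $M$ is non-compact. In particular, if $N$ is open SYS, then so is $M$. More precisely, the cohomology classes can be obtained by pull-back: for all SYS data $(V;\beta_1,\dots,\beta_{n-2})$ for $N$ there are a subset $W\subseteq M$ with compact boundary and a class $\gamma_1\in H^1(M,\partial_\infty W^c)$ such that the image of $\gamma_1$ in $H^1(M)$ is the pull-back $f^*$ of the image of $\beta_1$ in $H^1(N)$ and $(W;\gamma_1,f^*\beta_2,\dots,f^*\beta_{n-2})$ is SYS data for $M$. -/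

import Mathlib

open Set Topology

noncomputable section

namespace SYS

/-! ### Singular simplices, chains and cochains (integer coefficients) -/

section Simplices

variable {X Y : Type*} [TopologicalSpace X] [TopologicalSpace Y]

/-- The map of standard simplices that is affine and given by `α` on vertices. -/
def vertexMap {p k : ℕ} (α : Fin (p + 1) → Fin (k + 1)) :
    C(stdSimplex ℝ (Fin (p + 1)), stdSimplex ℝ (Fin (k + 1))) :=
  ⟨stdSimplex.map α, stdSimplex.continuous_map α⟩

/-- Singular `k`-simplices of `X`. -/
abbrev Simplex (X : Type*) [TopologicalSpace X] (k : ℕ) : Type _ :=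
  C(stdSimplex ℝ (Fin (k + 1)), X)

/-- All (possibly infinite) formal integral combinations of singular `k`-simplices; which ones are
chains is decided by the finiteness conditions below. -/
abbrev Chain (X : Type*) [TopologicalSpace X] (k : ℕ) : Type _ := Simplex X k → ℤ

/-- Integral singular `k`-cochains. -/
abbrev Cochain (X : Type*) [TopologicalSpace X] (k : ℕ) : Type _ := Simplex X k → ℤ

/-- The `i`-th face of a singular simplex. -/
def face {k : ℕ} (i : Fin (k + 2)) (σ : Simplex X (k + 1)) : Simplex X k :=
  σ.comp (vertexMap i.succAbove)

/-- The front `p`-face `σ|[v_0, …, v_p]`. -/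
def front (p : ℕ) {k : ℕ} (h : p ≤ k) (σ : Simplex X k) : Simplex X p :=
  σ.comp (vertexMap fun i => ⟨i, by omega⟩)

/-- The back `q`-face `σ|[v_{k-q}, …, v_k]`. -/
def back (q : ℕ) {k : ℕ} (h : q ≤ k) (σ : Simplex X k) : Simplex X q :=
  σ.comp (vertexMap fun i => ⟨k - q + i, by omega⟩)

/-- The formal sum `∑ s, a s • (∑ t, w s t • t)`. The coefficient of each `t` is a finite sum
whenever only finitely many `s` with `a s ≠ 0` involve `t`. -/
def transfer {S T : Type*} (w : S → T → ℤ) (a : S → ℤ) : T → ℤ :=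
  fun t => ∑ᶠ s, a s * w s t

open Classical in
/-- The coefficient of `ρ` in `∂σ = ∑ i, (-1)^i (face i σ)`. -/
def incidence {k : ℕ} (σ : Simplex X (k + 1)) (ρ : Simplex X k) : ℤ :=
  ∑ i : Fin (k + 2), if face i σ = ρ then (-1) ^ (i : ℕ) else 0

/-- The singular boundary operator, extended to (locally finite) formal sums; it is zero in
degree `0`. -/
def boundary : {k : ℕ} → Chain X k → Chain X (k - 1)
  | 0, _ => 0
  | _ + 1, a => transfer incidence a

open Classical in
/-- The push-forward of formal sums of simplices along a continuous map. -/
def pushChain (g : C(X, Y)) {k : ℕ} (a : Chain X k) : Chain Y k :=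
  transfer (fun (σ : Simplex X k) (ρ : Simplex Y k) => if g.comp σ = ρ then 1 else 0) a

/-- The singular coboundary operator. -/
def coboundary (k : ℕ) : Cochain X k →+ Cochain X (k + 1) where
  toFun φ σ := ∑ i : Fin (k + 2), (-1) ^ (i : ℕ) * φ (face i σ)
  map_zero' := by ext; simp
  map_add' φ ψ := by ext; simp [mul_add, Finset.sum_add_distrib]

/-- The cup product of cochains. -/
def cup {p q : ℕ} (φ : Cochain X p) (ψ : Cochain X q) : Cochain X (p + q) :=
  fun σ => φ (front p (by omega) σ) * ψ (back q (by omega) σ)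

/-- The iterated cup product `φ 0 ⌣ φ 1 ⌣ ⋯ ⌣ φ (m - 1)` of `1`-cochains (the unit cochain `1`
for `m = 0`). -/
def cupProd : (m : ℕ) → (Fin m → Cochain X 1) → Cochain X m
  | 0, _ => 1
  | m + 1, φ => cup (cupProd m fun i => φ i.castSucc) (φ (Fin.last m))

open Classical in
/-- The cap product `a ⌢ φ`, where `σ ⌢ φ = φ (σ|[v_0, …, v_p]) • σ|[v_p, …, v_k]`. -/
def cap {p q k : ℕ} (h : p + q = k) (a : Chain X k) (φ : Cochain X p) : Chain X q :=
  transfer (fun (σ : Simplex X k) (ρ : Simplex X q) =>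
    if back q (by omega) σ = ρ then φ (front p (by omega) σ) else 0) a

/-! Auxiliary facts on formal sums. -/

/-- Every compact set meets only finitely many simplices of `a`. -/
def LocFin {k : ℕ} (a : Chain X k) : Prop :=
  ∀ K : Set X, IsCompact K → {σ : Simplex X k | a σ ≠ 0 ∧ (range σ ∩ K).Nonempty}.Finite

theorem exists_of_transfer_ne_zero {S T : Type*} {w : S → T → ℤ} {a : S → ℤ} {t : T}
    (h : transfer w a t ≠ 0) : ∃ s, a s * w s t ≠ 0 := by
  by_contra hne
  push Not at hne
  exact h ((finsum_congr hne).trans finsum_zero)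

theorem isCompact_range_simplex {k : ℕ} (σ : Simplex X k) : IsCompact (range σ) :=
  isCompact_range σ.continuous

theorem range_simplex_nonempty {k : ℕ} (σ : Simplex X k) : (range σ).Nonempty :=
  range_nonempty σ

theorem range_face_subset {k : ℕ} (i : Fin (k + 2)) (σ : Simplex X (k + 1)) :
    range (face i σ) ⊆ range σ := by
  rintro _ ⟨t, rfl⟩
  exact ⟨_, rfl⟩

theorem range_subset_of_incidence {k : ℕ} {σ : Simplex X (k + 1)} {ρ : Simplex X k}
    (h : incidence σ ρ ≠ 0) : range ρ ⊆ range σ := by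
  classical
  obtain ⟨i, -, hi⟩ := Finset.exists_ne_zero_of_sum_ne_zero h
  have : face i σ = ρ := by
    by_contra hne
    simp [hne] at hi
  rw [← this]
  exact range_face_subset i σ

theorem LocFin.of_finite {k : ℕ} {a : Chain X k} (h : {σ | a σ ≠ 0}.Finite) : LocFin a :=
  fun _ _ => h.subset fun _ hσ => hσ.1

theorem LocFin.incidence_finite {k : ℕ} {a : Chain X (k + 1)} (ha : LocFin a) (ρ : Simplex X k) :
    {σ | a σ * incidence σ ρ ≠ 0}.Finite := by
  refine (ha _ (isCompact_range_simplex ρ)).subset fun σ hσ => ?_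
  have h := mul_ne_zero_iff.1 hσ
  exact ⟨h.1, by
    rw [inter_eq_self_of_subset_right (range_subset_of_incidence h.2)]
    exact range_simplex_nonempty ρ⟩

theorem boundary_zero {k : ℕ} : boundary (0 : Chain X k) = 0 := by
  cases k with
  | zero => rfl
  | succ k => ext ρ; simp [boundary, transfer]

theorem boundary_neg {k : ℕ} (a : Chain X k) : boundary (-a) = -boundary a := by
  cases k with
  | zero => ext; simp [boundary]
  | succ k => ext ρ; simp [boundary, transfer, finsum_neg_distrib]

theorem boundary_add {k : ℕ} {a b : Chain X k} (ha : LocFin a) (hb : LocFin b) :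
    boundary (a + b) = boundary a + boundary b := by
  cases k with
  | zero => ext; simp [boundary]
  | succ k =>
    ext ρ
    simp only [boundary, transfer, Pi.add_apply, add_mul]
    exact finsum_add_distrib (ha.incidence_finite ρ) (hb.incidence_finite ρ)

/-- `boundary a` at a simplex outside `A` only depends on the values of `a` outside `A`. -/
theorem boundary_congr {k : ℕ} {a b : Chain X k} {A : Set X}
    (h : ∀ σ : Simplex X k, ¬ range σ ⊆ A → a σ = b σ) (ρ : Simplex X (k - 1)) (hρ : ¬ range ρ ⊆ A) :
    boundary a ρ = boundary b ρ := by
  cases k with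
  | zero => rfl
  | succ k =>
    refine finsum_congr fun σ => ?_
    by_cases hi : incidence σ ρ = 0
    · rw [hi, mul_zero, mul_zero]
    · rw [h σ fun hs => hρ ((range_subset_of_incidence hi).trans hs)]

theorem finite_add {S : Type*} {a b : S → ℤ} {P : S → Prop} (ha : {s | a s ≠ 0 ∧ P s}.Finite)
    (hb : {s | b s ≠ 0 ∧ P s}.Finite) : {s | (a + b) s ≠ 0 ∧ P s}.Finite := by
  refine (ha.union hb).subset fun s hs => ?_
  by_cases h : a s = 0
  · refine Or.inr ⟨fun h' => hs.1 (by simp [h, h']), hs.2⟩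
  · exact Or.inl ⟨h, hs.2⟩

end Simplices

/-! ### Relative singular homology -/

section Relative

variable {X Y : Type*} [TopologicalSpace X] [TopologicalSpace Y]

/-- Relative cycles of `(X, A)`: finite chains in `X` whose boundary is a chain in `A`. -/
def relCycles (A : Set X) (k : ℕ) : AddSubgroup (Chain X k) where
  carrier := {z | {σ | z σ ≠ 0}.Finite ∧
    ∀ ρ : Simplex X (k - 1), ¬ range ρ ⊆ A → boundary z ρ = 0}
  zero_mem' := ⟨by simp, fun ρ _ => by rw [boundary_zero]; rfl⟩
  add_mem' {a b} ha hb := by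
    refine ⟨?_, fun ρ hρ => ?_⟩
    · simpa using finite_add (P := fun _ => True) (by simpa using ha.1) (by simpa using hb.1)
    · rw [boundary_add (.of_finite ha.1) (.of_finite hb.1), Pi.add_apply, ha.2 ρ hρ, hb.2 ρ hρ,
        add_zero]
  neg_mem' {a} ha := by
    refine ⟨by simpa using ha.1, fun ρ hρ => ?_⟩
    rw [boundary_neg, Pi.neg_apply, ha.2 ρ hρ, neg_zero]

theorem mem_relCycles {A : Set X} {k : ℕ} {z : Chain X k} : z ∈ relCycles A k ↔
    {σ | z σ ≠ 0}.Finite ∧ ∀ ρ : Simplex X (k - 1), ¬ range ρ ⊆ A → boundary z ρ = 0 := Iff.rfl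

/-- Relative boundaries of `(X, A)`: chains of the form `∂e + c` with `e` a finite chain in `X` and
`c` a chain in `A`. -/
def relBoundaries (A : Set X) (k : ℕ) : AddSubgroup (Chain X k) where
  carrier := {z | ∃ e : Chain X (k + 1), {σ | e σ ≠ 0}.Finite ∧
    ∀ ρ : Simplex X k, ¬ range ρ ⊆ A → z ρ = boundary e ρ}
  zero_mem' := ⟨0, by simp, fun ρ _ => by rw [boundary_zero]⟩
  add_mem' := by
    rintro a b ⟨e, he, hae⟩ ⟨e', he', hbe⟩
    refine ⟨e + e', ?_, fun ρ hρ => ?_⟩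
    · simpa using finite_add (P := fun _ => True) (by simpa using he) (by simpa using he')
    · rw [boundary_add (.of_finite he) (.of_finite he')]
      exact congrArg₂ (· + ·) (hae ρ hρ) (hbe ρ hρ)
  neg_mem' := by
    rintro a ⟨e, he, hae⟩
    refine ⟨-e, by simpa using he, fun ρ hρ => ?_⟩
    rw [boundary_neg]
    exact congrArg Neg.neg (hae ρ hρ)

theorem mem_relBoundaries {A : Set X} {k : ℕ} {z : Chain X k} : z ∈ relBoundaries A k ↔
    ∃ e : Chain X (k + 1), {σ | e σ ≠ 0}.Finite ∧
      ∀ ρ : Simplex X k, ¬ range ρ ⊆ A → z ρ = boundary e ρ := Iff.rfl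

/-- Relative singular homology `H_k(X, A)` with integer coefficients. -/
abbrev RelHomology (A : Set X) (k : ℕ) : Type _ :=
  relCycles A k ⧸ (relBoundaries A k).addSubgroupOf (relCycles A k)

end Relative

/-! ### Homology and cohomology relative to the ends contained in `V` -/

section Ends

variable {X Y : Type*} [TopologicalSpace X] [TopologicalSpace Y]

/-- The chain group `C_k(X, ∂_∞V) = lim_K C_k(X, V \ K)`, the limit being over the compact
subsets `K` of `X`. Since `C_k(X, V \ K)` is free on the simplices that do not lie in `V \ K`, and
every simplex is of this kind for large `K`, an element of the limit is a formal sum of simplices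
in which, for every `K`, all but finitely many simplices lie in `V \ K`. For `V = ∅` this is
`C_k(X)`; for `V = univ` these are the locally finite chains `C_k(X, ∂_∞X)`. -/
def endChains (V : Set X) (k : ℕ) : AddSubgroup (Chain X k) where
  carrier := {a | ∀ K : Set X, IsCompact K → {σ : Simplex X k | a σ ≠ 0 ∧ ¬ range σ ⊆ V \ K}.Finite}
  zero_mem' := fun K _ => by simp
  add_mem' ha hb := fun K hK => finite_add (ha K hK) (hb K hK)
  neg_mem' ha := fun K hK => by simpa using ha K hK

theorem mem_endChains {V : Set X} {k : ℕ} {a : Chain X k} : a ∈ endChains V k ↔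
    ∀ K : Set X, IsCompact K → {σ : Simplex X k | a σ ≠ 0 ∧ ¬ range σ ⊆ V \ K}.Finite := Iff.rfl

theorem LocFin.of_mem {V : Set X} {k : ℕ} {a : Chain X k} (ha : a ∈ endChains V k) : LocFin a := by
  intro K hK
  refine (ha K hK).subset fun σ hσ => ⟨hσ.1, fun hs => ?_⟩
  obtain ⟨x, hx, hxK⟩ := hσ.2
  exact (hs hx).2 hxK

theorem mem_endChains_univ {k : ℕ} {a : Chain X k} : a ∈ endChains univ k ↔ LocFin a := by
  refine ⟨.of_mem, fun ha K hK => (ha K hK).subset fun σ hσ => ⟨hσ.1, ?_⟩⟩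
  obtain ⟨x, hx, hxK⟩ := not_subset.1 hσ.2
  exact ⟨x, hx, by simpa using hxK⟩

/-- The cycles of `C_*(X, ∂_∞V)`. -/
def endCycles (V : Set X) (k : ℕ) : AddSubgroup (Chain X k) where
  carrier := {a | a ∈ endChains V k ∧ boundary a = 0}
  zero_mem' := ⟨zero_mem _, boundary_zero⟩
  add_mem' {a b} ha hb := ⟨add_mem ha.1 hb.1, by
    rw [boundary_add (.of_mem ha.1) (.of_mem hb.1), ha.2, hb.2, add_zero]⟩
  neg_mem' {a} ha := ⟨neg_mem ha.1, by rw [boundary_neg, ha.2, neg_zero]⟩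

/-- The boundaries of `C_*(X, ∂_∞V)`. -/
def endBoundaries (V : Set X) (k : ℕ) : AddSubgroup (Chain X k) where
  carrier := {a | ∃ e ∈ endChains V (k + 1), a = boundary e}
  zero_mem' := ⟨0, zero_mem _, (boundary_zero (k := k + 1)).symm⟩
  add_mem' := by
    rintro a b ⟨e, he, rfl⟩ ⟨e', he', rfl⟩
    exact ⟨e + e', add_mem he he', (boundary_add (.of_mem he) (.of_mem he')).symm⟩
  neg_mem' := by
    rintro a ⟨e, he, rfl⟩
    exact ⟨-e, neg_mem he, (boundary_neg e).symm⟩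

theorem mem_endCycles {V : Set X} {k : ℕ} {a : Chain X k} : a ∈ endCycles V k ↔
    a ∈ endChains V k ∧ boundary a = 0 := Iff.rfl

theorem mem_endBoundaries {V : Set X} {k : ℕ} {a : Chain X k} : a ∈ endBoundaries V k ↔
    ∃ e ∈ endChains V (k + 1), a = boundary e := Iff.rfl

/-- The homology group `H_k(X, ∂_∞V)`. In particular `H_k(X, ∂_∞X)` is `EndHomology univ k`. -/
abbrev EndHomology (V : Set X) (k : ℕ) : Type _ :=
  endCycles V k ⧸ (endBoundaries V k).addSubgroupOf (endCycles V k)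

/-- The cochain group `C^k(X, ∂_∞W) = colim_K C^k(X, W \ K)`: cochains that vanish on the
simplices in `W \ K`, for some compact `K`. For `W = ∅` these are all cochains. -/
def endCochains (W : Set X) (k : ℕ) : AddSubgroup (Cochain X k) where
  carrier := {φ | ∃ K : Set X, IsCompact K ∧
    ∀ σ : Simplex X k, range σ ⊆ W \ K → φ σ = 0}
  zero_mem' := ⟨∅, isCompact_empty, fun _ _ => rfl⟩
  add_mem' := by
    rintro φ ψ ⟨K, hK, hφ⟩ ⟨L, hL, hψ⟩
    refine ⟨K ∪ L, hK.union hL, fun σ hσ => ?_⟩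
    rw [Pi.add_apply, hφ σ (hσ.trans (sdiff_subset_sdiff_right subset_union_left)),
      hψ σ (hσ.trans (sdiff_subset_sdiff_right subset_union_right)), add_zero]
  neg_mem' := by
    rintro φ ⟨K, hK, hφ⟩
    exact ⟨K, hK, fun σ hσ => by rw [Pi.neg_apply, hφ σ hσ, neg_zero]⟩

theorem mem_endCochains {W : Set X} {k : ℕ} {φ : Cochain X k} : φ ∈ endCochains W k ↔
    ∃ K : Set X, IsCompact K ∧ ∀ σ : Simplex X k, range σ ⊆ W \ K → φ σ = 0 := Iff.rfl

/-- The cocycles of `C^*(X, ∂_∞W)`. -/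
def endCocycles (W : Set X) (k : ℕ) : AddSubgroup (Cochain X k) :=
  endCochains W k ⊓ (coboundary k).ker

/-- The coboundaries of `C^*(X, ∂_∞W)`. -/
def endCoboundaries (W : Set X) : (k : ℕ) → AddSubgroup (Cochain X k)
  | 0 => ⊥
  | k + 1 => (endCochains W k).map (coboundary k)

/-- The cohomology group `H^k(X, ∂_∞W)`. -/
abbrev EndCohomology (W : Set X) (k : ℕ) : Type _ :=
  endCocycles W k ⧸ (endCoboundaries W k).addSubgroupOf (endCocycles W k)

/-- The cohomology group `H^k(X)`. -/
abbrev Cohomology (X : Type*) [TopologicalSpace X] (k : ℕ) : Type _ :=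
  EndCohomology (∅ : Set X) k

theorem mem_endCochains_empty {k : ℕ} (φ : Cochain X k) : φ ∈ endCochains (∅ : Set X) k := by
  refine mem_endCochains.2 ⟨∅, isCompact_empty, fun σ hσ => ?_⟩
  obtain ⟨x, hx⟩ := range_simplex_nonempty σ
  exact absurd (hσ hx).1 (notMem_empty x)

/-- The natural map `H^k(X, ∂_∞W) → H^k(X)`. -/
def forgetEnds (W : Set X) (k : ℕ) : EndCohomology W k →+ Cohomology X k :=
  QuotientAddGroup.map _ _
    (AddSubgroup.inclusion fun _ hφ => ⟨mem_endCochains_empty _, hφ.2⟩)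
    (by
      rintro ⟨φ, hφ⟩ h
      cases k with
      | zero => exact h
      | succ k =>
        obtain ⟨ψ, -, hψ⟩ := h
        exact ⟨ψ, mem_endCochains_empty ψ, hψ⟩)

/-- The pull-back of cochains. -/
def pullCochain (f : C(X, Y)) (k : ℕ) : Cochain Y k →+ Cochain X k where
  toFun φ σ := φ (f.comp σ)
  map_zero' := rfl
  map_add' _ _ := rfl

theorem coboundary_pullCochain (f : C(X, Y)) (k : ℕ) (φ : Cochain Y k) :
    coboundary k (pullCochain f k φ) = pullCochain f (k + 1) (coboundary k φ) := rfl

/-- The pull-back `f^* : H^k(Y) → H^k(X)`. -/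
def pullback (f : C(X, Y)) (k : ℕ) : Cohomology Y k →+ Cohomology X k :=
  QuotientAddGroup.map _ _
    (((pullCochain f k).comp (endCocycles (∅ : Set Y) k).subtype).codRestrict
      (endCocycles (∅ : Set X) k) (by
        rintro ⟨φ, hφ⟩
        refine ⟨mem_endCochains_empty _, ?_⟩
        change coboundary k (pullCochain f k φ) = 0
        rw [coboundary_pullCochain, show coboundary k φ = 0 from hφ.2, map_zero]))
    (by
      rintro ⟨φ, hφ⟩ h
      cases k with
      | zero =>
        have h0 : φ = 0 := h
        subst h0
        exact rfl
      | succ k =>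
        obtain ⟨ψ, -, hψ⟩ := h
        refine ⟨pullCochain f k ψ, mem_endCochains_empty _, ?_⟩
        rw [coboundary_pullCochain, hψ]
        rfl)

end Ends

/-! ### Restriction and push-forward in homology -/

section Maps

variable {X Y : Type*} [TopologicalSpace X] [TopologicalSpace Y]

open Classical in
/-- Discard the simplices that lie in `A`. -/
def truncate (A : Set X) {k : ℕ} (a : Chain X k) : Chain X k :=
  fun σ => if range σ ⊆ A then 0 else a σ

theorem truncate_of_not {A : Set X} {k : ℕ} (a : Chain X k) {σ : Simplex X k}
    (h : ¬ range σ ⊆ A) : truncate A a σ = a σ := if_neg h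

theorem truncate_finite {V A : Set X} (h : ∃ K, IsCompact K ∧ V \ K ⊆ A) {k : ℕ} {a : Chain X k}
    (ha : a ∈ endChains V k) : {σ | truncate A a σ ≠ 0}.Finite := by
  obtain ⟨K, hK, hA⟩ := h
  refine (ha K hK).subset fun σ hσ => ?_
  have hs : ¬ range σ ⊆ A := fun hs => hσ (if_pos hs)
  rw [mem_ofPred_eq, truncate_of_not a hs] at hσ
  exact ⟨hσ, fun h => hs (h.trans hA)⟩

/-- The restriction `H_k(X, ∂_∞V) → H_k(X, A)`, defined as soon as `A` contains `V` near
infinity. -/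
def restrict (V A : Set X) (h : ∃ K, IsCompact K ∧ V \ K ⊆ A) (k : ℕ) :
    EndHomology V k →+ RelHomology A k :=
  QuotientAddGroup.map _ _
    (({ toFun := truncate A
        map_zero' := by ext; simp [truncate]
        map_add' := fun a b => by ext σ; by_cases hs : range σ ⊆ A <;> simp [truncate, hs] } :
        Chain X k →+ Chain X k).comp (endCycles V k).subtype |>.codRestrict (relCycles A k) (by
      rintro ⟨a, ha⟩
      refine mem_relCycles.2 ⟨truncate_finite h ha.1, fun ρ hρ => ?_⟩
      refine (boundary_congr (fun σ hσ => truncate_of_not a hσ) ρ hρ).trans ?_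
      rw [ha.2]
      rfl))
    (by
      rintro ⟨a, ha⟩ h'
      obtain ⟨e, he, hae⟩ := mem_endBoundaries.1 h'
      refine mem_relBoundaries.2 ⟨truncate A e, truncate_finite h he, fun ρ hρ => ?_⟩
      refine (truncate_of_not a hρ).trans ?_
      rw [boundary_congr (fun σ hσ => truncate_of_not e hσ) ρ hρ]
      exact congrFun hae ρ)

theorem transfer_transfer {R S T : Type*} {w : R → S → ℤ} {v : S → T → ℤ} {a : R → ℤ} (t : T)
    (F : Finset R) (hF : ∀ r s, v s t ≠ 0 → w r s ≠ 0 → a r ≠ 0 → r ∈ F)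
    (hw : ∀ r, {s | w r s ≠ 0}.Finite) :
    transfer v (transfer w a) t = ∑ r ∈ F, a r * ∑ᶠ s, w r s * v s t := by
  have h1 : ∀ s, transfer w a s * v s t = ∑ r ∈ F, a r * (w r s * v s t) := by
    intro s
    by_cases hv : v s t = 0
    · simp [hv]
    · have : transfer w a s = ∑ r ∈ F, a r * w r s := by
        refine finsum_eq_sum_of_support_subset _ fun r hr => ?_
        have h := mul_ne_zero_iff.1 hr
        exact hF r s hv h.2 h.1
      rw [this, Finset.sum_mul]
      exact Finset.sum_congr rfl fun r _ => by ring
  have hfin : ∀ r, {s | w r s * v s t ≠ 0}.Finite := fun r =>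
    (hw r).subset fun s hs => (mul_ne_zero_iff.1 hs).1
  calc transfer v (transfer w a) t = ∑ᶠ s, ∑ r ∈ F, a r * (w r s * v s t) :=
        finsum_congr h1
    _ = ∑ r ∈ F, ∑ᶠ s, a r * (w r s * v s t) :=
        finsum_sum_comm F _ fun r _ =>
          (hfin r).subset fun s hs => (mul_ne_zero_iff.1 hs).2
    _ = _ := Finset.sum_congr rfl fun r _ => (mul_finsum _ _).symm

theorem incidence_finite {k : ℕ} (σ : Simplex X (k + 1)) : {ρ | incidence σ ρ ≠ 0}.Finite := by
  classical
  refine (finite_range fun i => face i σ).subset fun ρ hρ => ?_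
  obtain ⟨i, -, hi⟩ := Finset.exists_ne_zero_of_sum_ne_zero hρ
  exact ⟨i, by by_contra hne; simp [hne] at hi⟩

/-- Push-forward commutes with the boundary. -/
theorem boundary_pushChain (g : C(X, Y)) {k : ℕ} {a : Chain X k}
    (ha : ∀ L : Set Y, IsCompact L → {σ | a σ ≠ 0 ∧ (range (g.comp σ) ∩ L).Nonempty}.Finite) :
    boundary (pushChain g a) = pushChain g (boundary a) := by
  classical
  cases k with
  | zero => ext ρ; simp [boundary, pushChain, transfer]
  | succ k =>
    ext ρ
    set F := (ha _ (isCompact_range_simplex ρ)).toFinset with hFdef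
    have key : ∀ σ : Simplex X (k + 1), a σ ≠ 0 → range ρ ⊆ range (g.comp σ) → σ ∈ F := by
      intro σ h1 h2
      rw [hFdef, Finite.mem_toFinset]
      exact ⟨h1, by rw [inter_eq_self_of_subset_right h2]; exact range_simplex_nonempty ρ⟩
    have e1 : boundary (pushChain g a) ρ = ∑ σ ∈ F, a σ * incidence (g.comp σ) ρ := by
      refine (transfer_transfer (v := incidence) ρ F ?_ ?_).trans ?_
      · intro σ τ h1 h2 h3
        have : g.comp σ = τ := by by_contra hne; simp [hne] at h2
        subst this
        exact key σ h3 (range_subset_of_incidence h1)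
      · intro σ
        refine (finite_singleton (g.comp σ)).subset fun τ hτ => ?_
        by_contra hne
        exact hτ (if_neg fun h => hne h.symm)
      · refine Finset.sum_congr rfl fun σ _ => ?_
        refine congrArg (a σ * ·) ((finsum_eq_single _ (g.comp σ) ?_).trans ?_)
        rotate_left
        · simp
        · intro τ hτ
          simp [hτ.symm]
    have e2 : pushChain g (boundary a) ρ = ∑ σ ∈ F, a σ * incidence (g.comp σ) ρ := by
      refine (transfer_transfer (w := incidence) ρ F ?_ incidence_finite).trans ?_
      · intro σ τ h1 h2 h3
        have : g.comp τ = ρ := by by_contra hne; simp [hne] at h1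
        subst this
        refine key σ h3 ?_
        have h := range_subset_of_incidence h2
        rintro _ ⟨t, rfl⟩
        obtain ⟨s, hs⟩ := h ⟨t, rfl⟩
        exact ⟨s, congrArg g hs⟩
      · refine Finset.sum_congr rfl fun σ _ => ?_
        congr 1
        have h3 : ∀ τ : Simplex X k, incidence σ τ * (if g.comp τ = ρ then (1 : ℤ) else 0)
            = ∑ i : Fin (k + 2),
              if face i σ = τ then (if g.comp τ = ρ then (-1 : ℤ) ^ (i : ℕ) else 0) else 0 := by
          intro τ
          rw [incidence, Finset.sum_mul]
          refine Finset.sum_congr rfl fun i _ => ?_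
          split_ifs <;> simp
        rw [finsum_congr h3, finsum_sum_comm]
        · refine Finset.sum_congr rfl fun i _ => ?_
          rw [finsum_eq_single _ (face i σ)]
          · rw [if_pos rfl]; rfl
          · intro τ hτ
            rw [if_neg hτ.symm]
        · intro i _
          refine (finite_singleton (face i σ)).subset fun τ hτ => ?_
          by_contra hne
          exact hτ (if_neg fun h => hne h.symm)
    rw [e1]
    exact e2.symm

theorem exists_of_pushChain_ne_zero (g : C(X, Y)) {k : ℕ} {a : Chain X k} {ρ : Simplex Y k}
    (h : pushChain g a ρ ≠ 0) : ∃ σ, a σ ≠ 0 ∧ g.comp σ = ρ := by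
  classical
  obtain ⟨σ, hσ⟩ := exists_of_transfer_ne_zero h
  have h' := mul_ne_zero_iff.1 hσ
  exact ⟨σ, h'.1, by by_contra hne; simp [hne] at h'⟩

theorem pushChain_add (g : C(X, Y)) {k : ℕ} {a b : Chain X k}
    (ha : ∀ ρ, {σ | a σ ≠ 0 ∧ g.comp σ = ρ}.Finite)
    (hb : ∀ ρ, {σ | b σ ≠ 0 ∧ g.comp σ = ρ}.Finite) :
    pushChain g (a + b) = pushChain g a + pushChain g b := by
  classical
  have aux : ∀ {c : Chain X k}, (∀ ρ, {σ | c σ ≠ 0 ∧ g.comp σ = ρ}.Finite) → ∀ ρ,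
      {σ | c σ * (if g.comp σ = ρ then (1 : ℤ) else 0) ≠ 0}.Finite := by
    intro c hc ρ
    refine (hc ρ).subset fun σ hσ => ?_
    have h' := mul_ne_zero_iff.1 hσ
    exact ⟨h'.1, by by_contra hne; simp [hne] at h'⟩
  ext ρ
  simp only [pushChain, transfer, Pi.add_apply, add_mul]
  exact finsum_add_distrib (aux ha ρ) (aux hb ρ)

theorem pushChain_zero (g : C(X, Y)) {k : ℕ} : pushChain g (0 : Chain X k) = 0 := by
  ext; simp [pushChain, transfer]

theorem finite_pushChain (g : C(X, Y)) {k : ℕ} {a : Chain X k} (ha : {σ | a σ ≠ 0}.Finite) :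
    {ρ | pushChain g a ρ ≠ 0}.Finite := by
  refine (ha.image fun σ => g.comp σ).subset fun ρ hρ => ?_
  obtain ⟨σ, h1, h2⟩ := exists_of_pushChain_ne_zero g hρ
  exact ⟨σ, h1, h2⟩

/-- The map `H_k(X, A) → H_k(Y, B)` induced by a continuous map of pairs. -/
def relMap (g : C(X, Y)) {A : Set X} {B : Set Y} (h : MapsTo g A B) (k : ℕ) :
    RelHomology A k →+ RelHomology B k :=
  have push_sub : ∀ {j : ℕ} {a : Chain X j}, (∀ σ : Simplex X j, ¬ range σ ⊆ A → a σ = 0) →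
      ∀ ρ : Simplex Y j, ¬ range ρ ⊆ B → pushChain g a ρ = 0 := by
    intro j a ha ρ hρ
    by_contra hne
    obtain ⟨σ, h1, rfl⟩ := exists_of_pushChain_ne_zero g hne
    refine hρ ?_
    have hs : range σ ⊆ A := by
      by_contra hs
      exact h1 (ha σ hs)
    rintro _ ⟨t, rfl⟩
    exact h (hs ⟨t, rfl⟩)
  have bd : ∀ {j : ℕ} {a : Chain X j}, {σ | a σ ≠ 0}.Finite →
      boundary (pushChain g a) = pushChain g (boundary a) := fun ha =>
    boundary_pushChain g fun _ _ => ha.subset fun _ hσ => hσ.1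
  QuotientAddGroup.map _ _
    { toFun := fun z => ⟨pushChain g z.1, mem_relCycles.2 ⟨finite_pushChain g (mem_relCycles.1 z.2).1,
        fun ρ hρ => by
          rw [bd (mem_relCycles.1 z.2).1]
          exact push_sub (mem_relCycles.1 z.2).2 ρ hρ⟩⟩
      map_zero' := Subtype.ext (pushChain_zero g)
      map_add' := fun z z' => Subtype.ext <| pushChain_add g
        (fun _ => (mem_relCycles.1 z.2).1.subset fun _ hσ => hσ.1)
        (fun _ => (mem_relCycles.1 z'.2).1.subset fun _ hσ => hσ.1) }
    (by
      rintro ⟨z, hz⟩ h'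
      obtain ⟨e, he, hze⟩ := mem_relBoundaries.1 h'
      replace hze : ∀ ρ : Simplex X k, ¬ range ρ ⊆ A → z ρ = boundary e ρ := hze
      refine mem_relBoundaries.2 ⟨pushChain g e, finite_pushChain g he, fun ρ hρ => ?_⟩
      change pushChain g z ρ = _
      rw [bd he]
      have hbe : {σ | boundary e σ ≠ 0}.Finite := by
        refine (he.biUnion fun σ _ => incidence_finite σ).subset fun ρ hρ => ?_
        obtain ⟨σ, hσ⟩ := exists_of_transfer_ne_zero hρ
        have h' := mul_ne_zero_iff.1 hσ
        exact mem_biUnion (x := σ) h'.1 h'.2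
      change pushChain g z ρ = pushChain g (boundary e : Chain X k) ρ
      change {σ | (boundary e : Chain X k) σ ≠ 0}.Finite at hbe
      obtain ⟨b, hb⟩ : ∃ b : Chain X k, b = boundary e := ⟨_, rfl⟩
      rw [← hb] at hbe ⊢
      replace hze : ∀ ρ : Simplex X k, ¬ range ρ ⊆ A → z ρ = b ρ := hb ▸ hze
      have hsplit : z = (z - b) + b := by ext; simp
      have hd : {σ | (z - b) σ ≠ 0}.Finite := by
        refine (hz.1.union hbe).subset fun σ hσ => ?_
        by_contra hne
        simp only [mem_union, mem_ofPred_eq, not_or, not_not] at hne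
        exact hσ (by rw [Pi.sub_apply, hne.1, not_not.1 hne.2, sub_zero])
      rw [hsplit, pushChain_add g (fun _ => hd.subset fun _ hσ => hσ.1)
        (fun _ => hbe.subset fun _ hσ => hσ.1), Pi.add_apply,
        push_sub (fun σ hσ => by simp [hze σ hσ]) ρ hρ, zero_add])

/-- The push-forward `H_k(X, ∂_∞X) → H_k(Y, ∂_∞Y)` along a proper map. -/
def pushforward (g : C(X, Y)) (hg : ∀ K, IsCompact K → IsCompact (g ⁻¹' K)) (k : ℕ) :
    EndHomology (univ : Set X) k →+ EndHomology (univ : Set Y) k :=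
  have fin : ∀ {j : ℕ} {a : Chain X j}, a ∈ endChains univ j → ∀ L : Set Y, IsCompact L →
      {σ | a σ ≠ 0 ∧ (range (g.comp σ) ∩ L).Nonempty}.Finite := by
    intro j a ha L hL
    refine (LocFin.of_mem ha _ (hg L hL)).subset fun σ hσ => ⟨hσ.1, ?_⟩
    obtain ⟨_, ⟨t, rfl⟩, ht⟩ := hσ.2
    exact ⟨σ t, ⟨t, rfl⟩, ht⟩
  have fin' : ∀ {j : ℕ} {a : Chain X j}, a ∈ endChains univ j → ∀ ρ : Simplex Y j,
      {σ | a σ ≠ 0 ∧ g.comp σ = ρ}.Finite := by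
    intro j a ha ρ
    refine (fin ha _ (isCompact_range_simplex ρ)).subset fun σ hσ => ⟨hσ.1, ?_⟩
    rw [hσ.2, inter_self]
    exact range_simplex_nonempty ρ
  have mem : ∀ {j : ℕ} {a : Chain X j}, a ∈ endChains univ j →
      pushChain g a ∈ endChains univ j := by
    intro j a ha
    refine mem_endChains_univ.2 fun L hL => ?_
    refine ((fin ha L hL).image fun σ => g.comp σ).subset fun ρ hρ => ?_
    obtain ⟨σ, h1, h2⟩ := exists_of_pushChain_ne_zero g hρ.1
    exact ⟨σ, ⟨h1, by rw [h2]; exact hρ.2⟩, h2⟩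
  QuotientAddGroup.map _ _
    { toFun := fun z => ⟨pushChain g z.1, mem z.2.1, by
        rw [boundary_pushChain g (fin z.2.1), z.2.2, pushChain_zero]⟩
      map_zero' := Subtype.ext (pushChain_zero g)
      map_add' := fun z z' => Subtype.ext (pushChain_add g (fin' z.2.1) (fin' z'.2.1)) }
    (by
      rintro ⟨z, hz⟩ h'
      obtain ⟨e, he, hze⟩ := mem_endBoundaries.1 h'
      replace hze : z = boundary e := hze
      subst hze
      exact mem_endBoundaries.2
        ⟨pushChain g e, mem he, (boundary_pushChain g (fin he)).symm⟩)

end Maps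

/-! ### Fundamental classes and the degree of a quasi-proper map -/

section Degree

variable {X Y : Type*} [TopologicalSpace X] [TopologicalSpace Y]

theorem compl_near_infinity {K : Set X} (hK : IsCompact K) :
    ∃ L, IsCompact L ∧ univ \ L ⊆ Kᶜ := ⟨K, hK, fun _ hx => hx.2⟩

/-- `c ∈ H_n(X, ∂_∞X)` is a fundamental class (of an orientation) of the `n`-manifold `X`: at every
point `x` it restricts to a generator of the infinite cyclic group `H_n(X, X \ {x})`. An orientable
manifold is a manifold that has a fundamental class; choosing one is choosing an orientation. -/
def IsFundamentalClass (n : ℕ) (c : EndHomology (univ : Set X) n) : Prop :=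
  ∀ x : X, ∃ e : RelHomology ({x}ᶜ : Set X) n ≃+ ℤ,
    e (restrict univ {x}ᶜ (compl_near_infinity isCompact_singleton) n c) = 1

/-- `c'` is the restriction of `c ∈ H_n(X, ∂_∞X)` to the open set `U`: for every compact `K ⊆ U`,
the classes `c` and `c'` have the same image in `H_n(X, X \ K)`, which is isomorphic to
`H_n(U, U \ K)` by excision. -/
def IsRestriction (n : ℕ) (U : Set X) (c : EndHomology (univ : Set X) n)
    (c' : EndHomology (univ : Set U) n) : Prop :=
  ∀ (K : Set U) (hK : IsCompact K),
    restrict univ ((Subtype.val '' K)ᶜ) (compl_near_infinity (hK.image continuous_subtype_val)) n c =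
      relMap (⟨Subtype.val, continuous_subtype_val⟩ : C(U, X)) (A := Kᶜ) (B := (Subtype.val '' K)ᶜ)
        (fun x hx => by
          rintro ⟨y, hy, hyx⟩
          exact hx (Subtype.ext hyx ▸ hy)) n
        (restrict univ Kᶜ (compl_near_infinity hK) n c')

/-- The set `S_∞ = ⋂_K closure (f (X \ K))` of limits of `f` at infinity, `K` running over the
compact subsets of `X`. -/
def limitSet (f : C(X, Y)) : Set Y := ⋂ (K : Set X) (_ : IsCompact K), closure (f '' Kᶜ)

/-- Away from `S_∞`, the map `f` is proper. -/
theorem isCompact_preimage_restrict [T2Space Y] (f : C(X, Y)) (K : Set ↥(limitSet f)ᶜ)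
    (hK : IsCompact K) : IsCompact ((f.restrictPreimage (limitSet f)ᶜ) ⁻¹' K) := by
  set L : Set Y := Subtype.val '' K with hL
  have hLc : IsCompact L := hK.image continuous_subtype_val
  have hLd : L ∩ limitSet f = ∅ := by
    ext y
    simp only [mem_inter_iff, mem_empty_iff_false, iff_false, not_and]
    rintro ⟨z, -, rfl⟩
    exact z.2
  obtain ⟨C, hC, hCL⟩ : ∃ C : Set X, IsCompact C ∧ L ∩ closure (f '' Cᶜ) = ∅ := by
    have hdir : Directed (· ⊇ ·) fun C : {C : Set X // IsCompact C} => closure (f '' C.1ᶜ) :=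
      fun C D => ⟨⟨C.1 ∪ D.1, C.2.union D.2⟩,
        closure_mono (image_mono (compl_subset_compl.2 subset_union_left)),
        closure_mono (image_mono (compl_subset_compl.2 subset_union_right))⟩
    have : Nonempty {C : Set X // IsCompact C} := ⟨⟨∅, isCompact_empty⟩⟩
    obtain ⟨C, hC⟩ := hLc.elim_directed_family_closed
      (fun C : {C : Set X // IsCompact C} => closure (f '' C.1ᶜ)) (fun C => isClosed_closure)
      (by rw [iInter_subtype]; exact hLd) hdir
    exact ⟨C.1, C.2, hC⟩
  have hsub : f ⁻¹' L ⊆ C := by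
    intro x hx
    by_contra hxC
    have : f x ∈ L ∩ closure (f '' Cᶜ) := ⟨hx, subset_closure ⟨x, hxC, rfl⟩⟩
    rw [hCL] at this
    exact this
  have hcomp : IsCompact (f ⁻¹' L) :=
    hC.of_isClosed_subset (hLc.isClosed.preimage f.continuous) hsub
  rw [Subtype.isCompact_iff]
  convert hcomp using 1
  ext x
  constructor
  · rintro ⟨z, hz, rfl⟩
    exact ⟨_, hz, rfl⟩
  · rintro ⟨y, hy, hyx⟩
    exact ⟨⟨x, by rw [mem_preimage, ← hyx]; exact y.2⟩, by
      rw [mem_preimage]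
      convert hy using 1
      exact Subtype.ext hyx.symm, rfl⟩

/-- `f` is quasi-proper of degree `d` with respect to the fundamental classes `cX` and `cY`: the set
`S_∞` consists of discrete points, and `[X]`, restricted to `f⁻¹(Y \ S_∞)` and pushed forward to
`Y \ S_∞`, is `d` times the fundamental class of `Y \ S_∞`, which is the restriction of `[Y]`. -/
def HasDegree [T2Space Y] (n : ℕ) (f : C(X, Y)) (cX : EndHomology (univ : Set X) n)
    (cY : EndHomology (univ : Set Y) n) (d : ℤ) : Prop :=
  DiscreteTopology ↥(limitSet f) ∧
    ∃ (a : EndHomology (univ : Set ↥(f ⁻¹' (limitSet f)ᶜ)) n)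
      (b : EndHomology (univ : Set ↥(limitSet f)ᶜ) n),
      IsRestriction n (f ⁻¹' (limitSet f)ᶜ) cX a ∧ IsRestriction n (limitSet f)ᶜ cY b ∧
        pushforward (f.restrictPreimage (limitSet f)ᶜ) (isCompact_preimage_restrict f) n a = d • b

end Degree

/-! ### Aspherical classes and SYS manifolds -/

section Aspherical

variable {X : Type*} [TopologicalSpace X]

open Classical in
/-- The chain that consists of one simplex. -/
def single {k : ℕ} (σ : Simplex X k) : Chain X k := Pi.single σ 1

/-- The boundary of the standard `2`-simplex. -/
def triangleBoundary : Set (stdSimplex ℝ (Fin 3)) := {t | ∃ i, t i = 0}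

/-- The class of the relative cycle `z` comes from a disc `(Δ², ∂Δ²) → (X, A)`, or from a sphere
`Δ²/∂Δ² → X` (the constant simplex is subtracted to obtain an absolute cycle). -/
def IsSphericalCycle (A : Set X) (z : Chain X 2) : Prop :=
  (∃ σ : Simplex X 2, MapsTo σ triangleBoundary A ∧ z = single σ) ∨
    ∃ (σ : Simplex X 2) (x : X), MapsTo σ triangleBoundary {x} ∧
      z = single σ - single (ContinuousMap.const _ x)

/-- The image of the Hurewicz map `π_2(X, A) → H_2(X, A)`, all base points and all components of
`A` being allowed: the subgroup generated by the classes of maps of discs `(D², S¹) → (X, A)` and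
of spheres in `X`. For `A = ∅` it is the image of `π_2(X) → H_2(X)`. -/
def hurewiczImage (A : Set X) : AddSubgroup (RelHomology A 2) :=
  AddSubgroup.closure {h | ∃ z : relCycles A 2, IsSphericalCycle A z.1 ∧ (z : RelHomology A 2) = h}

theorem compl_contains_end {V Ω : Set X} (h : IsCompact (closure (symmDiff Ω Vᶜ))) :
    ∃ K, IsCompact K ∧ V \ K ⊆ Ωᶜ :=
  ⟨_, h, fun _ hx hΩ => hx.2 (subset_closure (Or.inl ⟨hΩ, fun hc => hc hx.1⟩))⟩

/-- `τ ∈ H_2(X, ∂_∞V)` is spherical: for every closed `Ω` such that the closure of `Ω Δ Vᶜ` is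
compact, the restriction of `τ` to `H_2(X, X \ Ω)` is in the image of the Hurewicz map. -/
def IsSpherical (V : Set X) (τ : EndHomology V 2) : Prop :=
  ∀ Ω : Set X, IsClosed Ω → ∀ h : IsCompact (closure (symmDiff Ω Vᶜ)),
    restrict V Ωᶜ (compl_contains_end h) 2 τ ∈ hurewiczImage Ωᶜ

/-- `τ = c ⌢ (β₁ ⌣ β 0 ⌣ β 1 ⌣ ⋯ ⌣ β (n - 4))` in `H_2(X, ∂_∞V)`, where `c ∈ H_n(X, ∂_∞X)`,
`β₁ ∈ H^1(X, ∂_∞Vᶜ)` and `β i ∈ H^1(X)`: this holds for representing cycles and cocycles. -/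
def IsCapProduct {n : ℕ} (hn : 3 ≤ n) (c : EndHomology (univ : Set X) n) (V : Set X)
    (β₁ : EndCohomology Vᶜ 1) (β : Fin (n - 3) → Cohomology X 1) (τ : EndHomology V 2) : Prop :=
  ∃ (a : endCycles (univ : Set X) n) (φ₁ : endCocycles Vᶜ 1)
    (φ : Fin (n - 3) → endCocycles (∅ : Set X) 1) (z : endCycles V 2),
    (a : EndHomology (univ : Set X) n) = c ∧ (φ₁ : EndCohomology Vᶜ 1) = β₁ ∧
      (∀ i, (φ i : Cohomology X 1) = β i) ∧ (z : EndHomology V 2) = τ ∧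
      z.1 = cap (p := 1 + (n - 3)) (by omega) a.1 (cup φ₁.1 (cupProd (n - 3) fun i => (φ i).1))

/-- The data `V`, `β₁ ∈ H^1(X, ∂_b X)`, `β i ∈ H^1(X)` exhibit the oriented `n`-manifold `X`, with
fundamental class `c`, as an SYS manifold: `V` has compact boundary and, with
`∂_s X = ∂_∞V` and `∂_b X = ∂_∞Vᶜ`, the class `c ⌢ (β₁ ⌣ ⋯)` in `H_2(X, ∂_s X)` is aspherical. -/
def IsSYSData {n : ℕ} (hn : 3 ≤ n) (c : EndHomology (univ : Set X) n) (V : Set X)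
    (β₁ : EndCohomology Vᶜ 1) (β : Fin (n - 3) → Cohomology X 1) : Prop :=
  IsCompact (frontier V) ∧
    ∃ τ : EndHomology V 2, IsCapProduct hn c V β₁ β τ ∧ ¬ IsSpherical V τ

/-- The (possibly open) oriented `n`-manifold `X` with fundamental class `c` is SYS. -/
def IsSYS {n : ℕ} (hn : 3 ≤ n) (c : EndHomology (univ : Set X) n) : Prop :=
  ∃ (V : Set X) (β₁ : EndCohomology Vᶜ 1) (β : Fin (n - 3) → Cohomology X 1),
    IsSYSData hn c V β₁ β

end Aspherical

end SYS

end

/-! Let `S` be the limit set of `f`. It is closed and discrete, so compact sets meet it in finitely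
many points, and `f` is proper over its complement. Represent `β₁` by a cocycle that vanishes on the
simplices of `Vᶜ \ K` with `K` compact. Choose an open `U ⊆ Vᶜ \ K` that differs from `Vᶜ` only
inside a compact set and whose compact frontier misses `S` (`exists_open_near_infinity`). Then `W =
f⁻¹(Uᶜ)` has compact frontier, the pulled-back cocycle vanishes on `Wᶜ`, and the cap product of
`[M]` with the pulled-back classes lives in `H_2(M, ∂_∞W)`. It remains to see that the class on `N`
is spherical if the one on `M` is (`HasDegree.isSpherical`).

Let `Ω` be a closed test set for `N`; it differs from `U` by a relatively compact set. If the
closure of `Ω Δ U` misses `S`, its preimage is compact, `f⁻¹(Ω)` is a test set for `M`, and the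
degree formula `f_*([M] ⌢ f^*β) = ±[N] ⌢ β` in `H_2(N, N \ Ω)` (`HasDegree.relMap_restrict_cap`)
settles the matter, since push-forwards of spherical classes are spherical.

In general `Ω` is first enlarged to `Ω₁` by compact neighbourhoods of the finitely many bad points.
Small open balls about the bad points outside `U` are then removed, which gives a set `Ω₂` of the
good kind (`exists_adapted_closed`). Sphericity over `Ω₂` implies sphericity over `Ω₁`: the balls
can be contracted to their centres by homotopies that are fixed on `N \ Ω₁`, a disc whose boundary
is collapsed to a point is a sphere, and adding an isolated point to the subspace is injective on
`H_2` (`mem_hurewiczImage_of_contractible`). From `Ω₁` one returns to the smaller set `Ω` by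
functoriality.

For the degree formula put `A = N \ Ω`. A simplex that lies neither in `A` nor in `U` meets `Ω Δ U`,
so only a finite part of each fundamental cycle matters. The degree hypothesis makes the
push-forward of one part homologous to `d` times the other up to a chain in `A ∪ U`. Barycentric
subdivision splits that chain into a chain in `A` and one in `U` (`exists_homologous_small`), and
capping with a cocycle that vanishes on `U` leaves a chain in `A`.

If `M` is compact, then `S` is empty, nonzero degree forces `f` to be surjective, and `N` is
compact. -/

noncomputable section

namespace SYS

/-! ### Formal chains of ordered tuples -/

section Tuples

variable {Q R Q' R' : Type*}

/-- Integral combinations of `m`-tuples of elements of `Q`, thought of as affine simplices with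
`m` vertices. The empty tuple in degree `0` serves as augmentation. -/
abbrev TupleChain (Q : Type*) (m : ℕ) : Type _ := (Fin m → Q) →₀ ℤ

/-- The boundary operator of tuples. -/
def tupleBoundary {m : ℕ} : TupleChain Q (m + 1) →ₗ[ℤ] TupleChain Q m :=
  Finsupp.linearCombination ℤ fun v =>
    ∑ i : Fin (m + 1), (-1 : ℤ) ^ (i : ℕ) • Finsupp.single (fun j => v (i.succAbove j)) 1

/-- The cone with apex `b`. -/
def tupleCone (b : Q) {m : ℕ} : TupleChain Q m →ₗ[ℤ] TupleChain Q (m + 1) :=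
  Finsupp.linearCombination ℤ fun v => Finsupp.single (Fin.cons b v : Fin (m + 1) → Q) 1

/-- The map of tuple chains induced by a map of the vertices. -/
def tupleMap (g : Q → R) {m : ℕ} : TupleChain Q m →ₗ[ℤ] TupleChain R m :=
  Finsupp.linearCombination ℤ fun v => Finsupp.single (fun i => g (v i)) 1

theorem tupleBoundary_single {m : ℕ} (v : Fin (m + 1) → Q) :
    tupleBoundary (Finsupp.single v 1) =
      ∑ i : Fin (m + 1), (-1 : ℤ) ^ (i : ℕ) • Finsupp.single (fun j => v (i.succAbove j)) 1 := by
  simp [tupleBoundary]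

@[simp] theorem tupleCone_single (b : Q) {m : ℕ} (v : Fin m → Q) :
    tupleCone b (Finsupp.single v 1) = Finsupp.single (Fin.cons b v : Fin (m + 1) → Q) 1 := by
  simp [tupleCone]

@[simp] theorem tupleMap_single (g : Q → R) {m : ℕ} (v : Fin m → Q) :
    tupleMap g (Finsupp.single v 1) = Finsupp.single (fun i => g (v i)) 1 := by
  simp [tupleMap]

theorem chain_hom_ext {S E : Type*} [AddCommGroup E] {F G : (S →₀ ℤ) →ₗ[ℤ] E}
    (h : ∀ s, F (Finsupp.single s 1) = G (Finsupp.single s 1)) : F = G := by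
  ext s
  exact h s

/-- Deleting the apex returns the tuple; deleting any later vertex gives the cone over a face, with
the sign shifted by one. So coning is a contraction of the augmented complex, and all chain
homotopies below are built from it. -/
theorem tupleBoundary_cone_succ (b : Q) {m : ℕ} (c : TupleChain Q (m + 1)) :
    tupleBoundary (tupleCone b c) = c - tupleCone b (tupleBoundary c) := by
  have : tupleBoundary ∘ₗ tupleCone b =
      LinearMap.id - (tupleCone b (m := m)) ∘ₗ tupleBoundary := by
    refine chain_hom_ext fun v => ?_
    simp only [LinearMap.comp_apply, LinearMap.sub_apply, LinearMap.id_apply, tupleCone_single,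
      tupleBoundary_single, map_sum, map_smul]
    rw [Fin.sum_univ_succ, sub_eq_add_neg, ← Finset.sum_neg_distrib]
    congr 1
    · simp
    · refine Finset.sum_congr rfl fun i _ => ?_
      rw [← neg_smul]
      congr 1
      · simp [pow_succ]
      · congr 1
        funext j
        refine Fin.cases ?_ (fun j => ?_) j <;> simp
  exact LinearMap.congr_fun this c

theorem tupleBoundary_cone_zero (b : Q) (c : TupleChain Q 0) :
    tupleBoundary (tupleCone b c) = c := by
  have : tupleBoundary ∘ₗ tupleCone b = LinearMap.id (M := TupleChain Q 0) := by
    refine chain_hom_ext fun v => ?_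
    simp only [LinearMap.comp_apply, LinearMap.id_apply, tupleCone_single, tupleBoundary_single]
    rw [Fin.sum_univ_one, Fin.val_zero, pow_zero, one_smul]
    congr 1
  exact LinearMap.congr_fun this c

/-- Every tuple is the cone over its tail with apex its first vertex, so the cone formula and
induction replace the usual double sum. -/
theorem tupleBoundary_boundary {m : ℕ} (c : TupleChain Q (m + 2)) :
    tupleBoundary (tupleBoundary c) = 0 := by
  induction m with
  | zero =>
    have : tupleBoundary ∘ₗ tupleBoundary = (0 : TupleChain Q 2 →ₗ[ℤ] TupleChain Q 0) := by
      refine chain_hom_ext fun v => ?_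
      have hv : Finsupp.single v (1 : ℤ) = tupleCone (v 0) (Finsupp.single (Fin.tail v) 1) := by
        rw [tupleCone_single, Fin.cons_self_tail]
      rw [LinearMap.comp_apply, hv, tupleBoundary_cone_succ, map_sub, tupleBoundary_cone_zero,
        sub_self, LinearMap.zero_apply]
    exact LinearMap.congr_fun this c
  | succ m ih =>
    have : tupleBoundary ∘ₗ tupleBoundary = (0 : TupleChain Q (m + 3) →ₗ[ℤ] TupleChain Q (m + 1)) := by
      refine chain_hom_ext fun v => ?_
      have hv : Finsupp.single v (1 : ℤ) = tupleCone (v 0) (Finsupp.single (Fin.tail v) 1) := by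
        rw [tupleCone_single, Fin.cons_self_tail]
      rw [LinearMap.comp_apply, hv, tupleBoundary_cone_succ, map_sub, tupleBoundary_cone_succ, ih,
        map_zero, sub_zero, sub_self, LinearMap.zero_apply]
    exact LinearMap.congr_fun this c

theorem tupleMap_boundary (g : Q → R) {m : ℕ} (c : TupleChain Q (m + 1)) :
    tupleMap g (tupleBoundary c) = tupleBoundary (tupleMap g c) := by
  have : tupleMap g ∘ₗ tupleBoundary = tupleBoundary ∘ₗ tupleMap g (m := m + 1) := by
    refine chain_hom_ext fun v => ?_
    simp only [LinearMap.comp_apply, tupleBoundary_single, map_sum, map_smul, tupleMap_single]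
  exact LinearMap.congr_fun this c

theorem tupleMap_cone (g : Q → R) (b : Q) {m : ℕ} (c : TupleChain Q m) :
    tupleMap g (tupleCone b c) = tupleCone (g b) (tupleMap g c) := by
  have : tupleMap g ∘ₗ tupleCone b = tupleCone (g b) ∘ₗ tupleMap g (m := m) := by
    refine chain_hom_ext fun v => ?_
    simp only [LinearMap.comp_apply, tupleCone_single, tupleMap_single]
    congr 1
    funext j
    refine Fin.cases ?_ (fun j => ?_) j <;> simp
  exact LinearMap.congr_fun this c

/-- Subdivision of tuple chains with respect to a choice `b` of interior points. -/
def subdiv (b : ∀ {m : ℕ}, (Fin (m + 1) → Q) → Q) : ∀ m, TupleChain Q m →ₗ[ℤ] TupleChain Q m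
  | 0 => LinearMap.id
  | m + 1 => Finsupp.linearCombination ℤ fun v =>
      tupleCone (b v) (subdiv b m (tupleBoundary (Finsupp.single v 1)))

/-- The chain homotopy obtained by coning from the points `b`. -/
def coneHomotopy (b : ∀ {m : ℕ}, (Fin (m + 1) → Q) → Q')
    (D : ∀ m, TupleChain Q m →ₗ[ℤ] TupleChain Q' m) :
    ∀ m, TupleChain Q m →ₗ[ℤ] TupleChain Q' (m + 1)
  | 0 => 0
  | m + 1 => Finsupp.linearCombination ℤ fun v => tupleCone (b v)
      (D (m + 1) (Finsupp.single v 1) - coneHomotopy b D m (tupleBoundary (Finsupp.single v 1)))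

variable {b : ∀ {m : ℕ}, (Fin (m + 1) → Q) → Q}

theorem subdiv_single {m : ℕ} (v : Fin (m + 1) → Q) : subdiv b (m + 1) (Finsupp.single v 1) =
    tupleCone (b v) (subdiv b m (tupleBoundary (Finsupp.single v 1))) := by
  simp [subdiv]

/-- By induction the subdivided boundary of a tuple is a cycle, and the cone over a cycle has that
cycle as its boundary. -/
theorem tupleBoundary_subdiv {m : ℕ} (c : TupleChain Q (m + 1)) :
    tupleBoundary (subdiv b (m + 1) c) = subdiv b m (tupleBoundary c) := by
  induction m with
  | zero =>
    have : tupleBoundary ∘ₗ subdiv b 1 = subdiv b 0 ∘ₗ tupleBoundary := by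
      refine chain_hom_ext fun v => ?_
      rw [LinearMap.comp_apply, subdiv_single, tupleBoundary_cone_zero, LinearMap.comp_apply]
    exact LinearMap.congr_fun this c
  | succ m ih =>
    have : tupleBoundary ∘ₗ subdiv b (m + 2) = subdiv b (m + 1) ∘ₗ tupleBoundary := by
      refine chain_hom_ext fun v => ?_
      rw [LinearMap.comp_apply, subdiv_single, tupleBoundary_cone_succ, ih, tupleBoundary_boundary,
        map_zero, map_zero, sub_zero, LinearMap.comp_apply]
    exact LinearMap.congr_fun this c

/-- Naturality requires only that the choice of apices be natural; this is what carries subdivision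
over to singular simplices. -/
theorem tupleMap_subdiv {b' : ∀ {m : ℕ}, (Fin (m + 1) → R) → R} (g : Q → R)
    (hg : ∀ {m : ℕ} (v : Fin (m + 1) → Q), g (b v) = b' fun i => g (v i)) {m : ℕ}
    (c : TupleChain Q m) : tupleMap g (subdiv b m c) = subdiv b' m (tupleMap g c) := by
  induction m with
  | zero => rfl
  | succ m ih =>
    have : tupleMap g ∘ₗ subdiv b (m + 1) = subdiv b' (m + 1) ∘ₗ tupleMap g := by
      refine chain_hom_ext fun v => ?_
      rw [LinearMap.comp_apply, subdiv_single, tupleMap_cone, ih, LinearMap.comp_apply,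
        tupleMap_single, subdiv_single, tupleMap_boundary, tupleMap_single, hg]
    exact LinearMap.congr_fun this c

variable {a : ∀ {m : ℕ}, (Fin (m + 1) → Q) → Q'}
  {D : ∀ m, TupleChain Q m →ₗ[ℤ] TupleChain Q' m}

theorem coneHomotopy_single {m : ℕ} (v : Fin (m + 1) → Q) :
    coneHomotopy a D (m + 1) (Finsupp.single v 1) = tupleCone (a v)
      (D (m + 1) (Finsupp.single v 1) -
        coneHomotopy a D m (tupleBoundary (Finsupp.single v 1))) := by
  simp [coneHomotopy]

/-- The method of acyclic models in its simplest form: by induction `D v` minus the homotopy on `∂v`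
is a cycle, and the cone fills it. One statement yields both the subdivision homotopy (`D = id -
subdivision`) and the prism operator (`D = top - bottom`). -/
theorem tupleBoundary_coneHomotopy (h0 : D 0 = 0)
    (hD : ∀ {m : ℕ} (c : TupleChain Q (m + 1)),
      tupleBoundary (D (m + 1) c) = D m (tupleBoundary c)) {m : ℕ} (c : TupleChain Q (m + 1)) :
    tupleBoundary (coneHomotopy a D (m + 1) c) =
      D (m + 1) c - coneHomotopy a D m (tupleBoundary c) := by
  induction m with
  | zero =>
    have : tupleBoundary ∘ₗ coneHomotopy a D 1 = D 1 - coneHomotopy a D 0 ∘ₗ tupleBoundary := by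
      refine chain_hom_ext fun v => ?_
      rw [LinearMap.comp_apply, coneHomotopy_single, tupleBoundary_cone_succ, map_sub, hD, h0]
      simp [coneHomotopy]
    exact LinearMap.congr_fun this c
  | succ m ih =>
    have : tupleBoundary ∘ₗ coneHomotopy a D (m + 2) =
        D (m + 2) - coneHomotopy a D (m + 1) ∘ₗ tupleBoundary := by
      refine chain_hom_ext fun v => ?_
      rw [LinearMap.comp_apply, coneHomotopy_single, tupleBoundary_cone_succ, map_sub, hD, ih,
        tupleBoundary_boundary, map_zero, sub_zero, sub_self, map_zero, sub_zero]
      rfl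
    exact LinearMap.congr_fun this c

theorem tupleMap_coneHomotopy {a' : ∀ {m : ℕ}, (Fin (m + 1) → R) → R'}
    {D' : ∀ m, TupleChain R m →ₗ[ℤ] TupleChain R' m} (g : Q → R) (g' : Q' → R')
    (hg : ∀ {m : ℕ} (v : Fin (m + 1) → Q), g' (a v) = a' fun i => g (v i))
    (hD : ∀ {m : ℕ} (c : TupleChain Q m), tupleMap g' (D m c) = D' m (tupleMap g c)) {m : ℕ}
    (c : TupleChain Q m) :
    tupleMap g' (coneHomotopy a D m c) = coneHomotopy a' D' m (tupleMap g c) := by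
  induction m with
  | zero => simp [coneHomotopy]
  | succ m ih =>
    have : tupleMap g' ∘ₗ coneHomotopy a D (m + 1) = coneHomotopy a' D' (m + 1) ∘ₗ tupleMap g := by
      refine chain_hom_ext fun v => ?_
      rw [LinearMap.comp_apply, coneHomotopy_single, tupleMap_cone, map_sub, ih, hD,
        LinearMap.comp_apply, tupleMap_boundary, tupleMap_single, coneHomotopy_single, hg]
    exact LinearMap.congr_fun this c

theorem exists_of_mem_support {S T : Type*} {w : S → T →₀ ℤ} {c : S →₀ ℤ} {t : T}
    (h : t ∈ (Finsupp.linearCombination ℤ w c).support) :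
    ∃ s ∈ c.support, t ∈ (w s).support := by
  classical
  rw [Finsupp.linearCombination_apply] at h
  obtain ⟨s, hs, hts⟩ := Finset.mem_biUnion.1 (Finsupp.support_finsetSum h)
  exact ⟨s, hs, Finsupp.support_smul hts⟩

theorem exists_of_mem_support_cone {p : Q} {m : ℕ} {c : TupleChain Q m} {w : Fin (m + 1) → Q}
    (h : w ∈ (tupleCone p c).support) : ∃ v ∈ c.support, w = Fin.cons p v := by
  obtain ⟨v, hv, hw⟩ := exists_of_mem_support h
  exact ⟨v, hv, Finset.mem_singleton.1 (Finsupp.support_single_subset hw)⟩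

end Tuples

/-! ### Finite singular chains -/

section FiniteChains

variable {X Y : Type*} [TopologicalSpace X] [TopologicalSpace Y]

/-- Finite singular chains. -/
abbrev FChain (X : Type*) [TopologicalSpace X] (k : ℕ) : Type _ := Simplex X k →₀ ℤ

/-- The boundary operator of finite singular chains. -/
def fboundary {k : ℕ} : FChain X (k + 1) →ₗ[ℤ] FChain X k :=
  Finsupp.linearCombination ℤ fun σ =>
    ∑ i : Fin (k + 2), (-1 : ℤ) ^ (i : ℕ) • Finsupp.single (face i σ) 1

/-- The push-forward of finite singular chains. -/
def fpush (g : C(X, Y)) {k : ℕ} : FChain X k →ₗ[ℤ] FChain Y k :=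
  Finsupp.linearCombination ℤ fun σ => Finsupp.single (g.comp σ) 1

theorem fboundary_single {k : ℕ} (σ : Simplex X (k + 1)) : fboundary (Finsupp.single σ 1) =
    ∑ i : Fin (k + 2), (-1 : ℤ) ^ (i : ℕ) • Finsupp.single (face i σ) 1 := by
  simp [fboundary]

@[simp] theorem fpush_single (g : C(X, Y)) {k : ℕ} (σ : Simplex X k) :
    fpush g (Finsupp.single σ 1) = Finsupp.single (g.comp σ) 1 := by
  simp [fpush]

theorem fpush_fboundary (g : C(X, Y)) {k : ℕ} (c : FChain X (k + 1)) :
    fpush g (fboundary c) = fboundary (fpush g c) := by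
  have : fpush g ∘ₗ fboundary = fboundary ∘ₗ fpush g (k := k + 1) := by
    refine chain_hom_ext fun σ => ?_
    simp only [LinearMap.comp_apply, fboundary_single, map_sum, map_smul, fpush_single]
    rfl
  exact LinearMap.congr_fun this c

end FiniteChains

/-! ### Affine simplices in convex sets -/

section Affine

variable {X Y : Type*} [TopologicalSpace X] [TopologicalSpace Y]
variable {E F : Type*} [NormedAddCommGroup E] [NormedSpace ℝ E] [NormedAddCommGroup F]
  [NormedSpace ℝ F] {C : Set E} {C' : Set F}

/-- The affine simplex with given vertices in a convex set. -/
def affineSimplex (hC : Convex ℝ C) {m : ℕ} (v : Fin (m + 1) → C) : Simplex C m where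
  toFun t := ⟨∑ i, t.1 i • (v i : E),
    hC.sum_mem (fun i _ => t.2.1 i) t.2.2 fun i _ => (v i).2⟩
  continuous_toFun := by
    refine Continuous.subtype_mk (continuous_finsetSum _ fun i _ => ?_) _
    exact ((continuous_apply i).comp continuous_subtype_val).smul continuous_const

theorem affineSimplex_coe (hC : Convex ℝ C) {m : ℕ} (v : Fin (m + 1) → C)
    (t : stdSimplex ℝ (Fin (m + 1))) :
    (affineSimplex hC v t : E) = ∑ i, t.1 i • (v i : E) := rfl

/-- Barycentric coordinates are summed over the fibres of `α`. For the coface maps this identifies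
singular faces with faces of tuples. -/
theorem affineSimplex_comp_vertexMap (hC : Convex ℝ C) {m p : ℕ} (v : Fin (m + 1) → C)
    (α : Fin (p + 1) → Fin (m + 1)) :
    (affineSimplex hC v).comp (vertexMap α) = affineSimplex hC fun i => v (α i) := by
  classical
  ext t
  simp only [ContinuousMap.comp_apply, affineSimplex_coe]
  have h : ∀ j, (vertexMap α t).1 j = ∑ i with α i = j, t.1 i := fun j =>
    FunOnFinite.linearMap_apply_apply ..
  simp only [h, Finset.sum_smul]
  rw [← Finset.sum_fiberwise (s := Finset.univ) (g := α)]
  refine Finset.sum_congr rfl fun j _ => Finset.sum_congr rfl fun i hi => ?_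
  rw [(Finset.mem_filter.1 hi).2]

/-- The center of an affine simplex. -/
def center (hC : Convex ℝ C) {m : ℕ} (v : Fin (m + 1) → C) : C :=
  affineSimplex hC v stdSimplex.barycenter

theorem center_coe (hC : Convex ℝ C) {m : ℕ} (v : Fin (m + 1) → C) :
    (center hC v : E) = ∑ i, ((m : ℝ) + 1)⁻¹ • (v i : E) := by
  refine (affineSimplex_coe ..).trans (Finset.sum_congr rfl fun i _ => ?_)
  rw [stdSimplex.barycenter_apply, Fintype.card_fin, Nat.cast_add, Nat.cast_one]

/-- A map of convex sets that preserves finite convex combinations. -/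
def IsAffineOn (g : C → C') : Prop :=
  ∀ ⦃m : ℕ⦄ (t : stdSimplex ℝ (Fin (m + 1))) (v : Fin (m + 1) → C) (x : C),
    (x : E) = ∑ i, t.1 i • (v i : E) → (g x : F) = ∑ i, t.1 i • (g (v i) : F)

theorem IsAffineOn.affineSimplex (hC : Convex ℝ C) (hC' : Convex ℝ C') {g : C → C'}
    (hg : IsAffineOn g) {m : ℕ} (v : Fin (m + 1) → C) (t : stdSimplex ℝ (Fin (m + 1))) :
    g (affineSimplex hC v t) = SYS.affineSimplex hC' (fun i => g (v i)) t :=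
  Subtype.ext (hg t v _ (affineSimplex_coe ..))

theorem IsAffineOn.center (hC : Convex ℝ C) (hC' : Convex ℝ C') {g : C → C'}
    (hg : IsAffineOn g) {m : ℕ} (v : Fin (m + 1) → C) :
    g (center hC v) = SYS.center hC' fun i => g (v i) :=
  hg.affineSimplex hC hC' v _

theorem isAffineOn_affineSimplex (hC : Convex ℝ C) {m : ℕ} (v : Fin (m + 1) → C) :
    IsAffineOn (affineSimplex hC v) := by
  intro p t u x hx
  simp only [affineSimplex_coe, hx, Finset.smul_sum, Finset.sum_apply, Pi.smul_apply, smul_eq_mul,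
    Finset.sum_smul, smul_smul]
  exact Finset.sum_comm

/-- The chain of singular simplices `g ∘ [v]`. -/
def realize (hC : Convex ℝ C) (g : C(C, X)) {m : ℕ} :
    TupleChain C (m + 1) →ₗ[ℤ] FChain X m :=
  Finsupp.linearCombination ℤ fun v => Finsupp.single (g.comp (affineSimplex hC v)) 1

@[simp] theorem realize_single (hC : Convex ℝ C) (g : C(C, X)) {m : ℕ} (v : Fin (m + 1) → C) :
    realize hC g (Finsupp.single v 1) = Finsupp.single (g.comp (affineSimplex hC v)) 1 := by
  simp [realize]

theorem fboundary_realize (hC : Convex ℝ C) (g : C(C, X)) {m : ℕ} (c : TupleChain C (m + 2)) :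
    fboundary (realize hC g c) = realize hC g (tupleBoundary c) := by
  have : fboundary ∘ₗ realize hC g (m := m + 1) = realize hC g ∘ₗ tupleBoundary := by
    refine chain_hom_ext fun v => ?_
    simp only [LinearMap.comp_apply, realize_single, fboundary_single, tupleBoundary_single,
      map_sum, map_smul]
    refine Finset.sum_congr rfl fun i _ => ?_
    rw [face, ContinuousMap.comp_assoc, affineSimplex_comp_vertexMap]
  exact LinearMap.congr_fun this c

theorem realize_tupleMap (hC : Convex ℝ C) (hC' : Convex ℝ C') (h : C(C, C'))
    (hh : IsAffineOn h) (g : C(C', X)) {m : ℕ} (c : TupleChain C (m + 1)) :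
    realize hC' g (tupleMap h c) = realize hC (g.comp h) c := by
  have : realize hC' g ∘ₗ tupleMap h = realize hC (g.comp h) (m := m) := by
    refine chain_hom_ext fun v => ?_
    rw [LinearMap.comp_apply, tupleMap_single, realize_single, realize_single,
      ContinuousMap.comp_assoc]
    congr 2
    ext t
    exact congrArg Subtype.val (hh.affineSimplex hC hC' v t).symm
  exact LinearMap.congr_fun this c

theorem fpush_realize (hC : Convex ℝ C) (g : C(C, X)) (f : C(X, Y)) {m : ℕ}
    (c : TupleChain C (m + 1)) : fpush f (realize hC g c) = realize hC (f.comp g) c := by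
  have : fpush f ∘ₗ realize hC g (m := m) = realize hC (f.comp g) := by
    refine chain_hom_ext fun v => ?_
    simp only [LinearMap.comp_apply, realize_single, fpush_single, ContinuousMap.comp_assoc]
  exact LinearMap.congr_fun this c

/-- The standard simplex as a set. -/
abbrev Std (k : ℕ) : Set (Fin (k + 1) → ℝ) := stdSimplex ℝ (Fin (k + 1))

theorem convex_std (k : ℕ) : Convex ℝ (Std k) := convex_stdSimplex ℝ _

/-- The vertices of the standard simplex. -/
def stdVertex (k : ℕ) (i : Fin (k + 1)) : Std k := ⟨Pi.single i 1, single_mem_stdSimplex ℝ i⟩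

/-- The standard simplex as a tuple of vertices. -/
def stdTuple (k : ℕ) : TupleChain (Std k) (k + 1) := Finsupp.single (stdVertex k) 1

theorem affineSimplex_stdVertex (k : ℕ) :
    affineSimplex (convex_std k) (stdVertex k) = ContinuousMap.id _ := by
  classical
  refine ContinuousMap.ext fun t => Subtype.ext ?_
  rw [affineSimplex_coe]
  ext j
  simp [stdVertex, Finset.sum_apply, Pi.single_apply]

theorem affineSimplex_vertex (hC : Convex ℝ C) {m : ℕ} (v : Fin (m + 1) → C) (i : Fin (m + 1)) :
    affineSimplex hC v (stdVertex m i) = v i := by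
  classical
  ext
  simp [affineSimplex_coe, stdVertex, Pi.single_apply]

/-- Each singular simplex is the image of the universal tuple of vertices, so identities between
natural operators need only be checked on tuples. -/
theorem realize_stdTuple {k : ℕ} (σ : Simplex X k) :
    realize (convex_std k) σ (stdTuple k) = Finsupp.single σ 1 := by
  rw [stdTuple, realize_single, affineSimplex_stdVertex, ContinuousMap.comp_id]

theorem realize_boundary_stdTuple {k : ℕ} (σ : Simplex X (k + 1)) :
    realize (convex_std (k + 1)) σ (tupleBoundary (stdTuple (k + 1))) =
      fboundary (Finsupp.single σ 1) := by
  rw [← fboundary_realize, realize_stdTuple]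

theorem fboundary_fboundary {k : ℕ} (c : FChain X (k + 2)) : fboundary (fboundary c) = 0 := by
  have : fboundary ∘ₗ fboundary = (0 : FChain X (k + 2) →ₗ[ℤ] FChain X k) := by
    refine chain_hom_ext fun σ => ?_
    rw [LinearMap.comp_apply, ← realize_boundary_stdTuple, fboundary_realize,
      tupleBoundary_boundary, map_zero, LinearMap.zero_apply]
  exact LinearMap.congr_fun this c

end Affine

/-! ### Chains supported in subsets -/

section Support

variable {X Y : Type*} [TopologicalSpace X] [TopologicalSpace Y]

/-- Finite chains whose simplices satisfy a condition. -/
abbrev chainsIn {k : ℕ} (P : Set (Simplex X k)) : Submodule ℤ (FChain X k) :=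
  Finsupp.supported ℤ ℤ P

/-- The singular simplices of a subset. -/
def simplicesIn (A : Set X) (k : ℕ) : Set (Simplex X k) := {σ | range σ ⊆ A}

theorem mem_chainsIn {k : ℕ} {P : Set (Simplex X k)} {c : FChain X k} :
    c ∈ chainsIn P ↔ ∀ σ, σ ∉ P → c σ = 0 := Finsupp.mem_supported' ..

theorem single_mem_chainsIn {k : ℕ} {P : Set (Simplex X k)} {σ : Simplex X k} (h : σ ∈ P) :
    (Finsupp.single σ 1 : FChain X k) ∈ chainsIn P := Finsupp.single_mem_supported ℤ 1 h

/-- A linear map of chains that sends the simplices in `P` to chains in a submodule. -/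
theorem map_mem_of_chainsIn {k : ℕ} {M : Type*} [AddCommGroup M] {P : Set (Simplex X k)}
    {S : Submodule ℤ M} {F : FChain X k →ₗ[ℤ] M}
    (h : ∀ σ ∈ P, F (Finsupp.single σ 1) ∈ S) {c : FChain X k} (hc : c ∈ chainsIn P) :
    F c ∈ S := by
  rw [chainsIn, Finsupp.supported_eq_span_single] at hc
  refine (Submodule.span_le.2 ?_ : _ ≤ S.comap F) hc
  rintro _ ⟨σ, hσ, rfl⟩
  exact h σ hσ

theorem fboundary_mem {A : Set X} {k : ℕ} {c : FChain X (k + 1)}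
    (hc : c ∈ chainsIn (simplicesIn A (k + 1))) : fboundary c ∈ chainsIn (simplicesIn A k) := by
  refine map_mem_of_chainsIn (fun σ hσ => ?_) hc
  rw [fboundary_single]
  exact Submodule.sum_mem _ fun i _ => Submodule.smul_mem _ _
    (single_mem_chainsIn ((range_face_subset i σ).trans hσ))

theorem fpush_mem {g : C(X, Y)} {A : Set X} {B : Set Y} (h : MapsTo g A B) {k : ℕ}
    {c : FChain X k} (hc : c ∈ chainsIn (simplicesIn A k)) :
    fpush g c ∈ chainsIn (simplicesIn B k) := by
  refine map_mem_of_chainsIn (fun σ hσ => ?_) hc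
  rw [fpush_single]
  refine single_mem_chainsIn ?_
  rintro _ ⟨t, rfl⟩
  exact h (hσ ⟨t, rfl⟩)

theorem realize_mem {E : Type*} [NormedAddCommGroup E] [NormedSpace ℝ E] {C : Set E}
    (hC : Convex ℝ C) {g : C(C, X)} {A : Set X} (hg : range g ⊆ A) {m : ℕ}
    (c : TupleChain C (m + 1)) : realize hC g c ∈ chainsIn (simplicesIn A m) := by
  induction c using Finsupp.induction_linear with
  | zero => rw [map_zero]; exact zero_mem _
  | add c d hc hd => rw [map_add]; exact add_mem hc hd
  | single v z =>
    rw [← mul_one z, ← smul_eq_mul, ← Finsupp.smul_single, map_smul, realize_single]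
    refine Submodule.smul_mem _ _ (single_mem_chainsIn ?_)
    rintro _ ⟨t, rfl⟩
    exact hg ⟨_, rfl⟩

end Support

/-! ### Barycentric subdivision and homotopy invariance -/

section Subdivision

variable {X Y : Type*} [TopologicalSpace X] [TopologicalSpace Y]
variable {E F : Type*} [NormedAddCommGroup E] [NormedSpace ℝ E] [NormedAddCommGroup F]
  [NormedSpace ℝ F] {C : Set E} {C' : Set F}

/-- Any tuple in a convex set comes from the standard one by an affine map, to which the naturality
lemmas apply. -/
theorem single_eq_tupleMap (hC : Convex ℝ C) {m : ℕ} (v : Fin (m + 1) → C) :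
    (Finsupp.single v 1 : TupleChain C (m + 1)) =
      tupleMap (affineSimplex hC v) (stdTuple m) := by
  rw [stdTuple, tupleMap_single]
  congr 1
  funext i
  rw [affineSimplex_vertex]

/-- Barycentric subdivision of affine chains. -/
def barySubdiv (hC : Convex ℝ C) (m : ℕ) : TupleChain C m →ₗ[ℤ] TupleChain C m :=
  subdiv (fun {_} v => center hC v) m

/-- The chain homotopy between the identity and the barycentric subdivision. -/
def baryHomotopy (hC : Convex ℝ C) (m : ℕ) : TupleChain C m →ₗ[ℤ] TupleChain C (m + 1) :=
  coneHomotopy (fun {_} v => center hC v) (fun m => LinearMap.id - barySubdiv hC m) m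

theorem tupleMap_barySubdiv (hC : Convex ℝ C) (hC' : Convex ℝ C') {g : C → C'}
    (hg : IsAffineOn g) {m : ℕ} (c : TupleChain C m) :
    tupleMap g (barySubdiv hC m c) = barySubdiv hC' m (tupleMap g c) :=
  tupleMap_subdiv g (fun v => hg.center hC hC' v) c

theorem tupleMap_baryHomotopy (hC : Convex ℝ C) (hC' : Convex ℝ C') {g : C → C'}
    (hg : IsAffineOn g) {m : ℕ} (c : TupleChain C m) :
    tupleMap g (baryHomotopy hC m c) = baryHomotopy hC' m (tupleMap g c) := by
  refine tupleMap_coneHomotopy g g (fun v => hg.center hC hC' v) (fun c => ?_) c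
  simp only [LinearMap.sub_apply, LinearMap.id_apply, map_sub, tupleMap_barySubdiv hC hC' hg]

theorem tupleBoundary_baryHomotopy (hC : Convex ℝ C) {m : ℕ} (c : TupleChain C (m + 1)) :
    tupleBoundary (baryHomotopy hC (m + 1) c) =
      c - barySubdiv hC (m + 1) c - baryHomotopy hC m (tupleBoundary c) := by
  refine tupleBoundary_coneHomotopy ?_ (fun c => ?_) c
  · exact sub_self _
  · simp only [LinearMap.sub_apply, LinearMap.id_apply, map_sub]
    rw [barySubdiv, tupleBoundary_subdiv]
    rfl

/-- Barycentric subdivision of singular chains. -/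
def fsubdiv {k : ℕ} : FChain X k →ₗ[ℤ] FChain X k :=
  Finsupp.linearCombination ℤ fun σ =>
    realize (convex_std k) σ (barySubdiv (convex_std k) (k + 1) (stdTuple k))

/-- The chain homotopy between the identity and the barycentric subdivision. -/
def fsubdivHomotopy {k : ℕ} : FChain X k →ₗ[ℤ] FChain X (k + 1) :=
  Finsupp.linearCombination ℤ fun σ =>
    realize (convex_std k) σ (baryHomotopy (convex_std k) (k + 1) (stdTuple k))

theorem fsubdiv_single {k : ℕ} (σ : Simplex X k) : fsubdiv (Finsupp.single σ 1) =
    realize (convex_std k) σ (barySubdiv (convex_std k) (k + 1) (stdTuple k)) := by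
  simp [fsubdiv]

theorem fsubdivHomotopy_single {k : ℕ} (σ : Simplex X k) : fsubdivHomotopy (Finsupp.single σ 1) =
    realize (convex_std k) σ (baryHomotopy (convex_std k) (k + 1) (stdTuple k)) := by
  simp [fsubdivHomotopy]

/-- Affine maps preserve barycentres, so subdividing inside `C` and subdividing each realized
simplex in its own standard simplex agree. Applied to the boundary tuples, this makes `fsubdiv` a
chain map. -/
theorem realize_barySubdiv (hC : Convex ℝ C) (g : C(C, X)) {m : ℕ} (c : TupleChain C (m + 1)) :
    realize hC g (barySubdiv hC (m + 1) c) = fsubdiv (realize hC g c) := by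
  have : realize hC g ∘ₗ barySubdiv hC (m + 1) = fsubdiv ∘ₗ realize hC g := by
    refine chain_hom_ext fun v => ?_
    rw [LinearMap.comp_apply, LinearMap.comp_apply, realize_single, fsubdiv_single,
      single_eq_tupleMap hC,
      ← tupleMap_barySubdiv (convex_std m) hC (isAffineOn_affineSimplex hC v),
      realize_tupleMap _ _ _ (isAffineOn_affineSimplex hC v)]
  exact LinearMap.congr_fun this c

theorem realize_baryHomotopy (hC : Convex ℝ C) (g : C(C, X)) {m : ℕ} (c : TupleChain C (m + 1)) :
    realize hC g (baryHomotopy hC (m + 1) c) = fsubdivHomotopy (realize hC g c) := by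
  have : realize hC g ∘ₗ baryHomotopy hC (m + 1) = fsubdivHomotopy ∘ₗ realize hC g := by
    refine chain_hom_ext fun v => ?_
    rw [LinearMap.comp_apply, LinearMap.comp_apply, realize_single, fsubdivHomotopy_single,
      single_eq_tupleMap hC,
      ← tupleMap_baryHomotopy (convex_std m) hC (isAffineOn_affineSimplex hC v),
      realize_tupleMap _ _ _ (isAffineOn_affineSimplex hC v)]
  exact LinearMap.congr_fun this c

theorem fboundary_fsubdiv {k : ℕ} (c : FChain X (k + 1)) :
    fboundary (fsubdiv c) = fsubdiv (fboundary c) := by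
  have : fboundary ∘ₗ fsubdiv = fsubdiv ∘ₗ fboundary (X := X) (k := k) := by
    refine chain_hom_ext fun σ => ?_
    rw [LinearMap.comp_apply, LinearMap.comp_apply, fsubdiv_single, fboundary_realize, barySubdiv,
      tupleBoundary_subdiv, ← realize_boundary_stdTuple, ← realize_barySubdiv]
    rfl
  exact LinearMap.congr_fun this c

theorem fboundary_fsubdivHomotopy {k : ℕ} (c : FChain X (k + 1)) :
    fboundary (fsubdivHomotopy c) = c - fsubdiv c - fsubdivHomotopy (fboundary c) := by
  have : fboundary ∘ₗ fsubdivHomotopy =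
      LinearMap.id - fsubdiv - fsubdivHomotopy ∘ₗ fboundary (X := X) (k := k) := by
    refine chain_hom_ext fun σ => ?_
    simp only [LinearMap.comp_apply, LinearMap.sub_apply, LinearMap.id_apply]
    rw [fsubdivHomotopy_single, fboundary_realize, tupleBoundary_baryHomotopy, map_sub, map_sub,
      realize_stdTuple, realize_barySubdiv, realize_stdTuple, realize_baryHomotopy,
      realize_boundary_stdTuple]
  exact LinearMap.congr_fun this c

/-! ### The prism operator -/

/-- The prism over a convex set. -/
abbrev prismSet (C : Set E) : Set (E × ℝ) := C ×ˢ Icc (0 : ℝ) 1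

theorem convex_prismSet (hC : Convex ℝ C) : Convex ℝ (prismSet C) := hC.prod (convex_Icc 0 1)

/-- The inclusion of a level of the prism. -/
def prismLevel (C : Set E) (u : unitInterval) : C(C, prismSet C) where
  toFun x := ⟨(x.1, u.1), x.2, u.2⟩
  continuous_toFun := by fun_prop

/-- The product of a map with the identity of the interval. -/
def prismLift (g : C(C, C')) : C(prismSet C, prismSet C') where
  toFun p := ⟨(g ⟨p.1.1, p.2.1⟩, p.1.2), (g ⟨p.1.1, p.2.1⟩).2, p.2.2⟩
  continuous_toFun := by fun_prop

/-- A homotopy composed with a map of a convex set. -/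
def prismComp (h : C(X × unitInterval, Y)) (g : C(C, X)) : C(prismSet C, Y) where
  toFun p := h (g ⟨p.1.1, p.2.1⟩, ⟨p.1.2, p.2.2⟩)
  continuous_toFun := by fun_prop

/-- The stage `u` of a homotopy. -/
def stage (h : C(X × unitInterval, Y)) (u : unitInterval) : C(X, Y) where
  toFun x := h (x, u)
  continuous_toFun := by fun_prop

theorem isAffineOn_prismLevel (u : unitInterval) : IsAffineOn (prismLevel C u) := by
  intro m t v x hx
  refine Prod.ext ?_ ?_
  · simpa [prismLevel, Prod.fst_sum] using hx
  · have : ∑ i, t.1 i * (u : ℝ) = u := by rw [← Finset.sum_mul, t.2.2, one_mul]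
    simpa [prismLevel, Prod.snd_sum] using this.symm

theorem IsAffineOn.prismLift {g : C(C, C')} (hg : IsAffineOn g) :
    IsAffineOn (SYS.prismLift g) := by
  intro m t v x hx
  have h1 : x.1.1 = ∑ i, t.1 i • (v i).1.1 := by simpa [Prod.fst_sum] using congrArg Prod.fst hx
  have h2 : x.1.2 = ∑ i, t.1 i • (v i).1.2 := by simpa [Prod.snd_sum] using congrArg Prod.snd hx
  refine Prod.ext ?_ ?_
  · simpa [SYS.prismLift, Prod.fst_sum] using
      hg t (fun i => ⟨(v i).1.1, (v i).2.1⟩) ⟨x.1.1, x.2.1⟩ h1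
  · simpa [SYS.prismLift, Prod.snd_sum] using h2

/-- The difference of top and bottom of the prism. -/
def prismEnds (C : Set E) (m : ℕ) : TupleChain C m →ₗ[ℤ] TupleChain (prismSet C) m :=
  tupleMap (prismLevel C 1) - tupleMap (prismLevel C 0)

/-- The prism operator on affine chains. -/
def tuplePrism (hC : Convex ℝ C) (m : ℕ) :
    TupleChain C m →ₗ[ℤ] TupleChain (prismSet C) (m + 1) :=
  coneHomotopy (fun {_} v => center (convex_prismSet hC) fun i => prismLevel C 0 (v i))
    (prismEnds C) m

/-- No explicit triangulation of the prism is needed: the prism is convex, and coning from the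
centre of the bottom face is a natural choice. The two ends agree in degree `0`, because there is
only one empty tuple. -/
theorem tupleBoundary_tuplePrism (hC : Convex ℝ C) {m : ℕ} (c : TupleChain C (m + 1)) :
    tupleBoundary (tuplePrism hC (m + 1) c) =
      tupleMap (prismLevel C 1) c - tupleMap (prismLevel C 0) c -
        tuplePrism hC m (tupleBoundary c) := by
  refine tupleBoundary_coneHomotopy ?_ (fun c => ?_) c
  · refine sub_eq_zero.2 (chain_hom_ext fun v => ?_)
    rw [tupleMap_single, tupleMap_single]
    congr 1
    exact Subsingleton.elim _ _
  · simp only [prismEnds, LinearMap.sub_apply, map_sub, tupleMap_boundary]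

theorem tupleMap_tupleMap {Q R S : Type*} (g : Q → R) (h : R → S) {m : ℕ} (c : TupleChain Q m) :
    tupleMap h (tupleMap g c) = tupleMap (fun x => h (g x)) c := by
  have : tupleMap h ∘ₗ tupleMap g = tupleMap (m := m) (fun x => h (g x)) := by
    refine chain_hom_ext fun v => ?_
    simp only [LinearMap.comp_apply, tupleMap_single]
  exact LinearMap.congr_fun this c

theorem tupleMap_tuplePrism (hC : Convex ℝ C) (hC' : Convex ℝ C') {g : C(C, C')}
    (hg : IsAffineOn g) {m : ℕ} (c : TupleChain C m) :
    tupleMap (prismLift g) (tuplePrism hC m c) = tuplePrism hC' m (tupleMap g c) := by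
  refine tupleMap_coneHomotopy g _ (fun v => ?_) (fun c => ?_) c
  · exact hg.prismLift.center (convex_prismSet hC) (convex_prismSet hC') _
  · simp only [prismEnds, LinearMap.sub_apply, map_sub, tupleMap_tupleMap]
    rfl

/-- The prism operator of a homotopy. -/
def fprism (h : C(X × unitInterval, Y)) {k : ℕ} : FChain X k →ₗ[ℤ] FChain Y (k + 1) :=
  Finsupp.linearCombination ℤ fun σ =>
    realize (convex_prismSet (convex_std k)) (prismComp h σ)
      (tuplePrism (convex_std k) (k + 1) (stdTuple k))

theorem fprism_single (h : C(X × unitInterval, Y)) {k : ℕ} (σ : Simplex X k) :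
    fprism h (Finsupp.single σ 1) = realize (convex_prismSet (convex_std k)) (prismComp h σ)
      (tuplePrism (convex_std k) (k + 1) (stdTuple k)) := by
  simp [fprism]

theorem realize_tuplePrism (hC : Convex ℝ C) (h : C(X × unitInterval, Y)) (g : C(C, X)) {m : ℕ}
    (c : TupleChain C (m + 1)) :
    realize (convex_prismSet hC) (prismComp h g) (tuplePrism hC (m + 1) c) =
      fprism h (realize hC g c) := by
  have : realize (convex_prismSet hC) (prismComp h g) ∘ₗ tuplePrism hC (m + 1) =
      fprism h ∘ₗ realize hC g := by
    refine chain_hom_ext fun v => ?_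
    rw [LinearMap.comp_apply, LinearMap.comp_apply, realize_single, fprism_single,
      single_eq_tupleMap hC,
      ← tupleMap_tuplePrism (convex_std m) hC (isAffineOn_affineSimplex hC v),
      realize_tupleMap (convex_prismSet (convex_std m)) _ _
        (isAffineOn_affineSimplex hC v).prismLift]
    rfl
  exact LinearMap.congr_fun this c

theorem fboundary_fprism (h : C(X × unitInterval, Y)) {k : ℕ} (c : FChain X (k + 1)) :
    fboundary (fprism h c) = fpush (stage h 1) c - fpush (stage h 0) c - fprism h (fboundary c) := by
  have : fboundary ∘ₗ fprism h (k := k + 1) =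
      fpush (stage h 1) - fpush (stage h 0) - fprism h ∘ₗ fboundary := by
    refine chain_hom_ext fun σ => ?_
    simp only [LinearMap.comp_apply, LinearMap.sub_apply]
    rw [fprism_single, fboundary_realize, tupleBoundary_tuplePrism, map_sub, map_sub,
      realize_tuplePrism, realize_boundary_stdTuple,
      realize_tupleMap (convex_std _) _ _ (isAffineOn_prismLevel 1),
      realize_tupleMap (convex_std _) _ _ (isAffineOn_prismLevel 0),
      ← realize_stdTuple σ, fpush_realize, fpush_realize]
    rfl
  exact LinearMap.congr_fun this c

theorem fprism_mem {h : C(X × unitInterval, Y)} {A : Set X} {B : Set Y}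
    (hAB : ∀ x ∈ A, ∀ u, h (x, u) ∈ B) {k : ℕ} {c : FChain X k}
    (hc : c ∈ chainsIn (simplicesIn A k)) : fprism h c ∈ chainsIn (simplicesIn B (k + 1)) := by
  refine map_mem_of_chainsIn (fun σ hσ => ?_) hc
  rw [fprism_single]
  refine realize_mem _ ?_ _
  rintro _ ⟨p, rfl⟩
  exact hAB _ (hσ ⟨_, rfl⟩) _

end Subdivision

/-! ### Small simplices -/

section Small

variable {X : Type*} [TopologicalSpace X]
variable {E : Type*} [NormedAddCommGroup E] [NormedSpace ℝ E] {C : Set E}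

/-- The classical mesh estimate. Membership in the convex hull is carried through the induction
because it bounds the distance from the new apex to the vertices inherited from a subdivided face.
-/
theorem barySubdiv_support (hC : Convex ℝ C) {m : ℕ} (v : Fin (m + 1) → C) {r : ℝ}
    (hr : ∀ i j, dist (v i) (v j) ≤ r) {w : Fin (m + 1) → C}
    (hw : w ∈ (barySubdiv hC (m + 1) (Finsupp.single v 1)).support) :
    (∀ i, (w i : E) ∈ convexHull ℝ (range fun i => (v i : E))) ∧
      ∀ i j, dist (w i) (w j) ≤ m / (m + 1) * r := by
  have hr0 : 0 ≤ r := dist_nonneg.trans (hr 0 0)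
  induction m with
  | zero =>
    have : Subsingleton (Fin (0 + 1)) := inferInstanceAs (Subsingleton (Fin 1))
    rw [barySubdiv, subdiv_single] at hw
    obtain ⟨u, -, rfl⟩ := exists_of_mem_support_cone hw
    refine ⟨fun i => ?_, fun i j => ?_⟩
    · rw [Subsingleton.elim i 0, Fin.cons_zero, center_coe]
      refine subset_convexHull ℝ _ ⟨0, ?_⟩
      simp
    · rw [Subsingleton.elim i j, dist_self]
      simp
  | succ m ih =>
    rw [barySubdiv, subdiv_single] at hw
    obtain ⟨u, hu, rfl⟩ := exists_of_mem_support_cone hw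
    have hu' : ∃ i : Fin (m + 2),
        u ∈ (barySubdiv hC (m + 1) (Finsupp.single (fun j => v (i.succAbove j)) 1)).support := by
      rw [tupleBoundary_single, map_sum] at hu
      classical
      obtain ⟨i, -, hi⟩ := Finset.mem_biUnion.1 (Finsupp.support_finsetSum hu)
      rw [map_smul] at hi
      exact ⟨i, Finsupp.support_smul hi⟩
    obtain ⟨i₀, hi₀⟩ := hu'
    obtain ⟨ih1, ih2⟩ := ih (fun j => v (i₀.succAbove j)) (fun i j => hr _ _) hi₀
    have hull : ∀ j, (u j : E) ∈ convexHull ℝ (range fun i => (v i : E)) := fun j =>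
      convexHull_mono (by rintro _ ⟨l, rfl⟩; exact ⟨_, rfl⟩) (ih1 j)
    have hm : (0 : ℝ) < (m : ℝ) + 1 + 1 := by positivity
    have hcv : ∀ i, dist (center hC v : E) (v i) ≤ ((m + 1 : ℕ) : ℝ) / ((m + 1 : ℕ) + 1) * r := by
      intro i
      -- The difference is the average of the vectors `v j - v i`, one of which vanishes; this is
      -- where the factor `(m + 1) / (m + 2)` comes from.
      have h1 : (center hC v : E) - v i =
          ∑ j, (((m + 1 : ℕ) : ℝ) + 1)⁻¹ • ((v j : E) - v i) := by
        rw [center_coe]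
        simp only [smul_sub, Finset.sum_sub_distrib, Finset.sum_const, Finset.card_univ,
          Fintype.card_fin, ← Nat.cast_smul_eq_nsmul ℝ, smul_smul]
        congr 1
        rw [Nat.cast_add (m + 1) 1, Nat.cast_one, mul_inv_cancel₀ (by positivity), one_smul]
      rw [dist_eq_norm, h1]
      refine (norm_sum_le _ _).trans ?_
      rw [Fin.sum_univ_succAbove _ i, sub_self, smul_zero, norm_zero, zero_add]
      refine (Finset.sum_le_sum fun j _ => (?_ : _ ≤ (((m + 1 : ℕ) : ℝ) + 1)⁻¹ * r)).trans ?_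
      · rw [norm_smul, Real.norm_of_nonneg (by positivity), ← dist_eq_norm]
        exact mul_le_mul_of_nonneg_left (hr _ _) (by positivity)
      · rw [Finset.sum_const, Finset.card_univ, Fintype.card_fin, nsmul_eq_mul, ← mul_assoc,
          div_eq_mul_inv]
    have hcu : ∀ j, dist (center hC v) (u j) ≤ ((m + 1 : ℕ) : ℝ) / ((m + 1 : ℕ) + 1) * r := by
      intro j
      -- A ball about the centre that contains all vertices contains their hull, hence every vertex
      -- of the subdivided face.
      have : convexHull ℝ (range fun i => (v i : E)) ⊆
          Metric.closedBall (center hC v : E) (((m + 1 : ℕ) : ℝ) / ((m + 1 : ℕ) + 1) * r) := by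
        refine convexHull_min ?_ (convex_closedBall _ _)
        rintro _ ⟨i, rfl⟩
        rw [Metric.mem_closedBall, dist_comm]
        exact hcv i
      have h := this (hull j)
      rwa [Metric.mem_closedBall, dist_comm] at h
    refine ⟨fun i => ?_, fun i j => ?_⟩
    · refine Fin.cases ?_ (fun j => ?_) i
      · rw [Fin.cons_zero, center_coe]
        refine (convex_convexHull ℝ _).sum_mem (fun _ _ => by positivity) ?_
          fun i _ => subset_convexHull ℝ _ ⟨i, rfl⟩
        rw [Finset.sum_const, Finset.card_univ, Fintype.card_fin, nsmul_eq_mul,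
          Nat.cast_add (m + 1) 1, Nat.cast_one, mul_inv_cancel₀ (by positivity)]
      · rw [Fin.cons_succ]
        exact hull j
    · have hnn : 0 ≤ ((m + 1 : ℕ) : ℝ) / ((m + 1 : ℕ) + 1) * r := by positivity
      refine Fin.cases ?_ (fun i => ?_) i <;> refine Fin.cases ?_ (fun j => ?_) j
      · rw [dist_self]; exact hnn
      · rw [Fin.cons_zero, Fin.cons_succ]; exact hcu j
      · rw [Fin.cons_zero, Fin.cons_succ, dist_comm]; exact hcu i
      · rw [Fin.cons_succ, Fin.cons_succ]
        refine (ih2 i j).trans (mul_le_mul_of_nonneg_right ?_ hr0)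
        rw [div_le_div_iff₀ (by positivity) (by positivity)]
        push_cast
        nlinarith

end Small

/-! ### Iterated subdivision and the splitting of chains into two open sets -/

section Small

variable {X : Type*} [TopologicalSpace X]
variable {E : Type*} [NormedAddCommGroup E] [NormedSpace ℝ E] {C : Set E}

theorem barySubdiv_iterate_support (hC : Convex ℝ C) {m : ℕ} (v : Fin (m + 1) → C) {r : ℝ}
    (hr : ∀ i j, dist (v i) (v j) ≤ r) (p : ℕ) {w : Fin (m + 1) → C}
    (hw : w ∈ ((barySubdiv hC (m + 1))^[p] (Finsupp.single v 1)).support) :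
    ∀ i j, dist (w i) (w j) ≤ (m / (m + 1)) ^ p * r := by
  induction p generalizing w with
  | zero =>
    have : w = v := Finset.mem_singleton.1 (Finsupp.support_single_subset hw)
    simpa [this] using hr
  | succ p ih =>
    rw [Function.iterate_succ_apply'] at hw
    obtain ⟨u, hu, hwu⟩ := exists_of_mem_support hw
    have h := (barySubdiv_support hC u (ih hu) (by rwa [barySubdiv, subdiv_single])).2
    intro i j
    rw [pow_succ', mul_assoc]
    exact h i j

theorem affineSimplex_mem_closedBall (hC : Convex ℝ C) {m : ℕ} (w : Fin (m + 1) → C) {r : ℝ}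
    (hr : ∀ i j, dist (w i) (w j) ≤ r) (t : stdSimplex ℝ (Fin (m + 1))) :
    affineSimplex hC w t ∈ Metric.closedBall (w 0) r := by
  change (affineSimplex hC w t : E) ∈ Metric.closedBall (w 0 : E) r
  exact (convex_closedBall _ _).sum_mem (fun i _ => t.2.1 i) t.2.2 fun i _ => hr i 0

/-- The simplices that lie in one of two sets. -/
def smallSimplices (A B : Set X) (k : ℕ) : Set (Simplex X k) := simplicesIn A k ∪ simplicesIn B k

theorem chainsIn_mono {k : ℕ} {P P' : Set (Simplex X k)} (h : P ⊆ P') :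
    chainsIn P ≤ chainsIn P' := Finsupp.supported_mono h

theorem realize_mem_of_support (hC : Convex ℝ C) (g : C(C, X)) {m : ℕ} {P : Set (Simplex X m)}
    {c : TupleChain C (m + 1)} (h : ∀ v ∈ c.support, g.comp (affineSimplex hC v) ∈ P) :
    realize hC g c ∈ chainsIn P := by
  rw [realize, Finsupp.linearCombination_apply]
  exact Submodule.sum_mem _ fun v hv => Submodule.smul_mem _ _ (single_mem_chainsIn (h v hv))

theorem fsubdiv_mem_small {A B : Set X} {k : ℕ} {c : FChain X k}
    (hc : c ∈ chainsIn (smallSimplices A B k)) : fsubdiv c ∈ chainsIn (smallSimplices A B k) := by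
  refine map_mem_of_chainsIn (fun σ hσ => ?_) hc
  rw [fsubdiv_single]
  rcases hσ with hσ | hσ
  · exact chainsIn_mono subset_union_left (realize_mem _ hσ _)
  · exact chainsIn_mono subset_union_right (realize_mem _ hσ _)

theorem fsubdivHomotopy_mem_small {A B : Set X} {k : ℕ} {c : FChain X k}
    (hc : c ∈ chainsIn (smallSimplices A B k)) :
    fsubdivHomotopy c ∈ chainsIn (smallSimplices A B (k + 1)) := by
  refine map_mem_of_chainsIn (fun σ hσ => ?_) hc
  rw [fsubdivHomotopy_single]
  rcases hσ with hσ | hσ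
  · exact chainsIn_mono subset_union_left (realize_mem _ hσ _)
  · exact chainsIn_mono subset_union_right (realize_mem _ hσ _)

theorem fsubdiv_iterate_mem_small {A B : Set X} {k : ℕ} {c : FChain X k}
    (hc : c ∈ chainsIn (smallSimplices A B k)) (p : ℕ) :
    fsubdiv^[p] c ∈ chainsIn (smallSimplices A B k) := by
  induction p with
  | zero => exact hc
  | succ p ih =>
    rw [Function.iterate_succ_apply']
    exact fsubdiv_mem_small ih

theorem realize_barySubdiv_iterate (hC : Convex ℝ C) (g : C(C, X)) {m : ℕ}
    (c : TupleChain C (m + 1)) (p : ℕ) :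
    realize hC g ((barySubdiv hC (m + 1))^[p] c) = fsubdiv^[p] (realize hC g c) := by
  induction p with
  | zero => rfl
  | succ p ih =>
    rw [Function.iterate_succ_apply', Function.iterate_succ_apply', realize_barySubdiv, ih]

theorem fsubdiv_iterate_eq_pow {k : ℕ} (c : FChain X k) (p : ℕ) :
    fsubdiv^[p] c = (fsubdiv ^ p : Module.End ℤ (FChain X k)) c :=
  (Module.End.pow_apply fsubdiv p c).symm

/-- The mesh of the `p`-th subdivision of the standard simplex tends to zero, so it eventually falls
below a Lebesgue number of the cover by the preimages of `A` and `B`. -/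
theorem exists_subdiv_simplex_small {A B : Set X} (hA : IsOpen A) (hB : IsOpen B) {k : ℕ}
    {σ : Simplex X k} (hσ : range σ ⊆ A ∪ B) :
    ∃ p, fsubdiv^[p] (Finsupp.single σ 1) ∈ chainsIn (smallSimplices A B k) := by
  obtain ⟨δ, hδ, hball⟩ := lebesgue_number_lemma_of_metric (s := (univ : Set (Std k)))
    (c := fun b : Bool => if b then σ ⁻¹' A else σ ⁻¹' B) isCompact_univ
    (fun b => by
      cases b
      · exact hB.preimage σ.continuous
      · exact hA.preimage σ.continuous)
    (fun t _ => by
      rcases hσ ⟨t, rfl⟩ with h | h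
      · exact mem_iUnion.2 ⟨true, h⟩
      · exact mem_iUnion.2 ⟨false, h⟩)
  have hq : (k : ℝ) / (k + 1) < 1 := (div_lt_one (by positivity)).2 (by linarith)
  have hr : ∀ i j, dist (stdVertex k i) (stdVertex k j) ≤ Metric.diam (univ : Set (Std k)) :=
    fun i j => Metric.dist_le_diam_of_mem isCompact_univ.isBounded (mem_univ _) (mem_univ _)
  set D := Metric.diam (univ : Set (Std k))
  have hlim : Filter.Tendsto (fun p : ℕ => ((k : ℝ) / (k + 1)) ^ p * D) Filter.atTop (𝓝 0) := by
    simpa using (tendsto_pow_atTop_nhds_zero_of_lt_one (by positivity) hq).mul_const D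
  obtain ⟨p, hp⟩ := (hlim.eventually (gt_mem_nhds hδ)).exists
  refine ⟨p, ?_⟩
  rw [← realize_stdTuple, ← realize_barySubdiv_iterate]
  refine realize_mem_of_support _ _ fun w hw => ?_
  have hd := barySubdiv_iterate_support _ _ hr p hw
  obtain ⟨b, hb⟩ := hball (w 0) (mem_univ _)
  have hw' : ∀ t, affineSimplex (convex_std k) w t ∈ Metric.ball (w 0) δ := fun t =>
    Metric.closedBall_subset_ball hp (affineSimplex_mem_closedBall (convex_std k) w hd t)
  cases b
  · refine Or.inr ?_
    rintro _ ⟨t, rfl⟩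
    exact hb (hw' t)
  · refine Or.inl ?_
    rintro _ ⟨t, rfl⟩
    exact hb (hw' t)

/-- Different simplices need different numbers of subdivisions; since subdividing preserves
smallness, these numbers can be added. -/
theorem exists_subdiv_small {A B : Set X} (hA : IsOpen A) (hB : IsOpen B) {k : ℕ}
    {c : FChain X k} (hc : c ∈ chainsIn (simplicesIn (A ∪ B) k)) :
    ∃ p, fsubdiv^[p] c ∈ chainsIn (smallSimplices A B k) := by
  rw [chainsIn, Finsupp.supported_eq_span_single] at hc
  induction hc using Submodule.span_induction with
  | mem x hx =>
    obtain ⟨σ, hσ, rfl⟩ := hx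
    exact exists_subdiv_simplex_small hA hB hσ
  | zero => exact ⟨0, zero_mem _⟩
  | add x y _ _ hx hy =>
    obtain ⟨p, hp⟩ := hx
    obtain ⟨q, hq⟩ := hy
    refine ⟨p + q, ?_⟩
    rw [fsubdiv_iterate_eq_pow, map_add, ← fsubdiv_iterate_eq_pow, ← fsubdiv_iterate_eq_pow]
    refine add_mem ?_ ?_
    · rw [add_comm, Function.iterate_add_apply]
      exact fsubdiv_iterate_mem_small hp q
    · rw [Function.iterate_add_apply]
      exact fsubdiv_iterate_mem_small hq p
  | smul z x _ hx =>
    obtain ⟨p, hp⟩ := hx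
    refine ⟨p, ?_⟩
    rw [fsubdiv_iterate_eq_pow, map_smul, ← fsubdiv_iterate_eq_pow]
    exact Submodule.smul_mem _ _ hp

/-- A chain in `A ∪ B` whose boundary is a sum of chains in `A` and in `B` is homologous to such a
sum. -/
theorem exists_homologous_small {A B : Set X} (hA : IsOpen A) (hB : IsOpen B) {k : ℕ}
    {c : FChain X (k + 1)} (hc : c ∈ chainsIn (simplicesIn (A ∪ B) (k + 1)))
    (hbc : fboundary c ∈ chainsIn (smallSimplices A B k)) :
    ∃ e, c - fboundary e ∈ chainsIn (smallSimplices A B (k + 1)) := by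
  obtain ⟨p, hp⟩ := exists_subdiv_small hA hB hc
  clear hc
  induction p generalizing c with
  | zero => exact ⟨0, by simpa using hp⟩
  | succ p ih =>
    obtain ⟨e, he⟩ := ih (c := fsubdiv c) (by rw [fboundary_fsubdiv]; exact fsubdiv_mem_small hbc)
      (by rwa [Function.iterate_succ_apply] at hp)
    -- With `T` the subdivision homotopy, `c - ∂(T c)` is the subdivision of `c` plus `T(∂c)`, and
    -- the last term is small because `∂c` is.
    refine ⟨e + fsubdivHomotopy c, ?_⟩
    have : c - fboundary (e + fsubdivHomotopy c) =
        (fsubdiv c - fboundary e) + fsubdivHomotopy (fboundary c) := by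
      rw [map_add, fboundary_fsubdivHomotopy]
      abel
    rw [this]
    exact add_mem he (fsubdivHomotopy_mem_small hbc)

end Small

/-! ### Finite chains as formal sums -/

section Bridge

variable {X Y : Type*} [TopologicalSpace X] [TopologicalSpace Y]

/-- On finite chains the formal operators are honest linear maps; this links the definitions by
infinite sums to the linear algebra above. -/
theorem transfer_coe {S T : Type*} {w : S → T → ℤ} {W : S → T →₀ ℤ} (hW : ∀ s t, W s t = w s t)
    (c : S →₀ ℤ) : transfer w c = ⇑(Finsupp.linearCombination ℤ W c) := by
  ext t
  rw [Finsupp.linearCombination_apply, Finsupp.sum, Finsupp.finsetSum_apply]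
  refine (finsum_eq_sum_of_support_subset (s := c.support) _ fun s hs => ?_).trans ?_
  · exact Finsupp.mem_support_iff.2 (mul_ne_zero_iff.1 hs).1
  · exact Finset.sum_congr rfl fun s _ => by rw [Finsupp.smul_apply, hW, smul_eq_mul]

theorem boundary_coe {k : ℕ} (c : FChain X (k + 1)) :
    boundary (⇑c : Chain X (k + 1)) = ⇑(fboundary c) := by
  classical
  refine transfer_coe (fun σ ρ => ?_) c
  rw [Finsupp.finsetSum_apply, incidence]
  refine Finset.sum_congr rfl fun i _ => ?_
  rw [Finsupp.smul_apply, Finsupp.single_apply]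
  split_ifs <;> simp

theorem pushChain_coe (g : C(X, Y)) {k : ℕ} (c : FChain X k) :
    pushChain g (⇑c : Chain X k) = ⇑(fpush g c) := by
  classical
  refine transfer_coe (fun σ ρ => ?_) c
  rw [Finsupp.single_apply]

/-- The cap product of finite chains. -/
def fcap {p q k : ℕ} (h : p + q = k) (φ : Cochain X p) : FChain X k →ₗ[ℤ] FChain X q :=
  Finsupp.linearCombination ℤ fun σ =>
    φ (front p (by omega) σ) • Finsupp.single (back q (by omega) σ) 1

theorem fcap_single {p q k : ℕ} (h : p + q = k) (φ : Cochain X p) (σ : Simplex X k) :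
    fcap h φ (Finsupp.single σ 1) =
      φ (front p (by omega) σ) • Finsupp.single (back q (by omega) σ) 1 := by
  simp [fcap]

theorem cap_coe {p q k : ℕ} (h : p + q = k) (φ : Cochain X p) (c : FChain X k) :
    cap h (⇑c : Chain X k) φ = ⇑(fcap h φ c) := by
  classical
  refine transfer_coe (fun σ ρ => ?_) c
  rw [Finsupp.smul_apply, Finsupp.single_apply]
  split_ifs <;> simp

open Classical in
/-- The part of a formal sum that consists of the simplices in `P`. -/
def part {k : ℕ} (a : Chain X k) (P : Set (Simplex X k)) (h : {σ | a σ ≠ 0 ∧ σ ∈ P}.Finite) :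
    FChain X k :=
  Finsupp.ofSupportFinite (fun σ => if σ ∈ P then a σ else 0)
    (h.subset fun σ hσ => by
      have : (if σ ∈ P then a σ else 0) ≠ 0 := hσ
      by_cases hP : σ ∈ P
      · rw [if_pos hP] at this
        exact ⟨this, hP⟩
      · exact absurd (if_neg hP) this)

theorem part_of_mem {k : ℕ} {a : Chain X k} {P : Set (Simplex X k)}
    {h : {σ | a σ ≠ 0 ∧ σ ∈ P}.Finite} {σ : Simplex X k} (hσ : σ ∈ P) : part a P h σ = a σ :=
  if_pos hσ

theorem exists_coe_eq {k : ℕ} {a : Chain X k} (h : {σ | a σ ≠ 0}.Finite) :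
    ∃ c : FChain X k, ⇑c = a := ⟨Finsupp.ofSupportFinite a h, rfl⟩

theorem finite_coe {k : ℕ} (c : FChain X k) : {σ | (⇑c : Chain X k) σ ≠ 0}.Finite :=
  c.hasFiniteSupport

end Bridge

/-! ### Cup and cap products -/

section Products

variable {X Y : Type*} [TopologicalSpace X] [TopologicalSpace Y]

/-- Faces indexed by natural numbers. -/
def natFace {k : ℕ} (i : ℕ) (σ : Simplex X (k + 1)) : Simplex X k :=
  σ.comp (vertexMap fun j => ⟨if j.1 < i then j.1 else j.1 + 1, by split_ifs <;> omega⟩)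

theorem face_eq_natFace {k : ℕ} (i : Fin (k + 2)) (σ : Simplex X (k + 1)) :
    face i σ = natFace i.1 σ := by
  rw [face, natFace]
  congr 2
  funext j
  ext
  by_cases h : j.1 < i.1
  · rw [Fin.succAbove_of_castSucc_lt _ _ (by simpa [Fin.lt_def] using h)]
    simp [h]
  · rw [Fin.succAbove_of_le_castSucc _ _ (by simpa [Fin.le_def] using h)]
    simp [h]

theorem vertexMap_comp {p q r : ℕ} (α : Fin (p + 1) → Fin (q + 1)) (β : Fin (q + 1) → Fin (r + 1)) :
    (vertexMap β).comp (vertexMap α) = vertexMap fun i => β (α i) :=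
  ContinuousMap.ext fun t => stdSimplex.map_comp_apply α β t

theorem front_natFace {p k i : ℕ} (h : p ≤ k) (σ : Simplex X (k + 1)) :
    front p h (natFace i σ) = natFace i (front (p + 1) (by omega) σ) := by
  simp only [front, natFace, ContinuousMap.comp_assoc, vertexMap_comp]

theorem front_natFace_gt {p k i : ℕ} (h : p ≤ k) (hi : p < i) (σ : Simplex X (k + 1)) :
    front p h (natFace i σ) = front p (by omega) σ := by
  simp only [front, natFace, ContinuousMap.comp_assoc, vertexMap_comp]
  congr 2
  funext j
  ext
  simp only
  rw [if_pos (by omega)]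

theorem front_eq_natFace {p k : ℕ} (h : p ≤ k) (σ : Simplex X (k + 1)) :
    natFace (p + 1) (front (p + 1) (by omega) σ) = front p (by omega) σ := by
  simp only [front, natFace, ContinuousMap.comp_assoc, vertexMap_comp]
  congr 2
  funext j
  ext
  simp only
  rw [if_pos (by omega)]

theorem back_natFace_le {p q k i : ℕ} (h : p + q = k) (hi : i ≤ p) (σ : Simplex X (k + 1)) :
    back q (by omega) (natFace i σ) = back q (by omega) σ := by
  simp only [back, natFace, ContinuousMap.comp_assoc, vertexMap_comp]
  congr 2
  funext j
  ext
  simp only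
  rw [if_neg (by omega)]
  omega

theorem back_natFace_ge {p q k i : ℕ} (h : p + q = k) (σ : Simplex X (k + 1)) :
    back q (by omega) (natFace (p + i) σ) = natFace i (back (q + 1) (by omega) σ) := by
  simp only [back, natFace, ContinuousMap.comp_assoc, vertexMap_comp]
  congr 2
  funext j
  ext
  simp only
  split_ifs <;> omega

theorem coboundary_apply {k : ℕ} (φ : Cochain X k) (σ : Simplex X (k + 1)) :
    coboundary k φ σ = ∑ i ∈ Finset.range (k + 2), (-1) ^ i * φ (natFace i σ) := by
  rw [← Fin.sum_univ_eq_sum_range fun i => (-1) ^ i * φ (natFace i σ)]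
  change ∑ i : Fin (k + 2), (-1) ^ (i : ℕ) * φ (face i σ) = _
  exact Finset.sum_congr rfl fun i _ => by rw [face_eq_natFace]

/-- The cocycle equation on the front `(p + 1)`-face, with its last term moved to the right; both
Leibniz rules below use it in this form. -/
theorem sum_cocycle_front {p k : ℕ} (h : p ≤ k) {φ : Cochain X p} (hφ : coboundary p φ = 0)
    (σ : Simplex X (k + 1)) :
    ∑ i ∈ Finset.range (p + 1), (-1) ^ i * φ (natFace i (front (p + 1) (by omega) σ)) =
      (-1) ^ p * φ (front p (by omega) σ) := by
  have := congrFun hφ (front (p + 1) (by omega) σ)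
  rw [coboundary_apply, Finset.sum_range_succ, front_eq_natFace h] at this
  rw [eq_neg_of_add_eq_zero_left this]
  ring

/-- Faces of index at most `p` affect only the front factor, the others only the back factor.
Cocyclicity of `φ` turns the first group into exactly the term missing from the cocycle equation of
`ψ`. -/
theorem coboundary_cup {p q : ℕ} {φ : Cochain X p} {ψ : Cochain X q} (hφ : coboundary p φ = 0)
    (hψ : coboundary q ψ = 0) : coboundary (p + q) (cup φ ψ) = 0 := by
  ext σ
  rw [coboundary_apply, show p + q + 2 = (p + 1) + (q + 1) by omega, Finset.sum_range_add]
  have h1 : ∑ i ∈ Finset.range (p + 1), (-1) ^ i * cup φ ψ (natFace i σ) =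
      ((-1) ^ p * φ (front p (by omega) σ)) * ψ (back q (by omega) σ) := by
    rw [← sum_cocycle_front (by omega : p ≤ p + q) hφ σ, Finset.sum_mul]
    refine Finset.sum_congr rfl fun i hi => ?_
    have hi' : i ≤ p := by have := Finset.mem_range.1 hi; omega
    rw [cup, front_natFace, back_natFace_le rfl hi', mul_assoc]
  have h2 : ∑ i ∈ Finset.range (q + 1), (-1) ^ (p + 1 + i) * cup φ ψ (natFace (p + 1 + i) σ) =
      ((-1) ^ p * φ (front p (by omega) σ)) *
        ∑ i ∈ Finset.range (q + 1), (-1) ^ (i + 1) * ψ (natFace (i + 1) (back (q + 1) (by omega) σ)) := by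
    rw [Finset.mul_sum]
    refine Finset.sum_congr rfl fun i hi => ?_
    rw [cup, front_natFace_gt _ (by omega), show p + 1 + i = p + (i + 1) by omega,
      back_natFace_ge rfl, pow_add]
    ring
  rw [h1, h2, ← mul_add]
  have h3 := congrFun hψ (back (q + 1) (by omega) σ)
  rw [coboundary_apply, Finset.sum_range_succ', ← back_natFace_ge rfl σ,
    back_natFace_le rfl (by omega)] at h3
  rw [pow_zero, one_mul, add_comm] at h3
  rw [h3, Pi.zero_apply, mul_zero, Pi.zero_apply]

theorem coboundary_cupProd (m : ℕ) {φ : Fin m → Cochain X 1} (hφ : ∀ i, coboundary 1 (φ i) = 0) :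
    coboundary m (cupProd m φ) = 0 := by
  induction m with
  | zero =>
    ext σ
    rw [coboundary_apply]
    simp [cupProd, Finset.sum_range_succ]
  | succ m ih => exact coboundary_cup (ih fun i => hφ _) (hφ _)

theorem pullCochain_cup (f : C(X, Y)) {p q : ℕ} (φ : Cochain Y p) (ψ : Cochain Y q) :
    pullCochain f (p + q) (cup φ ψ) = cup (pullCochain f p φ) (pullCochain f q ψ) := rfl

theorem pullCochain_cupProd (f : C(X, Y)) (m : ℕ) (φ : Fin m → Cochain Y 1) :
    pullCochain f m (cupProd m φ) = cupProd m fun i => pullCochain f 1 (φ i) := by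
  induction m with
  | zero => rfl
  | succ m ih =>
    rw [cupProd, cupProd, ← ih]
    rfl

/-- The same splitting of the faces at `p` as for the cup product: the faces of index at most `p`
supply the zeroth face of the back simplex, the remaining ones its other faces. -/
theorem fboundary_fcap {p q k : ℕ} (h : p + q = k) {φ : Cochain X p} (hφ : coboundary p φ = 0)
    (c : FChain X (k + 1)) :
    fboundary (fcap (q := q + 1) (by omega) φ c) = (-1 : ℤ) ^ p • fcap h φ (fboundary c) := by
  have : fboundary ∘ₗ fcap (q := q + 1) (by omega) φ =
      (-1 : ℤ) ^ p • (fcap h φ ∘ₗ fboundary (k := k)) := by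
    refine chain_hom_ext fun σ => ?_
    simp only [LinearMap.comp_apply, LinearMap.smul_apply, fcap_single, map_smul, fboundary_single,
      map_sum, face_eq_natFace]
    rw [Fin.sum_univ_eq_sum_range fun i => (-1 : ℤ) ^ i •
        (Finsupp.single (natFace i (back (q + 1) (by omega) σ)) 1 : FChain X q),
      Fin.sum_univ_eq_sum_range fun i => (-1 : ℤ) ^ i • φ (front p (by omega) (natFace i σ)) •
        (Finsupp.single (back q (by omega) (natFace i σ)) 1 : FChain X q),
      show k + 2 = (p + 1) + (q + 1) by omega, Finset.sum_range_add _ (p + 1) (q + 1)]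
    have h1 : ∑ i ∈ Finset.range (p + 1), (-1 : ℤ) ^ i • φ (front p (by omega) (natFace i σ)) •
        (Finsupp.single (back q (by omega) (natFace i σ)) 1 : FChain X q) =
        ((-1) ^ p * φ (front p (by omega) σ)) • Finsupp.single (back q (by omega) σ) 1 := by
      rw [← sum_cocycle_front (by omega : p ≤ k) hφ σ, Finset.sum_smul]
      refine Finset.sum_congr rfl fun i hi => ?_
      have hi' : i ≤ p := by have := Finset.mem_range.1 hi; omega
      rw [front_natFace, back_natFace_le h hi', smul_smul]
    have h2 : ∑ i ∈ Finset.range (q + 1), (-1 : ℤ) ^ (p + 1 + i) •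
        φ (front p (by omega) (natFace (p + 1 + i) σ)) •
        (Finsupp.single (back q (by omega) (natFace (p + 1 + i) σ)) 1 : FChain X q) =
        ((-1) ^ p * φ (front p (by omega) σ)) • ∑ i ∈ Finset.range (q + 1), (-1 : ℤ) ^ (i + 1) •
          Finsupp.single (natFace (i + 1) (back (q + 1) (by omega) σ)) 1 := by
      rw [Finset.smul_sum]
      refine Finset.sum_congr rfl fun i hi => ?_
      rw [front_natFace_gt _ (by omega), show p + 1 + i = p + (i + 1) by omega,
        back_natFace_ge h, smul_smul, smul_smul, pow_add]
      congr 1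
      ring
    rw [h1, h2, ← smul_add, smul_smul, ← mul_assoc, ← mul_pow, Finset.sum_range_succ']
    rw [← back_natFace_ge h, back_natFace_le h (by omega)]
    simp only [neg_mul_neg, one_mul, one_pow, pow_zero, one_smul]
    exact congrArg _ (add_comm _ _)
  exact LinearMap.congr_fun this c

theorem fpush_fcap (g : C(X, Y)) {p q k : ℕ} (h : p + q = k) (φ : Cochain Y p) (c : FChain X k) :
    fpush g (fcap h (pullCochain g p φ) c) = fcap h φ (fpush g c) := by
  have : fpush g ∘ₗ fcap h (pullCochain g p φ) = fcap h φ ∘ₗ fpush g := by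
    refine chain_hom_ext fun σ => ?_
    simp only [LinearMap.comp_apply, fcap_single, map_smul, fpush_single]
    rfl
  exact LinearMap.congr_fun this c

theorem range_front_subset {p k : ℕ} (h : p ≤ k) (σ : Simplex X k) :
    range (front p h σ) ⊆ range σ := by
  rintro _ ⟨t, rfl⟩
  exact ⟨_, rfl⟩

theorem range_back_subset {q k : ℕ} (h : q ≤ k) (σ : Simplex X k) :
    range (back q h σ) ⊆ range σ := by
  rintro _ ⟨t, rfl⟩
  exact ⟨_, rfl⟩

theorem cap_congr {p q k : ℕ} (h : p + q = k) {φ : Cochain X p} {a b : Chain X k} {A : Set X}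
    (hab : ∀ σ : Simplex X k, ¬ range σ ⊆ A →
      a σ * φ (front p (by omega) σ) = b σ * φ (front p (by omega) σ))
    {ρ : Simplex X q} (hρ : ¬ range ρ ⊆ A) : cap h a φ ρ = cap h b φ ρ := by
  classical
  refine finsum_congr fun σ => ?_
  beta_reduce
  by_cases hb : back q (by omega) σ = ρ
  · rw [if_pos hb]
    exact hab σ fun hs => hρ (hb ▸ (range_back_subset _ σ).trans hs)
  · rw [if_neg hb, mul_zero, mul_zero]

theorem exists_of_cap_ne_zero {p q k : ℕ} (h : p + q = k) {φ : Cochain X p} {a : Chain X k}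
    {ρ : Simplex X q} (hρ : cap h a φ ρ ≠ 0) :
    ∃ σ, a σ ≠ 0 ∧ φ (front p (by omega) σ) ≠ 0 ∧ back q (by omega) σ = ρ := by
  classical
  obtain ⟨σ, hσ⟩ := exists_of_transfer_ne_zero hρ
  have h' := mul_ne_zero_iff.1 hσ
  by_cases hb : back q (by omega) σ = ρ
  · exact ⟨σ, h'.1, by simpa [hb] using h'.2, hb⟩
  · exact absurd (if_neg hb) h'.2

theorem not_subset_compl_range {k : ℕ} (ρ : Simplex X k) : ¬ range ρ ⊆ (range ρ)ᶜ := by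
  intro h
  obtain ⟨x, hx⟩ := range_simplex_nonempty ρ
  exact h hx hx

/-- The coefficient at `ρ` involves only simplices that meet `range ρ`, of which there are finitely
many. After truncation the Leibniz rule for finite chains applies. -/
theorem boundary_cap_eq_zero {p q k : ℕ} (h : p + (q + 1) = k) {a : Chain X k} (ha : LocFin a)
    (hb : boundary a = 0) {φ : Cochain X p} (hφ : coboundary p φ = 0) :
    boundary (cap h a φ) = 0 := by
  cases k with
  | zero => omega
  | succ k =>
    ext ρ
    have hρ := not_subset_compl_range ρ
    set A := (range ρ)ᶜ with hA
    obtain ⟨c, hc⟩ : ∃ c : FChain X (k + 1), ⇑c = truncate A a := by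
      refine exists_coe_eq ((ha _ (isCompact_range_simplex ρ)).subset fun σ hσ => ?_)
      have hs : ¬ range σ ⊆ A := fun hs => hσ (if_pos hs)
      rw [mem_ofPred_eq, truncate_of_not a hs] at hσ
      obtain ⟨x, hx, hxA⟩ := not_subset.1 hs
      exact ⟨hσ, x, hx, not_not.1 hxA⟩
    have hac : ∀ σ : Simplex X (k + 1), ¬ range σ ⊆ A → a σ = c σ := fun σ hσ => by
      rw [hc, truncate_of_not a hσ]
    have e1 : boundary (cap h a φ) ρ = boundary (cap h (⇑c) φ) ρ :=
      boundary_congr (fun τ hτ => cap_congr h (fun σ hσ => by rw [hac σ hσ]) hτ) ρ hρ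
    have hpq : p + q = k := by omega
    rw [e1, cap_coe, boundary_coe, fboundary_fcap hpq hφ, Finsupp.smul_apply, ← cap_coe,
      ← boundary_coe]
    have e2 : cap hpq (boundary (⇑c : Chain X (k + 1))) φ ρ = cap hpq (0 : Chain X k) φ ρ := by
      refine cap_congr hpq (fun τ hτ => ?_) hρ
      have : boundary (⇑c : Chain X (k + 1)) τ = boundary a τ :=
        boundary_congr (fun σ hσ => (hac σ hσ).symm) τ hτ
      rw [hb] at this
      exact congrArg (· * _) this
    rw [e2]
    simp [cap, transfer]

end Products

/-! ### Relative homology classes of finite chains -/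

section RelClass

variable {X Y Z : Type*} [TopologicalSpace X] [TopologicalSpace Y] [TopologicalSpace Z]

/-- Finite relative cycles. -/
def IsRelCycle (A : Set X) {k : ℕ} (c : FChain X (k + 1)) : Prop :=
  fboundary c ∈ chainsIn (simplicesIn A k)

theorem IsRelCycle.mem {A : Set X} {k : ℕ} {c : FChain X (k + 1)} (h : IsRelCycle A c) :
    (⇑c : Chain X (k + 1)) ∈ relCycles A (k + 1) :=
  mem_relCycles.2 ⟨finite_coe c, fun ρ hρ => by
    rw [boundary_coe]
    exact mem_chainsIn.1 h ρ hρ⟩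

/-- The class of a finite relative cycle. -/
def relClass (A : Set X) {k : ℕ} (c : FChain X (k + 1)) (h : IsRelCycle A c) :
    RelHomology A (k + 1) :=
  QuotientAddGroup.mk ⟨⇑c, h.mem⟩

theorem isRelCycle_of_mem {A : Set X} {k : ℕ} {c : FChain X (k + 1)}
    (h : (⇑c : Chain X (k + 1)) ∈ relCycles A (k + 1)) : IsRelCycle A c :=
  mem_chainsIn.2 fun ρ hρ => by
    rw [← boundary_coe]
    exact (mem_relCycles.1 h).2 ρ hρ

theorem mk_eq_relClass {A : Set X} {k : ℕ} (z : relCycles A (k + 1)) {c : FChain X (k + 1)}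
    (h : ⇑c = z.1) :
    ∃ hc : IsRelCycle A c, (z : RelHomology A (k + 1)) = relClass A c hc := by
  refine ⟨isRelCycle_of_mem (h ▸ z.2), ?_⟩
  exact congrArg QuotientAddGroup.mk (Subtype.ext h.symm)

theorem exists_relClass {A : Set X} {k : ℕ} (x : RelHomology A (k + 1)) :
    ∃ c, ∃ hc : IsRelCycle A c, x = relClass A c hc := by
  obtain ⟨z, rfl⟩ := QuotientAddGroup.mk_surjective x
  obtain ⟨c, hc⟩ := exists_coe_eq (mem_relCycles.1 z.2).1
  exact ⟨c, mk_eq_relClass z hc⟩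

theorem relClass_eq {A : Set X} {k : ℕ} {c d : FChain X (k + 1)} {hc : IsRelCycle A c}
    {hd : IsRelCycle A d} : relClass A c hc = relClass A d hd ↔
      ∃ e, c - d - fboundary e ∈ chainsIn (simplicesIn A (k + 1)) := by
  rw [eq_comm, relClass, relClass, QuotientAddGroup.eq, AddSubgroup.mem_addSubgroupOf,
    mem_relBoundaries]
  constructor
  · rintro ⟨e, he, h⟩
    obtain ⟨e, rfl⟩ := exists_coe_eq he
    refine ⟨e, mem_chainsIn.2 fun ρ hρ => ?_⟩
    have := h ρ hρ
    rw [boundary_coe] at this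
    change -d ρ + c ρ = fboundary e ρ at this
    simp only [Finsupp.sub_apply, ← this]
    ring
  · rintro ⟨e, he⟩
    refine ⟨⇑e, finite_coe e, fun ρ hρ => ?_⟩
    have := mem_chainsIn.1 he ρ hρ
    rw [boundary_coe]
    change -d ρ + c ρ = fboundary e ρ
    simp only [Finsupp.sub_apply] at this
    linarith

theorem relClass_congr {A : Set X} {k : ℕ} {c d : FChain X (k + 1)} (hc : IsRelCycle A c)
    (hd : IsRelCycle A d) (h : c - d ∈ chainsIn (simplicesIn A (k + 1))) :
    relClass A c hc = relClass A d hd :=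
  relClass_eq.2 ⟨0, by rwa [map_zero, sub_zero]⟩

theorem relClass_eq_zero {A : Set X} {k : ℕ} {c : FChain X (k + 1)} {hc : IsRelCycle A c} :
    relClass A c hc = 0 ↔ ∃ e, c - fboundary e ∈ chainsIn (simplicesIn A (k + 1)) := by
  have h0 : IsRelCycle A (0 : FChain X (k + 1)) := by
    rw [IsRelCycle, map_zero]
    exact zero_mem _
  have : relClass A 0 h0 = 0 := rfl
  rw [← this, relClass_eq]
  simp only [sub_zero]

theorem IsRelCycle.fpush {A : Set X} {B : Set Y} {g : C(X, Y)} (h : MapsTo g A B) {k : ℕ}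
    {c : FChain X (k + 1)} (hc : IsRelCycle A c) : IsRelCycle B (SYS.fpush g c) := by
  rw [IsRelCycle, ← fpush_fboundary]
  exact fpush_mem h hc

theorem relMap_relClass {A : Set X} {B : Set Y} {g : C(X, Y)} (h : MapsTo g A B) {k : ℕ}
    {c : FChain X (k + 1)} (hc : IsRelCycle A c) :
    relMap g h (k + 1) (relClass A c hc) = relClass B (fpush g c) (hc.fpush h) :=
  congrArg QuotientAddGroup.mk (Subtype.ext (pushChain_coe g c))

theorem fpush_comp (g : C(X, Y)) (f : C(Y, Z)) {k : ℕ} (c : FChain X k) :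
    fpush f (fpush g c) = fpush (f.comp g) c := by
  have : fpush f ∘ₗ fpush g = fpush (f.comp g) (k := k) := by
    refine chain_hom_ext fun σ => ?_
    simp only [LinearMap.comp_apply, fpush_single, ContinuousMap.comp_assoc]
  exact LinearMap.congr_fun this c

theorem fpush_id {k : ℕ} (c : FChain X k) : fpush (ContinuousMap.id X) c = c := by
  have : fpush (ContinuousMap.id X) (k := k) = LinearMap.id := by
    refine chain_hom_ext fun σ => ?_
    rw [fpush_single, ContinuousMap.id_comp, LinearMap.id_apply]
  exact LinearMap.congr_fun this c

theorem relMap_relMap {A : Set X} {B : Set Y} {D : Set Z} {g : C(X, Y)} {f : C(Y, Z)}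
    (hg : MapsTo g A B) (hf : MapsTo f B D) (hfg : MapsTo (f.comp g) A D) {k : ℕ}
    (x : RelHomology A (k + 1)) :
    relMap f hf (k + 1) (relMap g hg (k + 1) x) = relMap (f.comp g) hfg (k + 1) x := by
  obtain ⟨c, hc, rfl⟩ := exists_relClass x
  rw [relMap_relClass, relMap_relClass, relMap_relClass]
  exact relClass_congr _ _ (by rw [fpush_comp, sub_self]; exact zero_mem _)

/-- The map of relative homology groups induced by an inclusion. -/
def relIncl {A B : Set X} (h : A ⊆ B) (k : ℕ) : RelHomology A k →+ RelHomology B k :=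
  relMap (ContinuousMap.id X) (A := A) (B := B) h k

theorem relIncl_relClass {A B : Set X} (h : A ⊆ B) {k : ℕ} {c : FChain X (k + 1)}
    (hc : IsRelCycle A c) : ∃ hc' : IsRelCycle B c,
      relIncl h (k + 1) (relClass A c hc) = relClass B c hc' := by
  have hc' : IsRelCycle B c := chainsIn_mono (fun _ hσ => hσ.trans h) hc
  refine ⟨hc', (relMap_relClass (g := ContinuousMap.id X) h hc).trans ?_⟩
  exact relClass_congr _ _ (by rw [fpush_id, sub_self]; exact zero_mem _)

/-- The restriction to `H_k(X, A)` is represented by every finite chain that agrees with the given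
cycle on the simplices outside `A`. -/
theorem restrict_eq_relClass {V A : Set X} {h : ∃ K, IsCompact K ∧ V \ K ⊆ A} {k : ℕ}
    (z : endCycles V (k + 1)) {c : FChain X (k + 1)}
    (hcz : ∀ σ : Simplex X (k + 1), ¬ range σ ⊆ A → c σ = z.1 σ) :
    ∃ hc : IsRelCycle A c, restrict V A h (k + 1) z = relClass A c hc := by
  obtain ⟨d, hd⟩ := exists_coe_eq (truncate_finite h z.2.1)
  obtain ⟨hd', hdz⟩ := mk_eq_relClass (A := A) (k := k) ⟨truncate A z.1, mem_relCycles.2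
    ⟨truncate_finite h z.2.1, fun ρ hρ => by
      refine (boundary_congr (fun σ hσ => truncate_of_not z.1 hσ) ρ hρ).trans ?_
      rw [z.2.2]
      rfl⟩⟩ hd
  have hcd : c - d ∈ chainsIn (simplicesIn A (k + 1)) := mem_chainsIn.2 fun σ hσ => by
    rw [Finsupp.sub_apply, hcz σ hσ, hd, truncate_of_not z.1 hσ, sub_self]
  have hc : IsRelCycle A c := by
    have : fboundary c = fboundary (c - d) + fboundary d := by rw [map_sub, sub_add_cancel]
    rw [IsRelCycle, this]
    exact add_mem (fboundary_mem hcd) hd'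
  refine ⟨hc, ?_⟩
  rw [relClass_congr hc hd' hcd, ← hdz]
  rfl

theorem exists_restrict_eq_relClass {V A : Set X} {h : ∃ K, IsCompact K ∧ V \ K ⊆ A} {k : ℕ}
    (z : endCycles V (k + 1)) : ∃ c : FChain X (k + 1),
      (∀ σ : Simplex X (k + 1), ¬ range σ ⊆ A → c σ = z.1 σ) ∧
      ∃ hc : IsRelCycle A c, restrict V A h (k + 1) z = relClass A c hc := by
  obtain ⟨d, hd⟩ := exists_coe_eq (truncate_finite h z.2.1)
  have hcz : ∀ σ : Simplex X (k + 1), ¬ range σ ⊆ A → d σ = z.1 σ := fun σ hσ => by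
    rw [hd, truncate_of_not z.1 hσ]
  exact ⟨d, hcz, restrict_eq_relClass z hcz⟩

theorem relIncl_restrict {V A B : Set X} (hA : ∃ K, IsCompact K ∧ V \ K ⊆ A)
    (hB : ∃ K, IsCompact K ∧ V \ K ⊆ B) (hAB : A ⊆ B) {k : ℕ} (x : EndHomology V (k + 1)) :
    relIncl hAB (k + 1) (restrict V A hA (k + 1) x) = restrict V B hB (k + 1) x := by
  obtain ⟨z, rfl⟩ := QuotientAddGroup.mk_surjective x
  obtain ⟨c, hcz, hc, h⟩ := exists_restrict_eq_relClass (h := hA) z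
  obtain ⟨hc1, h1⟩ := relIncl_relClass hAB hc
  obtain ⟨hc2, h2⟩ := restrict_eq_relClass (h := hB) z fun σ hσ => hcz σ fun hs => hσ (hs.trans hAB)
  exact (congrArg _ h).trans (h1.trans h2.symm)

/-- A homotopy that starts at the identity and preserves `A` ends at a map that acts trivially on
`H_k(X, A)`. -/
theorem relMap_stage {h : C(X × unitInterval, X)} (h0 : stage h 0 = ContinuousMap.id X) {A : Set X}
    (hA : ∀ x ∈ A, ∀ u, h (x, u) ∈ A) (hm : MapsTo (stage h 1) A A) {k : ℕ}
    (x : RelHomology A (k + 1)) : relMap (stage h 1) hm (k + 1) x = x := by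
  obtain ⟨c, hc, rfl⟩ := exists_relClass x
  rw [relMap_relClass]
  refine relClass_eq.2 ⟨fprism h c, ?_⟩
  rw [fboundary_fprism, h0, fpush_id, sub_sub_cancel]
  exact fprism_mem hA hc

end RelClass

/-! ### Spherical classes -/

section Hurewicz

variable {X Y : Type*} [TopologicalSpace X] [TopologicalSpace Y]

theorem single_eq_coe {k : ℕ} (σ : Simplex X k) :
    single σ = ⇑(Finsupp.single σ 1 : FChain X k) := by
  classical
  funext ρ
  simp [single, Pi.single_apply, Finsupp.single_apply, eq_comm]

/-- Finite chain version of `IsSphericalCycle`. -/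
def IsSphericalChain (A : Set X) (z : FChain X 2) : Prop :=
  (∃ σ : Simplex X 2, MapsTo σ triangleBoundary A ∧ z = Finsupp.single σ 1) ∨
    ∃ (σ : Simplex X 2) (x : X), MapsTo σ triangleBoundary {x} ∧
      z = Finsupp.single σ 1 - Finsupp.single (ContinuousMap.const _ x) 1

theorem isSphericalCycle_coe {A : Set X} {z : FChain X 2} :
    IsSphericalCycle A z ↔ IsSphericalChain A z := by
  simp only [IsSphericalCycle, IsSphericalChain, single_eq_coe, ← Finsupp.coe_sub,
    DFunLike.coe_fn_eq]

theorem face_vertexMap_mem {i : Fin 3} (t : stdSimplex ℝ (Fin 2)) :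
    vertexMap i.succAbove t ∈ triangleBoundary := by
  classical
  refine ⟨i, ?_⟩
  refine (FunOnFinite.linearMap_apply_apply ..).trans (Finset.sum_eq_zero fun j hj => ?_)
  exact absurd (Finset.mem_filter.1 hj).2 (Fin.succAbove_ne i j)

theorem range_face_subset_of_mapsTo {σ : Simplex X 2} {A : Set X}
    (h : MapsTo σ triangleBoundary A) (i : Fin 3) : range (face i σ) ⊆ A := by
  rintro _ ⟨t, rfl⟩
  exact h (face_vertexMap_mem t)

theorem IsSphericalChain.isRelCycle {A : Set X} {z : FChain X 2} (h : IsSphericalChain A z) :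
    IsRelCycle A z := by
  rcases h with ⟨σ, hσ, rfl⟩ | ⟨σ, x, hσ, rfl⟩
  · rw [IsRelCycle, fboundary_single]
    exact Submodule.sum_mem _ fun i _ => Submodule.smul_mem _ _
      (single_mem_chainsIn (range_face_subset_of_mapsTo hσ i))
  · rw [IsRelCycle, map_sub, fboundary_single, fboundary_single, ← Finset.sum_sub_distrib]
    refine Submodule.sum_mem _ fun i _ => ?_
    have : face i σ = face i (ContinuousMap.const _ x) :=
      ContinuousMap.ext fun t => hσ (face_vertexMap_mem t)
    rw [this, sub_self]
    exact zero_mem _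

theorem IsSphericalChain.relClass_mem {A : Set X} {z : FChain X 2} (h : IsSphericalChain A z) :
    relClass A z h.isRelCycle ∈ hurewiczImage A :=
  AddSubgroup.subset_closure ⟨⟨⇑z, h.isRelCycle.mem⟩, isSphericalCycle_coe.2 h, rfl⟩

theorem hurewiczImage_induction {A : Set X} {P : RelHomology A 2 → Prop}
    (hs : ∀ z (h : IsSphericalChain A z), P (relClass A z h.isRelCycle)) (h0 : P 0)
    (hadd : ∀ x y, P x → P y → P (x + y)) (hneg : ∀ x, P x → P (-x)) {x : RelHomology A 2}
    (hx : x ∈ hurewiczImage A) : P x := by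
  induction hx using AddSubgroup.closure_induction with
  | mem x hx =>
    obtain ⟨z, hz, rfl⟩ := hx
    obtain ⟨c, hc⟩ := exists_coe_eq (mem_relCycles.1 z.2).1
    rw [← hc, isSphericalCycle_coe] at hz
    obtain ⟨hc', h⟩ := mk_eq_relClass z hc
    rw [h]
    exact hs c hz
  | zero => exact h0
  | add x y _ _ hx hy => exact hadd x y hx hy
  | neg x _ hx => exact hneg x hx

theorem relMap_mem_hurewiczImage {A : Set X} {B : Set Y} {g : C(X, Y)} (h : MapsTo g A B)
    {x : RelHomology A 2} (hx : x ∈ hurewiczImage A) : relMap g h 2 x ∈ hurewiczImage B := by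
  refine hurewiczImage_induction (P := fun x => relMap g h 2 x ∈ hurewiczImage B)
    (fun z hz => ?_) ?_ (fun x y hx hy => ?_) (fun x hx => ?_) hx
  · have : IsSphericalChain B (fpush g z) := by
      rcases hz with ⟨σ, hσ, rfl⟩ | ⟨σ, x, hσ, rfl⟩
      · exact Or.inl ⟨g.comp σ, h.comp hσ, fpush_single g σ⟩
      · refine Or.inr ⟨g.comp σ, g x, fun t ht => congrArg g (hσ ht), ?_⟩
        rw [map_sub, fpush_single, fpush_single]
        rfl
    rw [relMap_relClass]
    exact this.relClass_mem
  · rw [map_zero]; exact zero_mem _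
  · rw [map_add]; exact add_mem hx hy
  · rw [map_neg]; exact neg_mem hx

/-- The boundary is the union of three edges, glued at common vertices. Connectedness is needed so
that the boundary of a disc cannot lie partly in `A` and partly at an isolated point. -/
theorem isPreconnected_triangleBoundary : IsPreconnected triangleBoundary := by
  have hedge : ∀ i : Fin 3, IsPreconnected (range (vertexMap (p := 1) (k := 2) i.succAbove)) :=
    fun i => isPreconnected_range (ContinuousMap.continuous _)
  have hvert : ∀ (i : Fin 3) (j : Fin 2), stdSimplex.vertex (S := ℝ) (i.succAbove j) ∈
      range (vertexMap (p := 1) (k := 2) i.succAbove) := fun i j =>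
    ⟨stdSimplex.vertex j, stdSimplex.map_vertex _ _⟩
  have hunion : triangleBoundary = range (vertexMap (p := 1) (k := 2) (Fin.succAbove 0)) ∪
      range (vertexMap (p := 1) (k := 2) (Fin.succAbove 1)) ∪
      range (vertexMap (p := 1) (k := 2) (Fin.succAbove 2)) := by
    refine Subset.antisymm ?_ ?_
    · rintro t ⟨i, hi⟩
      have : t ∈ range (vertexMap (p := 1) (k := 2) i.succAbove) := by
        have hsum : ∑ j : Fin 2, t.1 (i.succAbove j) = 1 := by
          have := t.2.2
          rw [Fin.sum_univ_succAbove _ i] at this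
          rwa [show t.1 i = 0 from hi, zero_add] at this
        refine ⟨⟨fun j => t.1 (i.succAbove j), fun j => t.2.1 _, hsum⟩, ?_⟩
        have e1 := affineSimplex_comp_vertexMap (convex_std 2) (stdVertex 2) i.succAbove
        rw [affineSimplex_stdVertex, ContinuousMap.id_comp] at e1
        rw [e1]
        refine Subtype.ext ?_
        rw [affineSimplex_coe]
        have e2 := congrArg Subtype.val (DFunLike.congr_fun (affineSimplex_stdVertex 2) t)
        rw [affineSimplex_coe, Fin.sum_univ_succAbove _ i, show t.1 i = 0 from hi, zero_smul,
          zero_add] at e2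
        exact e2
      fin_cases i
      · exact Or.inl (Or.inl this)
      · exact Or.inl (Or.inr this)
      · exact Or.inr this
    · rintro t ((⟨s, rfl⟩ | ⟨s, rfl⟩) | ⟨s, rfl⟩) <;> exact face_vertexMap_mem s
  rw [hunion]
  refine IsPreconnected.union (stdSimplex.vertex 0) (Or.inr ?_) ?_
    (IsPreconnected.union (stdSimplex.vertex 2) ?_ ?_ (hedge 0) (hedge 1)) (hedge 2)
  · exact hvert 1 0
  · exact hvert 2 0
  · exact hvert 0 1
  · exact hvert 1 1

theorem subset_or_subset_singleton {A O S : Set X} {b : X} (hA : IsOpen A) (hO : IsOpen O)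
    (hAO : Disjoint A O) (hb : b ∈ O) (hS : IsPreconnected S) (h : S ⊆ A ∪ {b}) :
    S ⊆ A ∨ S ⊆ {b} := by
  rcases hS.subset_or_subset hA hO hAO
    (h.trans (union_subset_union_right A (singleton_subset_iff.2 hb))) with h' | h'
  · exact Or.inl h'
  · refine Or.inr fun x hx => (h hx).resolve_left fun hxA => ?_
    exact disjoint_left.1 hAO hxA (h' hx)

theorem isPreconnected_range_simplex {k : ℕ} (σ : Simplex X k) : IsPreconnected (range σ) :=
  isPreconnected_range σ.continuous

/-- Since `b` is isolated from `A`, a chain in `A ∪ {b}` is a chain in `A` plus a multiple of the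
constant simplex at `b`. The boundary of the constant `2`-simplex is the constant `1`-simplex, so a
boundary in `A` forces that multiple to vanish. -/
theorem relIncl_point_injective {A O : Set X} {b : X} (hA : IsOpen A) (hO : IsOpen O)
    (hAO : Disjoint A O) (hb : b ∈ O) {x : RelHomology A 2}
    (hx : relIncl (subset_union_left (t := {b})) 2 x = 0) : x = 0 := by
  classical
  obtain ⟨c, hc, rfl⟩ := exists_relClass x
  obtain ⟨hc', h⟩ := relIncl_relClass (subset_union_left (s := A) (t := {b})) hc
  obtain ⟨e, he⟩ := relClass_eq_zero.1 (h.symm.trans hx)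
  refine relClass_eq_zero.2 ⟨e, ?_⟩
  have hbA : b ∉ A := fun h => disjoint_left.1 hAO h hb
  set r := c - fboundary e with hr
  have hconst : ∀ {k : ℕ}, ¬ range (ContinuousMap.const _ b : Simplex X k) ⊆ A := fun hs => by
    obtain ⟨y, hy⟩ := range_simplex_nonempty (ContinuousMap.const _ b : Simplex X _)
    obtain ⟨t, rfl⟩ := id hy
    exact hbA (hs hy)
  set κ : Simplex X 2 := ContinuousMap.const _ b with hκ
  -- Every simplex of `r` outside `A` is constant at `b`, hence equal to `κ`.
  have h1 : r - r κ • Finsupp.single κ 1 ∈ chainsIn (simplicesIn A 2) := by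
    refine mem_chainsIn.2 fun σ hσ => ?_
    by_cases hσκ : σ = κ
    · simp [hσκ]
    · have : r σ = 0 := by
        by_contra hne
        have hs : range σ ⊆ A ∪ {b} := by
          by_contra hs
          exact hne (mem_chainsIn.1 he σ hs)
        rcases subset_or_subset_singleton hA hO hAO hb (isPreconnected_range_simplex σ) hs
          with h' | h'
        · exact hσ h'
        · exact hσκ (ContinuousMap.ext fun t => h' ⟨t, rfl⟩)
      simp [this, Ne.symm hσκ]
  -- The three faces coincide and the alternating sum `1 - 1 + 1` is `1`.
  have h2 : fboundary (Finsupp.single κ 1) =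
      (Finsupp.single (ContinuousMap.const _ b) 1 : FChain X 1) := by
    have : ∀ i, face i κ = ContinuousMap.const _ b := fun i => rfl
    rw [fboundary_single]
    simp [this, Fin.sum_univ_succ]
  have h3 : fboundary r = fboundary c := by
    rw [hr, map_sub, fboundary_fboundary, sub_zero]
  have h4 := mem_chainsIn.1 (fboundary_mem h1) (ContinuousMap.const _ b) hconst
  have h5 := mem_chainsIn.1 hc (ContinuousMap.const _ b) hconst
  rw [map_sub, map_smul, h2, h3, Finsupp.sub_apply, h5, Finsupp.smul_apply,
    Finsupp.single_eq_same] at h4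
  have h6 : r κ = 0 := by simpa using h4
  rwa [h6, zero_smul, sub_zero] at h1

/-- The boundary of a disc is connected. It either lies in `A`, or is mapped entirely to `b`, and
then the disc is a sphere, whose cycle differs from the disc only by the constant simplex at `b`. -/
theorem exists_lift_hurewiczImage {A O : Set X} {b : X} (hA : IsOpen A) (hO : IsOpen O)
    (hAO : Disjoint A O) (hb : b ∈ O) {y : RelHomology (A ∪ {b}) 2}
    (hy : y ∈ hurewiczImage (A ∪ {b})) :
    ∃ x ∈ hurewiczImage A, relIncl (subset_union_left (t := {b})) 2 x = y := by
  refine hurewiczImage_induction (P := fun y => ∃ x ∈ hurewiczImage A,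
    relIncl (subset_union_left (t := {b})) 2 x = y) (fun z hz => ?_) ?_ ?_ ?_ hy
  · have key : ∀ z' (hz' : IsSphericalChain A z'),
        z' - z ∈ chainsIn (simplicesIn (A ∪ {b}) 2) → ∃ x ∈ hurewiczImage A,
          relIncl (subset_union_left (t := {b})) 2 x = relClass _ z hz.isRelCycle := by
      intro z' hz' h
      obtain ⟨hc', h'⟩ := relIncl_relClass (subset_union_left (s := A) (t := {b})) hz'.isRelCycle
      exact ⟨_, hz'.relClass_mem, h'.trans (relClass_congr _ _ h)⟩
    have key' : IsSphericalChain A z → ∃ x ∈ hurewiczImage A,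
          relIncl (subset_union_left (t := {b})) 2 x = relClass _ z hz.isRelCycle := fun h =>
      key z h (by rw [sub_self]; exact zero_mem _)
    rcases id hz with ⟨σ, hσ, h⟩ | h
    · have hpre := isPreconnected_triangleBoundary.image σ σ.continuous.continuousOn
      rcases subset_or_subset_singleton hA hO hAO hb hpre hσ.image_subset with h' | h'
      · exact key' (Or.inl ⟨σ, mapsTo_iff_image_subset.2 h', h⟩)
      · refine key _ (Or.inr ⟨σ, b, mapsTo_iff_image_subset.2 h', rfl⟩) ?_
        rw [h, sub_right_comm, sub_self, zero_sub]
        refine neg_mem (single_mem_chainsIn ?_)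
        rintro _ ⟨t, rfl⟩
        exact Or.inr rfl
    · exact key' (Or.inr h)
  · exact ⟨0, zero_mem _, map_zero _⟩
  · rintro _ _ ⟨x, hx, rfl⟩ ⟨y, hy, rfl⟩
    exact ⟨x + y, add_mem hx hy, map_add _ _ _⟩
  · rintro _ ⟨x, hx, rfl⟩
    exact ⟨-x, neg_mem hx, map_neg _ _⟩

/-- A class of `H_2(X, A)` is in the image of the Hurewicz map if it is so after adding to `A` a
set `B`, disjoint from `A`, that can be contracted in `X` relative to `A`. -/
theorem mem_hurewiczImage_of_contractible {A B O : Set X} {b : X} (hA : IsOpen A) (hO : IsOpen O)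
    (hAO : Disjoint A O) (hb : b ∈ O) {h : C(X × unitInterval, X)}
    (h0 : stage h 0 = ContinuousMap.id X) (hhA : ∀ x ∈ A, ∀ u, h (x, u) ∈ A)
    (hhB : ∀ x ∈ B, h (x, 1) = b) {x : RelHomology A 2}
    (hx : relIncl (subset_union_left (t := B)) 2 x ∈ hurewiczImage (A ∪ B)) :
    x ∈ hurewiczImage A := by
  -- The time-one map collapses `B` to the point `b`. It acts trivially on `H_2(X, A)`, so the class
  -- stays the same while `B` is replaced by `{b}`.
  have hm : MapsTo (stage h 1) (A ∪ B) (A ∪ {b}) := by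
    rintro y (hy | hy)
    · exact Or.inl (hhA y hy 1)
    · exact Or.inr (hhB y hy)
  have hmA : MapsTo (stage h 1) A A := fun y hy => hhA y hy 1
  have hmA' : MapsTo (stage h 1) A (A ∪ {b}) := hmA.mono_right subset_union_left
  have h1 := relMap_mem_hurewiczImage hm hx
  have h2 : relMap (stage h 1) hm 2 (relIncl (subset_union_left (t := B)) 2 x) =
      relIncl (subset_union_left (t := {b})) 2 x := by
    have e1 : relMap (stage h 1) hm 2 (relIncl (subset_union_left (t := B)) 2 x) =
        relMap ((stage h 1).comp (ContinuousMap.id X)) hmA' 2 x := relMap_relMap _ _ _ x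
    have e2 : relIncl (subset_union_left (t := {b})) 2 (relMap (stage h 1) hmA 2 x) =
        relMap ((ContinuousMap.id X).comp (stage h 1)) hmA' 2 x := relMap_relMap _ _ _ x
    rw [relMap_stage h0 hhA hmA] at e2
    exact e1.trans e2.symm
  rw [h2] at h1
  obtain ⟨y, hy, hyx⟩ := exists_lift_hurewiczImage hA hO hAO hb h1
  have : x - y = 0 := relIncl_point_injective hA hO hAO hb (by rw [map_sub, hyx, sub_self])
  rwa [sub_eq_zero.1 this]

end Hurewicz

/-! ### The degree formula -/

section DegreeFormula

variable {X Y : Type*} [TopologicalSpace X] [TopologicalSpace Y]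

theorem IsRelCycle.smul {A : Set X} {k : ℕ} {c : FChain X (k + 1)} (hc : IsRelCycle A c) (d : ℤ) :
    IsRelCycle A (d • c) := by
  rw [IsRelCycle, map_smul]
  exact Submodule.smul_mem _ _ hc

theorem smul_relClass {A : Set X} {k : ℕ} {c : FChain X (k + 1)} (hc : IsRelCycle A c) (d : ℤ) :
    d • relClass A c hc = relClass A (d • c) (hc.smul d) :=
  congrArg QuotientAddGroup.mk (Subtype.ext (Finsupp.coe_smul d c).symm)

theorem pushChain_congr {g : C(X, Y)} {k : ℕ} {a b : Chain X k} {ρ : Simplex Y k}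
    (h : ∀ σ : Simplex X k, g.comp σ = ρ → a σ = b σ) : pushChain g a ρ = pushChain g b ρ := by
  classical
  refine finsum_congr fun σ => ?_
  beta_reduce
  by_cases hσ : g.comp σ = ρ
  · rw [h σ hσ]
  · rw [if_neg hσ, mul_zero, mul_zero]

theorem restrict_pushforward {g : C(X, Y)} (hg : ∀ K, IsCompact K → IsCompact (g ⁻¹' K))
    {K : Set Y} (hK : IsCompact K) (hm : MapsTo g (g ⁻¹' K)ᶜ Kᶜ) {k : ℕ}
    (a : EndHomology (univ : Set X) (k + 1)) :
    restrict univ Kᶜ (compl_near_infinity hK) (k + 1) (pushforward g hg (k + 1) a) =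
      relMap g hm (k + 1)
        (restrict univ (g ⁻¹' K)ᶜ (compl_near_infinity (hg K hK)) (k + 1) a) := by
  obtain ⟨z, rfl⟩ := QuotientAddGroup.mk_surjective a
  obtain ⟨c, hcz, hc, h⟩ :=
    exists_restrict_eq_relClass (h := compl_near_infinity (hg K hK)) z
  have hpush : ∃ w : endCycles (univ : Set Y) (k + 1), w.1 = pushChain g z.1 ∧
      pushforward g hg (k + 1) z = w := ⟨⟨pushChain g z.1, _⟩, rfl, rfl⟩
  obtain ⟨w, hw, hpw⟩ := hpush
  obtain ⟨hc', h'⟩ := restrict_eq_relClass (h := compl_near_infinity hK) w (c := fpush g c) (by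
    intro ρ hρ
    rw [← pushChain_coe, hw]
    refine pushChain_congr fun σ hσ => hcz σ fun hs => hρ ?_
    rw [← hσ]
    rintro _ ⟨t, rfl⟩
    exact hs ⟨t, rfl⟩)
  refine (congrArg _ hpw).trans (h'.trans ?_)
  refine Eq.trans ?_ (congrArg (relMap g hm (k + 1)) h).symm
  rw [relMap_relClass]

theorem boundary_congr_small {A B : Set X} {k : ℕ} {a b : Chain X (k + 1)}
    (h : ∀ σ, σ ∉ smallSimplices A B (k + 1) → a σ = b σ) {ρ : Simplex X k}
    (hρ : ρ ∉ smallSimplices A B k) : boundary a ρ = boundary b ρ := by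
  refine finsum_congr fun σ => ?_
  by_cases hi : incidence σ ρ = 0
  · rw [hi, mul_zero, mul_zero]
  · rw [h σ fun hs => hρ (hs.imp (range_subset_of_incidence hi).trans
      (range_subset_of_incidence hi).trans)]

/-- The discarded simplices are small and so are their faces; at all other simplices the boundary is
that of the cycle `a`. -/
theorem fboundary_part_mem {A B : Set X} {k : ℕ} {a : Chain X (k + 1)} (ha : boundary a = 0)
    (h : {σ | a σ ≠ 0 ∧ σ ∈ (smallSimplices A B (k + 1))ᶜ}.Finite) :
    fboundary (part a (smallSimplices A B (k + 1))ᶜ h) ∈ chainsIn (smallSimplices A B k) := by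
  refine mem_chainsIn.2 fun ρ hρ => ?_
  rw [← boundary_coe, boundary_congr_small (fun σ hσ => part_of_mem hσ) hρ, ha]
  rfl

theorem fpush_mem_small {g : C(X, Y)} {A B : Set Y} {k : ℕ} {c : FChain X k}
    (hc : c ∈ chainsIn (smallSimplices (g ⁻¹' A) (g ⁻¹' B) k)) :
    fpush g c ∈ chainsIn (smallSimplices A B k) := by
  refine map_mem_of_chainsIn (fun σ hσ => ?_) hc
  rw [fpush_single]
  refine single_mem_chainsIn (hσ.imp ?_ ?_) <;>
  · rintro h _ ⟨t, rfl⟩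
    exact h ⟨t, rfl⟩

/-- Simplices in `U` are killed by `φ`, and those in `A` keep their back faces in `A`. This is why
chains in `A ∪ U` must be subdivided before capping. -/
theorem fcap_mem_of_small {A U : Set X} {p q k : ℕ} (h : p + q = k) {φ : Cochain X p}
    (hφ : ∀ σ : Simplex X p, range σ ⊆ U → φ σ = 0) {c : FChain X k}
    (hc : c ∈ chainsIn (smallSimplices A U k)) : fcap h φ c ∈ chainsIn (simplicesIn A q) := by
  refine map_mem_of_chainsIn (fun σ hσ => ?_) hc
  rw [fcap_single]
  rcases hσ with hσ | hσ
  · exact Submodule.smul_mem _ _ (single_mem_chainsIn ((range_back_subset _ σ).trans hσ))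
  · rw [hφ _ ((range_front_subset _ σ).trans hσ), zero_smul]
    exact zero_mem _

/-- Off `A`, the cap product with a cochain that vanishes on `U` is determined by the simplices that
lie neither in `A` nor in `U`. -/
theorem fcap_part_apply {A U : Set X} {p q k : ℕ} (h : p + q = k) {φ : Cochain X p}
    (hφ : ∀ σ : Simplex X p, range σ ⊆ U → φ σ = 0) {a : Chain X k}
    (ha : {σ | a σ ≠ 0 ∧ σ ∈ (smallSimplices A U k)ᶜ}.Finite) {ρ : Simplex X q}
    (hρ : ¬ range ρ ⊆ A) :
    fcap h φ (part a (smallSimplices A U k)ᶜ ha) ρ = cap h a φ ρ := by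
  rw [← cap_coe]
  refine cap_congr h (fun σ hσ => ?_) hρ
  by_cases hs : σ ∈ smallSimplices A U k
  · rw [hφ _ ((range_front_subset _ σ).trans (hs.resolve_left hσ)), mul_zero, mul_zero]
  · rw [part_of_mem hs]

theorem limitSet_eq_empty [CompactSpace X] (f : C(X, Y)) : limitSet f = ∅ := by
  refine eq_empty_of_subset_empty ((iInter₂_subset univ isCompact_univ).trans ?_)
  simp

variable [T2Space Y]

/-- The degree condition on chain level, in `H_{k+1}(Y, Y \ L)`. The defining identity over the
complement of the limit set is pushed forward along its inclusion, so excision is never inverted. -/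
theorem HasDegree.exists_chain {k : ℕ} {f : C(X, Y)} {d : ℤ}
    {zX : endCycles (univ : Set X) (k + 1)} {zY : endCycles (univ : Set Y) (k + 1)}
    (hf : HasDegree (k + 1) f zX zY d) {L : Set Y} (hL : IsCompact L)
    (hLf : Disjoint L (limitSet f)) {c : FChain X (k + 1)} {c' : FChain Y (k + 1)}
    (hc : ∀ σ : Simplex X (k + 1), ¬ range σ ⊆ (f ⁻¹' L)ᶜ → c σ = zX.1 σ)
    (hc' : ∀ σ : Simplex Y (k + 1), ¬ range σ ⊆ Lᶜ → c' σ = zY.1 σ) :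
    ∃ e, fpush f c - d • c' - fboundary e ∈ chainsIn (simplicesIn Lᶜ (k + 1)) := by
  obtain ⟨-, a, b, ha, hb, hab⟩ := hf
  obtain ⟨K, hK, rfl⟩ : ∃ K : Set ↥(limitSet f)ᶜ, IsCompact K ∧ L = Subtype.val '' K := by
    have hsub : Subtype.val '' (Subtype.val ⁻¹' L : Set ↥(limitSet f)ᶜ) = L := by
      rw [Subtype.image_preimage_coe]
      exact inter_eq_right.2 fun y hy => disjoint_left.1 hLf hy
    exact ⟨Subtype.val ⁻¹' L, by rwa [Subtype.isCompact_iff, hsub], hsub.symm⟩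
  have hK' := isCompact_preimage_restrict f K hK
  set g := f.restrictPreimage (limitSet f)ᶜ with hg
  have hpre : Subtype.val '' (g ⁻¹' K) = f ⁻¹' (Subtype.val '' K) := by
    ext x
    constructor
    · rintro ⟨x, hx, rfl⟩
      exact ⟨g x, hx, rfl⟩
    · rintro ⟨y, hy, hyx⟩
      have hx : f x ∈ (limitSet f)ᶜ := hyx ▸ y.2
      refine ⟨⟨x, hx⟩, ?_, rfl⟩
      have : g ⟨x, hx⟩ = y := Subtype.ext hyx.symm
      rw [mem_preimage, this]
      exact hy
  rw [← hpre] at hc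
  obtain ⟨h1, h1'⟩ := restrict_eq_relClass
    (h := compl_near_infinity (hK'.image continuous_subtype_val)) zX hc
  obtain ⟨h2, h2'⟩ := restrict_eq_relClass
    (h := compl_near_infinity (hK.image continuous_subtype_val)) zY hc'
  have hm : MapsTo f (Subtype.val '' (g ⁻¹' K))ᶜ (Subtype.val '' K)ᶜ := by
    rw [hpre]
    exact fun _ h => h
  have e1 := (ha (g ⁻¹' K) hK').symm.trans h1'
  have e2 := (hb K hK).symm.trans h2'
  have hj : MapsTo (⟨Subtype.val, continuous_subtype_val⟩ : C(↥(limitSet f)ᶜ, Y)) Kᶜ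
      (Subtype.val '' K)ᶜ := by
    rintro y hy ⟨z, hz, hzy⟩
    exact hy (Subtype.ext hzy ▸ hz)
  have hi : MapsTo (⟨Subtype.val, continuous_subtype_val⟩ : C(↥(f ⁻¹' (limitSet f)ᶜ), X))
      (g ⁻¹' K)ᶜ (Subtype.val '' (g ⁻¹' K))ᶜ := by
    rintro y hy ⟨z, hz, hzy⟩
    exact hy (Subtype.ext hzy ▸ hz)
  have hmg : MapsTo g (g ⁻¹' K)ᶜ Kᶜ := mapsTo_preimage g Kᶜ
  have e3 := congrArg (relMap _ hj (k + 1))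
    (restrict_pushforward (isCompact_preimage_restrict f) hK hmg a)
  rw [hab, map_zsmul, map_zsmul] at e3
  have e4 := congrArg (relMap f hm (k + 1)) e1
  have hfi := hm.comp hi
  have e5 := relMap_relMap hi hm hfi (restrict univ (g ⁻¹' K)ᶜ (compl_near_infinity hK') (k + 1) a)
  have e6 := relMap_relMap hmg hj hfi
    (restrict univ (g ⁻¹' K)ᶜ (compl_near_infinity hK') (k + 1) a)
  have e7 := (e4.symm.trans e5).trans (e6.symm.trans e3.symm)
  rw [relMap_relClass] at e7
  have e8 := e7.trans (congrArg (d • ·) e2)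
  rw [smul_relClass] at e8
  exact relClass_eq.1 e8

/-- The push-forward of a cap product with a pull-back, in `H_2(Y, A)`. -/
theorem HasDegree.relMap_restrict_cap {k : ℕ} {f : C(X, Y)} {d : ℤ}
    {aX : endCycles (univ : Set X) (k + 1)} {aY : endCycles (univ : Set Y) (k + 1)}
    (hf : HasDegree (k + 1) f aX aY d) {A U : Set Y} (hA : IsOpen A) (hU : IsOpen U)
    (hL : IsCompact (A ∪ U)ᶜ) (hLf : Disjoint (A ∪ U)ᶜ (limitSet f))
    (hX : {σ | aX.1 σ ≠ 0 ∧ σ ∈ (smallSimplices (f ⁻¹' A) (f ⁻¹' U) (k + 1))ᶜ}.Finite)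
    (hY : {σ | aY.1 σ ≠ 0 ∧ σ ∈ (smallSimplices A U (k + 1))ᶜ}.Finite)
    {p : ℕ} (hp : p + 2 = k + 1) {φ : Cochain Y p} (hφ : coboundary p φ = 0)
    (hφU : ∀ σ : Simplex Y p, range σ ⊆ U → φ σ = 0) {V : Set Y} {W : Set X}
    {zX : endCycles W 2} {zY : endCycles V 2} (hzX : zX.1 = cap hp aX.1 (pullCochain f p φ))
    (hzY : zY.1 = cap hp aY.1 φ) (hW : ∃ K, IsCompact K ∧ W \ K ⊆ f ⁻¹' A)
    (hV : ∃ K, IsCompact K ∧ V \ K ⊆ A) :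
    relMap f (mapsTo_preimage f A) 2 (restrict W (f ⁻¹' A) hW 2 zX) =
      d • restrict V A hV 2 zY := by
  set c := part aX.1 _ hX with hc
  set c' := part aY.1 _ hY with hc'
  have hφU' : ∀ σ : Simplex X p, range σ ⊆ f ⁻¹' U → pullCochain f p φ σ = 0 := fun σ hσ =>
    hφU _ (by rintro _ ⟨t, rfl⟩; exact hσ ⟨t, rfl⟩)
  -- A simplex that is not contained in `A ∪ U` is not small, so the parts `c` and `c'` agree with
  -- the fundamental cycles wherever the comparison over the compact set `(A ∪ U)ᶜ` looks.
  obtain ⟨e, he⟩ := hf.exists_chain hL hLf (c := c) (c' := c')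
    (fun σ hσ => part_of_mem fun hs => hσ (by
      rw [preimage_compl, compl_compl, preimage_union]
      exact hs.elim (·.trans subset_union_left) (·.trans subset_union_right)))
    (fun σ hσ => part_of_mem fun hs => hσ (by
      rw [compl_compl]
      exact hs.elim (·.trans subset_union_left) (·.trans subset_union_right)))
  rw [compl_compl] at he
  have hbd : fboundary (fpush f c - d • c' - fboundary e) ∈ chainsIn (smallSimplices A U k) := by
    rw [map_sub, fboundary_fboundary, sub_zero, map_sub, map_smul, ← fpush_fboundary]
    exact sub_mem (fpush_mem_small (fboundary_part_mem aX.2.2 hX))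
      (Submodule.smul_mem _ _ (fboundary_part_mem aY.2.2 hY))
  obtain ⟨e', he'⟩ := exists_homologous_small hA hU he hbd
  -- Projection formula and Leibniz rule; the factor `(-1)^p` cancels the sign of the latter.
  have hcap : fpush f (fcap hp (pullCochain f p φ) c) - d • fcap hp φ c' -
      fboundary ((-1 : ℤ) ^ p • fcap (q := 3) (by omega) φ (e + e')) =
      fcap hp φ (fpush f c - d • c' - fboundary e - fboundary e') := by
    rw [map_smul, fboundary_fcap hp hφ, smul_smul, ← mul_pow, neg_mul_neg, one_mul, one_pow,
      one_smul, fpush_fcap]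
    simp only [map_sub, map_add, map_smul]
    abel
  obtain ⟨h1, h1'⟩ := restrict_eq_relClass (h := hW) zX (c := fcap hp (pullCochain f p φ) c)
    (fun ρ hρ => by rw [hzX]; exact fcap_part_apply hp hφU' hX hρ)
  obtain ⟨h2, h2'⟩ := restrict_eq_relClass (h := hV) zY (c := fcap hp φ c')
    (fun ρ hρ => by rw [hzY]; exact fcap_part_apply hp hφU hY hρ)
  refine (congrArg _ h1').trans (Eq.trans ?_ (congrArg (d • ·) h2').symm)
  rw [relMap_relClass, smul_relClass]
  exact relClass_eq.2 ⟨_, hcap ▸ fcap_mem_of_small hp hφU he'⟩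

/-- A manifold that is the target of a map of degree `±1` from a compact space is compact. -/
theorem HasDegree.compactSpace [CompactSpace X] {k : ℕ} {f : C(X, Y)} {d : ℤ}
    (hd : d = 1 ∨ d = -1) {cX : EndHomology (univ : Set X) (k + 1)}
    {cY : EndHomology (univ : Set Y) (k + 1)} (hcY : IsFundamentalClass (k + 1) cY)
    (hf : HasDegree (k + 1) f cX cY d) : CompactSpace Y := by
  refine ⟨?_⟩
  have : range f = univ := by
    refine eq_univ_of_forall fun y => ?_
    by_contra hy
    obtain ⟨aX, rfl⟩ := QuotientAddGroup.mk_surjective cX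
    obtain ⟨aY, rfl⟩ := QuotientAddGroup.mk_surjective cY
    obtain ⟨c', hc', h1, h1'⟩ := exists_restrict_eq_relClass
      (h := compl_near_infinity (isCompact_singleton (x := y))) aY
    -- The fibre over `y` is empty, so the zero chain represents the restriction of `[X]`. Hence `d`
    -- times the local generator at `y` vanishes.
    obtain ⟨e, he⟩ := hf.exists_chain (isCompact_singleton (x := y))
      (by rw [limitSet_eq_empty]; exact disjoint_empty _) (c := 0) (c' := c')
      (fun σ hσ => absurd (fun x _ hx => hy ⟨x, hx⟩) hσ) hc'
    have h0 : d • relClass _ c' h1 = 0 := by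
      rw [smul_relClass]
      refine relClass_eq_zero.2 ⟨-e, ?_⟩
      rw [map_zero, zero_sub] at he
      have := neg_mem he
      rw [map_neg, sub_neg_eq_add]
      convert this using 1
      abel
    have h0' : relClass _ c' h1 = 0 := by
      rcases hd with rfl | rfl
      · rwa [one_smul] at h0
      · rwa [neg_smul, one_smul, neg_eq_zero] at h0
    obtain ⟨E, hE⟩ := hcY y
    have h3 := h1'.trans h0'
    have h4 := hE.symm.trans ((congrArg E h3).trans (map_zero E))
    exact one_ne_zero h4
  rw [← this]
  exact isCompact_range f.continuous

end DegreeFormula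

/-! ### Contractions of small balls -/

section Contraction

variable {X : Type*} [TopologicalSpace X]

/-- The radial homotopy of a normed space that contracts the ball of radius `r / 2` about `y₀` and is
constant outside the ball of radius `r`. -/
def radialHomotopy {E : Type*} [NormedAddCommGroup E] [NormedSpace ℝ E] (y₀ : E) (r : ℝ)
    (p : E × unitInterval) : E :=
  y₀ + (1 - (p.2 : ℝ) * max 0 (min 1 (2 - 2 * ‖p.1 - y₀‖ / r))) • (p.1 - y₀)

section Radial

variable {E : Type*} [NormedAddCommGroup E] [NormedSpace ℝ E] (y₀ : E) {r : ℝ}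

theorem continuous_radialHomotopy (r : ℝ) : Continuous (radialHomotopy y₀ r) := by
  unfold radialHomotopy
  fun_prop

theorem radialHomotopy_zero (r : ℝ) (y : E) : radialHomotopy y₀ r (y, 0) = y := by
  simp [radialHomotopy]

theorem radialHomotopy_of_le (hr : 0 < r) {y : E} (hy : r ≤ ‖y - y₀‖) (u : unitInterval) :
    radialHomotopy y₀ r (y, u) = y := by
  have : 2 - 2 * ‖y - y₀‖ / r ≤ 0 := by
    rw [sub_nonpos, le_div_iff₀ hr]
    linarith
  rw [radialHomotopy, max_eq_left ((min_le_right _ _).trans this)]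
  simp

theorem radialHomotopy_one (hr : 0 < r) {y : E} (hy : ‖y - y₀‖ ≤ r / 2) :
    radialHomotopy y₀ r (y, 1) = y₀ := by
  have : 1 ≤ 2 - 2 * ‖y - y₀‖ / r := by
    have : 2 * ‖y - y₀‖ / r ≤ 1 := by
      rw [div_le_one hr]
      linarith
    linarith
  simp only [radialHomotopy]
  rw [min_eq_left this, max_eq_right zero_le_one]
  simp

theorem radialHomotopy_mem {y : E} (hy : ‖y - y₀‖ ≤ r) (u : unitInterval) :
    radialHomotopy y₀ r (y, u) ∈ Metric.closedBall y₀ r := by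
  set m := max 0 (min 1 (2 - 2 * ‖y - y₀‖ / r)) with hm
  have h0 : 0 ≤ m := le_max_left _ _
  have h1 : m ≤ 1 := max_le zero_le_one (min_le_left _ _)
  have hu0 := u.2.1
  have hu1 := u.2.2
  have h2 : 0 ≤ (u : ℝ) * m := mul_nonneg hu0 h0
  have h3 : (u : ℝ) * m ≤ 1 := mul_le_one₀ hu1 h0 h1
  rw [mem_closedBall_iff_norm, radialHomotopy, add_sub_cancel_left, norm_smul,
    Real.norm_of_nonneg (by linarith)]
  refine le_trans ?_ hy
  exact mul_le_of_le_one_left (norm_nonneg _) (by linarith)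

end Radial

/-- The radial homotopy is transported through a chart and extended by the identity. -/
theorem exists_contraction [T2Space X] {E : Type*} [NormedAddCommGroup E] [NormedSpace ℝ E]
    [ProperSpace E] [ChartedSpace E X] {s : X} {O : Set X} (hO : IsOpen O) (hs : s ∈ O) :
    ∃ (B : Set X) (h : C(X × unitInterval, X)), IsOpen B ∧ s ∈ B ∧ B ⊆ O ∧
      stage h 0 = ContinuousMap.id X ∧ (∀ x ∉ O, ∀ u, h (x, u) = x) ∧ ∀ x ∈ B, h (x, 1) = s := by
  classical
  set φ := chartAt E s with hφ
  have hsφ : s ∈ φ.source := mem_chart_source E s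
  have hopen : IsOpen (φ.target ∩ φ.symm ⁻¹' O) := φ.isOpen_inter_preimage_symm hO
  have hmem : φ s ∈ φ.target ∩ φ.symm ⁻¹' O :=
    ⟨φ.map_source hsφ, by rwa [mem_preimage, φ.left_inv hsφ]⟩
  obtain ⟨r, hr, hball⟩ := Metric.nhds_basis_closedBall.mem_iff.1 (hopen.mem_nhds hmem)
  set y₀ := φ s with hy₀
  set K : Set X := φ.symm '' Metric.closedBall y₀ r with hK
  have hKc : IsClosed K :=
    ((isCompact_closedBall y₀ r).image_of_continuousOn
      (φ.continuousOn_symm.mono fun y hy => (hball hy).1)).isClosed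
  have hKO : K ⊆ O := by
    rintro _ ⟨y, hy, rfl⟩
    exact (hball hy).2
  have hout : ∀ x ∈ φ.source, x ∉ K → r ≤ ‖φ x - y₀‖ := by
    intro x hx hxK
    by_contra! hlt
    exact hxK ⟨φ x, mem_closedBall_iff_norm.2 hlt.le, φ.left_inv hx⟩
  -- Continuity is checked on two open sets: the chart domain, where the formula holds, and the
  -- complement of the compact, hence closed, set `K`, where `H` is the projection.
  set H : X × unitInterval → X := fun p =>
    if p.1 ∈ φ.source then φ.symm (radialHomotopy y₀ r (φ p.1, p.2)) else p.1 with hH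
  have hHout : ∀ p : X × unitInterval, p.1 ∉ K → H p = p.1 := by
    intro p hp
    by_cases hps : p.1 ∈ φ.source
    · simp only [hH, if_pos hps]
      rw [radialHomotopy_of_le y₀ hr (hout _ hps hp), φ.left_inv hps]
    · simp only [hH, if_neg hps]
  have hHcont : Continuous H := by
    refine continuous_iff_continuousAt.2 fun p => ?_
    by_cases hp : p.1 ∈ K
    · have hps : p.1 ∈ φ.source := by
        obtain ⟨y, hy, hyp⟩ := hp
        rw [← hyp]
        exact φ.map_target (hball hy).1
      have hnh : ∀ᶠ q : X × unitInterval in 𝓝 p, q.1 ∈ φ.source :=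
        continuous_fst.continuousAt.eventually (φ.open_source.mem_nhds hps)
      have heq : H =ᶠ[𝓝 p] fun q => φ.symm (radialHomotopy y₀ r (φ q.1, q.2)) :=
        hnh.mono fun q hq => if_pos hq
      refine ContinuousAt.congr ?_ heq.symm
      have htar : radialHomotopy y₀ r (φ p.1, p.2) ∈ φ.target := by
        by_cases hn : ‖φ p.1 - y₀‖ ≤ r
        · exact (hball (radialHomotopy_mem y₀ hn p.2)).1
        · rw [radialHomotopy_of_le y₀ hr (not_le.1 hn).le]
          exact φ.map_source hps
      refine ContinuousAt.comp (g := φ.symm) (φ.continuousAt_symm htar) ?_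
      refine (continuous_radialHomotopy y₀ r).continuousAt.comp ?_
      exact ((φ.continuousAt hps).comp continuous_fst.continuousAt).prodMk
        continuous_snd.continuousAt
    · have heq : H =ᶠ[𝓝 p] Prod.fst :=
        (continuous_fst.continuousAt.eventually (hKc.isOpen_compl.mem_nhds hp)).mono
          fun q hq => hHout q hq
      exact continuous_fst.continuousAt.congr heq.symm
  refine ⟨φ.source ∩ φ ⁻¹' Metric.ball y₀ (r / 2), ⟨H, hHcont⟩,
    φ.isOpen_inter_preimage Metric.isOpen_ball, ⟨hsφ, Metric.mem_ball_self (by positivity)⟩,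
    ?_, ?_, ?_, ?_⟩
  · rintro x ⟨hx, hxb⟩
    refine hKO ⟨φ x, ?_, φ.left_inv hx⟩
    exact Metric.closedBall_subset_closedBall (by linarith) (Metric.ball_subset_closedBall hxb)
  · refine ContinuousMap.ext fun x => ?_
    change H (x, 0) = x
    by_cases hx : x ∈ φ.source
    · simp only [hH, if_pos hx]
      rw [radialHomotopy_zero, φ.left_inv hx]
    · simp only [hH, if_neg hx]
  · exact fun x hx u => hHout (x, u) fun hxK => hx (hKO hxK)
  · rintro x ⟨hx, hxb⟩
    change H (x, 1) = s
    simp only [hH, if_pos hx]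
    rw [radialHomotopy_one y₀ hr (mem_ball_iff_norm.1 hxb).le, hy₀, φ.left_inv hsφ]

end Contraction

/-! ### Separation from a closed discrete set -/

section Separation

variable {Y : Type*} [TopologicalSpace Y]

theorem finite_inter_of_discrete [T2Space Y] {S : Set Y} (hS : IsClosed S) [DiscreteTopology S]
    {K : Set Y} (hK : IsCompact K) : (S ∩ K).Finite :=
  (hK.inter_left hS).finite ⟨DiscreteTopology.of_subset ‹_› inter_subset_left⟩

/-- Hausdorff separation of finitely many points, discreteness of `S` and local compactness are
combined. The sets `P s` allow further conditions to be imposed on the neighbourhoods. -/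
theorem exists_disjoint_compact_nhds [T2Space Y] [LocallyCompactSpace Y] {S : Set Y}
    [DiscreteTopology S] {F : Set Y} (hF : F.Finite) (hFS : F ⊆ S) {P : Y → Set Y}
    (hP : ∀ s ∈ F, P s ∈ 𝓝 s) :
    ∃ D : Y → Set Y, (∀ s ∈ F, IsCompact (D s) ∧ D s ∈ 𝓝 s ∧ D s ⊆ P s ∧ D s ∩ S ⊆ {s}) ∧
      F.PairwiseDisjoint D := by
  obtain ⟨U, hU, hdisj⟩ := hF.t2_separation
  have : ∀ s, ∃ D : Set Y, s ∈ F →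
      IsCompact D ∧ D ∈ 𝓝 s ∧ D ⊆ P s ∧ D ∩ S ⊆ {s} ∧ D ⊆ U s := by
    intro s
    by_cases hs : s ∈ F
    · obtain ⟨O, hO, hOs⟩ := isOpen_induced_iff.1 (isOpen_discrete ({⟨s, hFS hs⟩} : Set S))
      have hsO : s ∈ O := by
        have : (⟨s, hFS hs⟩ : S) ∈ Subtype.val ⁻¹' O := by rw [hOs]; rfl
        exact this
      obtain ⟨D, hD, hsub, hDc⟩ := local_compact_nhds (Filter.inter_mem
        (Filter.inter_mem (hP s hs) (hO.mem_nhds hsO)) ((hU s).2.mem_nhds (hU s).1))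
      refine ⟨D, fun _ => ⟨hDc, hD, fun x hx => (hsub hx).1.1, ?_, fun x hx => (hsub hx).2⟩⟩
      rintro x ⟨hx, hxS⟩
      have : (⟨x, hxS⟩ : S) ∈ Subtype.val ⁻¹' O := (hsub hx).1.2
      rw [hOs] at this
      exact congrArg Subtype.val this
    · exact ⟨∅, fun h => absurd h hs⟩
  choose D hD using this
  refine ⟨D, fun s hs => ⟨(hD s hs).1, (hD s hs).2.1, (hD s hs).2.2.1, (hD s hs).2.2.2.1⟩, ?_⟩
  intro s hs t ht hst
  exact (hdisj hs ht hst).mono (hD s hs).2.2.2.2 (hD t ht).2.2.2.2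

/-- The compact set `K ∪ frontier V` is thickened to `L` near the points of `S` that it contains, so
that no point of `S` lies on the frontier of `L`; then `U = Vᶜ \ L`. It is open because `frontier V
⊆ L`. -/
theorem exists_open_near_infinity [T2Space Y] [LocallyCompactSpace Y] {S : Set Y}
    (hS : IsClosed S) [DiscreteTopology S] {V K : Set Y} (hV : IsCompact (frontier V))
    (hK : IsCompact K) :
    ∃ U : Set Y, IsOpen U ∧ U ⊆ Vᶜ \ K ∧ (∃ L, IsCompact L ∧ Vᶜ \ U ⊆ L) ∧
      IsCompact (frontier U) ∧ Disjoint (frontier U) S := by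
  have hK0 := hK.union hV
  set K₀ := K ∪ frontier V with hK₀
  have hF := finite_inter_of_discrete hS hK0
  obtain ⟨D, hD, -⟩ := exists_disjoint_compact_nhds (S := S) hF inter_subset_left
    (P := fun _ => univ) fun _ _ => Filter.univ_mem
  set L := K₀ ∪ ⋃ s ∈ S ∩ K₀, D s with hL
  have hLc : IsCompact L := hK0.union (hF.isCompact_biUnion fun s hs => (hD s hs).1)
  have hLS : ∀ s ∈ S, s ∈ L → s ∈ interior L := by
    intro s hs hsL
    have hsK : s ∈ S ∩ K₀ := by
      rcases hsL with h | h
      · exact ⟨hs, h⟩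
      · obtain ⟨t, ht, hst⟩ := mem_iUnion₂.1 h
        have : s = t := (hD t ht).2.2.2 ⟨hst, hs⟩
        rwa [this]
    refine mem_interior_iff_mem_nhds.2 (Filter.mem_of_superset (hD s hsK).2.1 ?_)
    exact (subset_biUnion_of_mem (u := D) hsK).trans subset_union_right
  have hVL : frontier V ⊆ L := subset_union_right.trans subset_union_left
  have hUeq : Vᶜ \ L = (closure V)ᶜ \ L := by
    ext x
    refine and_congr_left fun hx => not_congr ?_
    rw [closure_eq_self_union_frontier]
    exact ⟨Or.inl, fun h => h.resolve_right fun h' => hx (hVL h')⟩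
  have hUo : IsOpen (Vᶜ \ L) := by
    rw [hUeq]
    exact isClosed_closure.isOpen_compl.sdiff hLc.isClosed
  have hfront : frontier (Vᶜ \ L) ⊆ L \ interior L := by
    rw [hUo.frontier_eq]
    rintro x ⟨hx, hxU⟩
    refine ⟨?_, fun hxi => ?_⟩
    · by_contra hxL
      have hxV : x ∈ V := by
        by_contra h
        exact hxU ⟨h, hxL⟩
      refine hxL (hVL ?_)
      rw [frontier_eq_closure_inter_closure]
      exact ⟨subset_closure hxV, closure_mono sdiff_subset hx⟩
    · obtain ⟨y, hy, hyU⟩ := mem_closure_iff.1 hx _ isOpen_interior hxi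
      exact hyU.2 (interior_subset hy)
  refine ⟨Vᶜ \ L, hUo, sdiff_subset_sdiff_right (subset_union_left.trans subset_union_left),
    ⟨L, hLc, ?_⟩, hLc.of_isClosed_subset isClosed_frontier (hfront.trans sdiff_subset), ?_⟩
  · rintro x ⟨hx, hxU⟩
    by_contra hxL
    exact hxU ⟨hx, hxL⟩
  · exact disjoint_left.2 fun x hx hxS => (hfront hx).2 (hLS x hxS (hfront hx).1)

/-- Each point of `S` in the closure of `Ω Δ U` must be given a neighbourhood on which the modified
`Ω` agrees with `U`. At points of `U` a neighbourhood is added. At the others a ball has to be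
removed, but only after a larger neighbourhood has been added, so that the homotopy contracting the
ball is supported inside `Ω'`. -/
theorem exists_adapted_closed [T2Space Y] {E : Type*} [NormedAddCommGroup E] [NormedSpace ℝ E]
    [ProperSpace E] [ChartedSpace E Y] {S : Set Y} (hS : IsClosed S) [DiscreteTopology S]
    {U Ω : Set Y} (hU : IsOpen U) (hUS : Disjoint (frontier U) S) (hΩ : IsClosed Ω)
    (hΩU : IsCompact (closure (symmDiff Ω U))) :
    ∃ (F : Set Y) (O B : Y → Set Y) (h : Y → C(Y × unitInterval, Y)) (Ω' : Set Y),
      F.Finite ∧ F.PairwiseDisjoint O ∧ (∀ s ∈ F, IsOpen (O s) ∧ s ∈ O s ∧ O s ⊆ Ω' ∧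
        IsOpen (B s) ∧ B s ⊆ O s ∧ stage (h s) 0 = ContinuousMap.id Y ∧
        (∀ x ∉ O s, ∀ u, h s (x, u) = x) ∧ ∀ x ∈ B s, h s (x, 1) = s) ∧
      IsClosed Ω' ∧ Ω ⊆ Ω' ∧ (∃ Q, IsCompact Q ∧ Ω' ⊆ Ω ∪ Q) ∧
      IsCompact (closure (symmDiff (Ω' \ ⋃ s ∈ F, B s) U)) ∧
      Disjoint (closure (symmDiff (Ω' \ ⋃ s ∈ F, B s) U)) S := by
  classical
  have : LocallyCompactSpace Y := ChartedSpace.locallyCompactSpace E Y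
  set T := closure (symmDiff Ω U) with hT
  have hF := finite_inter_of_discrete hS hΩU
  have hcl : ∀ s ∈ S, s ∉ U → s ∉ closure U := by
    intro s hs hsU h
    rw [closure_eq_self_union_frontier] at h
    exact disjoint_left.1 hUS (h.resolve_left hsU) hs
  -- As `S` misses the frontier of `U`, each neighbourhood can be placed inside `U` or off its
  -- closure.
  obtain ⟨D, hD, hDdisj⟩ := exists_disjoint_compact_nhds (S := S) hF inter_subset_left
    (P := fun s => if s ∈ U then U else (closure U)ᶜ) (fun s hs => by
      by_cases h : s ∈ U
      · rw [if_pos h]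
        exact hU.mem_nhds h
      · rw [if_neg h]
        exact isClosed_closure.isOpen_compl.mem_nhds (hcl s hs.1 h))
  have hDU : ∀ s ∈ S ∩ T, s ∈ U → D s ⊆ U := fun s hs h => by
    have := (hD s hs).2.2.1
    rwa [if_pos h] at this
  have hDU' : ∀ s ∈ S ∩ T, s ∉ U → D s ⊆ (closure U)ᶜ := fun s hs h => by
    have := (hD s hs).2.2.1
    rwa [if_neg h] at this
  have hB : ∀ s, ∃ (B : Set Y) (h : C(Y × unitInterval, Y)), s ∈ S ∩ T → IsOpen B ∧ s ∈ B ∧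
      B ⊆ interior (D s) ∧ stage h 0 = ContinuousMap.id Y ∧
      (∀ x ∉ interior (D s), ∀ u, h (x, u) = x) ∧ ∀ x ∈ B, h (x, 1) = s := by
    intro s
    by_cases hs : s ∈ S ∩ T
    · obtain ⟨B, h, hh⟩ := exists_contraction (E := E) (isOpen_interior (s := D s))
        (mem_interior_iff_mem_nhds.2 (hD s hs).2.1)
      exact ⟨B, h, fun _ => hh⟩
    · exact ⟨∅, ⟨Prod.fst, continuous_fst⟩, fun h => absurd h hs⟩
  choose B h hBh using hB
  have hFU : (S ∩ T) \ U ⊆ S ∩ T := sdiff_subset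
  have hQ : IsCompact (⋃ s ∈ S ∩ T, D s) := hF.isCompact_biUnion fun s hs => (hD s hs).1
  have hBU : ∀ x ∈ U, x ∉ ⋃ s ∈ (S ∩ T) \ U, B s := by
    intro x hx hxB
    obtain ⟨s, hs, hxs⟩ := mem_iUnion₂.1 hxB
    exact hDU' s hs.1 hs.2 (interior_subset ((hBh s hs.1).2.2.1 hxs)) (subset_closure hx)
  refine ⟨(S ∩ T) \ U, fun s => interior (D s), B, h, Ω ∪ ⋃ s ∈ S ∩ T, D s, hF.subset hFU, ?_,
    fun s hs => ⟨isOpen_interior, mem_interior_iff_mem_nhds.2 (hD s hs.1).2.1, ?_,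
      (hBh s hs.1).1, (hBh s hs.1).2.2.1, (hBh s hs.1).2.2.2.1, (hBh s hs.1).2.2.2.2.1,
      (hBh s hs.1).2.2.2.2.2⟩, hΩ.union hQ.isClosed, subset_union_left, ⟨_, hQ, subset_rfl⟩, ?_, ?_⟩
  · exact fun s hs t ht hst =>
      (hDdisj (hFU hs) (hFU ht) hst).mono interior_subset interior_subset
  · exact interior_subset.trans
      ((subset_biUnion_of_mem (u := D) hs.1).trans subset_union_right)
  · refine (hΩU.union hQ).closure_of_subset ?_
    rintro x (⟨⟨hx | hx, -⟩, hxU⟩ | ⟨hxU, hx⟩)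
    · exact Or.inl (subset_closure (Or.inl ⟨hx, hxU⟩))
    · exact Or.inr hx
    · refine Or.inl (subset_closure (Or.inr ⟨hxU, fun hxΩ => hx ⟨Or.inl hxΩ, hBU x hxU⟩⟩))
  · refine disjoint_right.2 fun s hs hsc => ?_
    -- Four cases: at points of `T` the neighbourhood is `D s` or the removed ball `B s`; away from
    -- `T` the sets `Ω` and `U` already agree, and only the added sets `D t` must be avoided when `s
    -- ∉ U`.
    suffices ∃ O ∈ 𝓝 s, ∀ x ∈ O,
        x ∉ symmDiff ((Ω ∪ ⋃ s ∈ S ∩ T, D s) \ ⋃ s ∈ (S ∩ T) \ U, B s) U by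
      obtain ⟨O, hO, hOx⟩ := this
      obtain ⟨x, hxO, hx⟩ := mem_closure_iff_nhds.1 hsc O hO
      exact hOx x hxO hx
    by_cases hsT : s ∈ T <;> by_cases hsU : s ∈ U
    · refine ⟨D s, (hD s ⟨hs, hsT⟩).2.1, ?_⟩
      rintro x hx (⟨-, hxU⟩ | ⟨hxU, hx'⟩)
      · exact hxU (hDU s ⟨hs, hsT⟩ hsU hx)
      · exact hx' ⟨Or.inr (mem_biUnion (⟨hs, hsT⟩ : s ∈ S ∩ T) hx), hBU x hxU⟩
    · have hsF : s ∈ (S ∩ T) \ U := ⟨⟨hs, hsT⟩, hsU⟩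
      refine ⟨B s, (hBh s hsF.1).1.mem_nhds (hBh s hsF.1).2.1, ?_⟩
      rintro x hx (⟨⟨-, hx'⟩, -⟩ | ⟨hxU, -⟩)
      · exact hx' (mem_biUnion hsF hx)
      · exact hBU x hxU (mem_biUnion hsF hx)
    · refine ⟨Tᶜ ∩ U, Filter.inter_mem (isClosed_closure.isOpen_compl.mem_nhds hsT)
        (hU.mem_nhds hsU), ?_⟩
      rintro x ⟨hxT, hxU⟩ (⟨-, hxU'⟩ | ⟨-, hx⟩)
      · exact hxU' hxU
      · refine hx ⟨Or.inl ?_, hBU x hxU⟩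
        by_contra hxΩ
        exact hxT (subset_closure (Or.inr ⟨hxU, hxΩ⟩))
    · refine ⟨Tᶜ ∩ (closure U)ᶜ ∩ (⋃ s ∈ S ∩ T, D s)ᶜ, Filter.inter_mem (Filter.inter_mem
        (isClosed_closure.isOpen_compl.mem_nhds hsT)
        (isClosed_closure.isOpen_compl.mem_nhds (hcl s hs hsU)))
        (hQ.isClosed.isOpen_compl.mem_nhds fun hsD => ?_), ?_⟩
      · obtain ⟨t, ht, hst⟩ := mem_iUnion₂.1 hsD
        have : s = t := (hD t ht).2.2.2 ⟨hst, hs⟩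
        exact hsT (this ▸ ht.2)
      · rintro x ⟨⟨hxT, hxU⟩, hxD⟩ (⟨⟨hx | hx, -⟩, hxU'⟩ | ⟨hxU', -⟩)
        · exact hxT (subset_closure (Or.inl ⟨hx, hxU'⟩))
        · exact hxD hx
        · exact hxU (subset_closure hxU')

end Separation

/-! ### Cap products with classes supported near an end -/

section CapCycles

variable {X Y : Type*} [TopologicalSpace X] [TopologicalSpace Y]

theorem inter_frontier_nonempty {S W : Set X} (hS : IsPreconnected S) {x y : X} (hx : x ∈ S)
    (hxW : x ∈ W) (hy : y ∈ S) (hyW : y ∉ W) : (S ∩ frontier W).Nonempty := by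
  by_contra hne
  have hcov : S ⊆ interior W ∪ interior Wᶜ := by
    intro z hz
    by_contra hzW
    refine hne ⟨z, hz, ?_⟩
    rw [frontier, mem_sdiff]
    refine ⟨?_, fun h => hzW (Or.inl h)⟩
    by_contra h
    exact hzW (Or.inr (by rwa [interior_compl]))
  rcases hS.subset_or_subset isOpen_interior isOpen_interior
    (disjoint_compl_right.mono interior_subset interior_subset) hcov with h | h
  · exact hyW (interior_subset (h hy))
  · exact interior_subset (h hx) hxW

/-- A contributing simplex has its front face meeting `W`, since `φ` does not vanish there. If its
back face leaves `W`, connectedness makes it meet the compact frontier, so local finiteness leaves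
only finitely many such simplices. -/
theorem cap_mem_endCycles {p q k : ℕ} (h : p + (q + 1) = k) {a : Chain X k}
    (ha : a ∈ endCycles univ k) {φ : Cochain X p} (hφ : coboundary p φ = 0) {W : Set X}
    (hW : IsCompact (frontier W)) (hφW : ∀ σ : Simplex X p, range σ ⊆ Wᶜ → φ σ = 0) :
    cap h a φ ∈ endCycles W (q + 1) := by
  have hfin := LocFin.of_mem ha.1
  refine ⟨fun C hC => ?_, boundary_cap_eq_zero h hfin ha.2 hφ⟩
  refine ((hfin _ (hC.union hW)).image fun σ => back (q + 1) (by omega) σ).subset ?_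
  rintro ρ ⟨hρ, hρC⟩
  obtain ⟨σ, hσ, hφσ, rfl⟩ := exists_of_cap_ne_zero h hρ
  refine ⟨σ, ⟨hσ, ?_⟩, rfl⟩
  obtain ⟨x, hx, hxC⟩ := not_subset.1 hρC
  have hxσ := range_back_subset _ σ hx
  by_cases hxc : x ∈ C
  · exact ⟨x, hxσ, Or.inl hxc⟩
  · have hxW : x ∉ W := fun hxW => hxC ⟨hxW, hxc⟩
    obtain ⟨y, hy, hyW⟩ := not_subset.1 fun hs =>
      hφσ (hφW _ ((range_front_subset _ σ).trans hs))
    obtain ⟨z, hz, hzW⟩ := inter_frontier_nonempty (isPreconnected_range_simplex σ) hy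
      (not_not.1 hyW) hxσ hxW
    exact ⟨z, hz, Or.inr hzW⟩

/-- Off `Ω Δ U` the open sets `Ωᶜ` and `U` are complementary, so a connected set there lies in one
of them. Together with local finiteness this makes the non-small part of a cycle finite. -/
theorem inter_symmDiff_nonempty {Ω U : Set X} (hΩ : IsClosed Ω) (hU : IsOpen U) {k : ℕ}
    {σ : Simplex X k} (hσ : σ ∉ smallSimplices Ωᶜ U k) : (range σ ∩ symmDiff Ω U).Nonempty := by
  by_contra hne
  have hnot : ∀ x ∈ range σ, x ∉ symmDiff Ω U := fun x hx h => hne ⟨x, hx, h⟩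
  refine hσ (isPreconnected_iff_subset_of_disjoint.1 (isPreconnected_range_simplex σ) _ _
    hΩ.isOpen_compl hU (fun x hx => ?_) ?_)
  · by_contra h
    exact hnot x hx (Or.inl ⟨by by_contra hΩ; exact h (Or.inl hΩ), fun hU => h (Or.inr hU)⟩)
  · exact eq_empty_of_forall_notMem fun x hx => hnot x hx.1 (Or.inr ⟨hx.2.2, hx.2.1⟩)

theorem LocFin.finite_not_small {k : ℕ} {a : Chain X k} (ha : LocFin a) {Ω U G : Set X}
    (hΩ : IsClosed Ω) (hU : IsOpen U) (hG : IsCompact G) (hΩU : symmDiff Ω U ⊆ G) :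
    {σ | a σ ≠ 0 ∧ σ ∈ (smallSimplices Ωᶜ U k)ᶜ}.Finite :=
  (ha G hG).subset fun _ hσ =>
    ⟨hσ.1, (inter_symmDiff_nonempty hΩ hU hσ.2).mono (inter_subset_inter_right _ hΩU)⟩

theorem isCompact_preimage_of_disjoint [T2Space Y] (f : C(X, Y)) {L : Set Y} (hL : IsCompact L)
    (hLf : Disjoint L (limitSet f)) : IsCompact (f ⁻¹' L) := by
  have hsub : Subtype.val '' (Subtype.val ⁻¹' L : Set ↥(limitSet f)ᶜ) = L := by
    rw [Subtype.image_preimage_coe]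
    exact inter_eq_right.2 fun y hy => disjoint_left.1 hLf hy
  have h := (isCompact_preimage_restrict f (Subtype.val ⁻¹' L)
    (by rwa [Subtype.isCompact_iff, hsub])).image continuous_subtype_val
  convert h using 1
  ext x
  constructor
  · intro hx
    exact ⟨⟨x, disjoint_left.1 hLf hx⟩, hx, rfl⟩
  · rintro ⟨x, hx, rfl⟩
    exact hx

theorem relIncl_mem_hurewiczImage {A B : Set X} (h : A ⊆ B) {x : RelHomology A 2}
    (hx : x ∈ hurewiczImage A) : relIncl h 2 x ∈ hurewiczImage B :=
  relMap_mem_hurewiczImage _ hx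

theorem relIncl_relIncl {A B D : Set X} (h : A ⊆ B) (h' : B ⊆ D) {k : ℕ}
    (x : RelHomology A (k + 1)) :
    relIncl h' (k + 1) (relIncl h (k + 1) x) = relIncl (h.trans h') (k + 1) x :=
  relMap_relMap (g := ContinuousMap.id X) (f := ContinuousMap.id X) h h' (h.trans h') x

theorem relIncl_refl {A : Set X} {k : ℕ} (x : RelHomology A (k + 1)) :
    relIncl (Subset.refl A) (k + 1) x = x := by
  obtain ⟨c, hc, rfl⟩ := exists_relClass x
  exact (relIncl_relClass _ hc).2

/-- Adding finitely many disjoint contractible sets to `A` does not affect sphericity. -/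
theorem mem_hurewiczImage_of_biUnion {A : Set X} (hA : IsOpen A) {F : Set X} (hF : F.Finite)
    {O B : X → Set X} {h : X → C(X × unitInterval, X)} (hO : F.PairwiseDisjoint O)
    (hOA : ∀ s ∈ F, Disjoint A (O s))
    (hB : ∀ s ∈ F, IsOpen (O s) ∧ s ∈ O s ∧ IsOpen (B s) ∧ B s ⊆ O s ∧
      stage (h s) 0 = ContinuousMap.id X ∧ (∀ x ∉ O s, ∀ u, h s (x, u) = x) ∧
      ∀ x ∈ B s, h s (x, 1) = s)
    {A' : Set X} (hA' : A' = A ∪ ⋃ s ∈ F, B s) (hAA' : A ⊆ A') {x : RelHomology A 2}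
    (hx : relIncl hAA' 2 x ∈ hurewiczImage A') : x ∈ hurewiczImage A := by
  induction F, hF using Set.Finite.induction_on generalizing A' with
  | empty =>
    rw [biUnion_empty, union_empty] at hA'
    subst hA'
    rwa [relIncl_refl] at hx
  | @insert s F hs _ ih =>
    have hA1 : A' = (A ∪ ⋃ t ∈ F, B t) ∪ B s := by
      rw [hA', biUnion_insert, union_assoc, union_comm (B s)]
    subst hA1
    refine ih (hO.subset (subset_insert _ _)) (fun t ht => hOA t (Or.inr ht))
      (fun t ht => hB t (Or.inr ht)) rfl subset_union_left ?_
    obtain ⟨h1, h2, -, -, h5, h6, h7⟩ := hB s (Or.inl rfl)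
    have hopen : IsOpen (A ∪ ⋃ t ∈ F, B t) :=
      hA.union (isOpen_biUnion fun t ht => (hB t (Or.inr ht)).2.2.1)
    have hdisj : Disjoint (A ∪ ⋃ t ∈ F, B t) (O s) := by
      refine disjoint_union_left.2 ⟨hOA s (Or.inl rfl), disjoint_iUnion₂_left.2 fun t ht => ?_⟩
      have hts : t ≠ s := fun h => hs (h ▸ ht)
      exact (hO (Or.inr ht) (Or.inl rfl) hts).mono_left (hB t (Or.inr ht)).2.2.2.1
    -- The balls not yet removed are counted as part of the subspace; being disjoint from `O s`,
    -- they are fixed by the homotopy.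
    refine mem_hurewiczImage_of_contractible hopen h1 hdisj h2 h5 (fun y hy u => ?_) h7 ?_
    · rw [h6 y (disjoint_left.1 hdisj hy)]
      exact hy
    · rwa [relIncl_relIncl]

end CapCycles

/-! ### Transfer of asphericity -/

section Main

variable {X Y : Type*} [TopologicalSpace X] [TopologicalSpace Y]

theorem isClosed_limitSet (f : C(X, Y)) : IsClosed (limitSet f) :=
  isClosed_biInter fun _ _ => isClosed_closure

variable [T2Space Y]

/-- The test set `Ω` is replaced by `Ω₂`, whose preimage is a test set upstairs. Sphericity is
pushed down over `Ω₂` by the degree formula, extended to `Ω₁` by filling in the balls, and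
restricted to `Ω`. -/
theorem HasDegree.isSpherical (E : Type*) [NormedAddCommGroup E] [NormedSpace ℝ E] [ProperSpace E]
    [ChartedSpace E Y] {k : ℕ} {f : C(X, Y)} {d : ℤ} (hd : d = 1 ∨ d = -1)
    {aX : endCycles (univ : Set X) (k + 1)} {aY : endCycles (univ : Set Y) (k + 1)}
    (hf : HasDegree (k + 1) f aX aY d) {U V L : Set Y} (hU : IsOpen U) (hUV : U ⊆ Vᶜ)
    (hL : IsCompact L) (hVL : Vᶜ \ U ⊆ L) (hUf : Disjoint (frontier U) (limitSet f))
    {p : ℕ} (hp : p + 2 = k + 1) {φ : Cochain Y p} (hφ : coboundary p φ = 0)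
    (hφU : ∀ σ : Simplex Y p, range σ ⊆ U → φ σ = 0)
    {zX : endCycles (f ⁻¹' Uᶜ) 2} {zY : endCycles V 2}
    (hzX : zX.1 = cap hp aX.1 (pullCochain f p φ)) (hzY : zY.1 = cap hp aY.1 φ)
    (hX : IsSpherical (f ⁻¹' Uᶜ) zX) : IsSpherical V zY := by
  intro Ω hΩ hΩV
  have hdisc := hf.1
  have hΩU : IsCompact (closure (symmDiff Ω U)) := by
    refine (hΩV.union hL).closure_of_subset ?_
    rintro x (⟨hx, hxU⟩ | ⟨hxU, hx⟩)
    · by_cases hxV : x ∈ Vᶜ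
      · exact Or.inr (hVL ⟨hxV, hxU⟩)
      · exact Or.inl (subset_closure (Or.inl ⟨hx, hxV⟩))
    · exact Or.inl (subset_closure (Or.inr ⟨hUV hxU, hx⟩))
  obtain ⟨F, O, B, h, Ω₁, hF, hOF, hB, hΩ₁, hΩΩ₁, ⟨Q, hQ, hΩ₁Q⟩, hG, hGf⟩ :=
    exists_adapted_closed (E := E) (isClosed_limitSet f) hU hUf hΩ hΩU
  set Ω₂ := Ω₁ \ ⋃ s ∈ F, B s with hΩ₂
  set G := closure (symmDiff Ω₂ U) with hGdef
  have hBo : IsOpen (⋃ s ∈ F, B s) := isOpen_biUnion fun s hs => (hB s hs).2.2.2.1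
  have hΩ₂c : IsClosed Ω₂ := hΩ₁.sdiff hBo
  have hfG := isCompact_preimage_of_disjoint f hG hGf
  have hcompl : (Ω₂ᶜ ∪ U)ᶜ ⊆ G := fun x hx => subset_closure (Or.inl
    ⟨by by_contra h; exact hx (Or.inl h), fun h => hx (Or.inr h)⟩)
  have hVK : ∃ K, IsCompact K ∧ V \ K ⊆ Ω₂ᶜ := ⟨G, hG, fun x hx hxΩ => hx.2
    (subset_closure (Or.inl ⟨hxΩ, fun hxU => hUV hxU hx.1⟩))⟩
  have hWK : ∃ K, IsCompact K ∧ f ⁻¹' Uᶜ \ K ⊆ f ⁻¹' Ω₂ᶜ := ⟨f ⁻¹' G, hfG, fun x hx hxΩ => hx.2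
    (subset_closure (Or.inl ⟨hxΩ, hx.1⟩))⟩
  have hpreim : f ⁻¹' (symmDiff Ω₂ U) = symmDiff (f ⁻¹' Ω₂) (f ⁻¹' U) := rfl
  have key := hf.relMap_restrict_cap hΩ₂c.isOpen_compl hU
    (hG.of_isClosed_subset (hΩ₂c.isOpen_compl.union hU).isClosed_compl hcompl)
    (hGf.mono_left hcompl)
    ((LocFin.of_mem aX.2.1).finite_not_small (hΩ₂c.preimage f.continuous) (hU.preimage f.continuous)
      hfG (hpreim ▸ preimage_mono subset_closure))
    ((LocFin.of_mem aY.2.1).finite_not_small hΩ₂c hU hG subset_closure)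
    hp hφ hφU hzX hzY hWK hVK
  have hsX : restrict (f ⁻¹' Uᶜ) (f ⁻¹' Ω₂ᶜ) hWK 2 zX ∈ hurewiczImage (f ⁻¹' Ω₂ᶜ) := by
    refine hX (f ⁻¹' Ω₂) (hΩ₂c.preimage f.continuous) (hfG.of_isClosed_subset isClosed_closure
      (closure_minimal ?_ (isClosed_closure.preimage f.continuous)))
    rw [preimage_compl, compl_compl, ← hpreim]
    exact fun x hx => subset_closure hx
  have hsY : restrict V Ω₂ᶜ hVK 2 zY ∈ hurewiczImage Ω₂ᶜ := by
    have := relMap_mem_hurewiczImage (mapsTo_preimage f Ω₂ᶜ) hsX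
    rw [key] at this
    -- Only here is `d = ±1` used: for other degrees merely a multiple of the class would be known
    -- to be spherical.
    rcases hd with rfl | rfl
    · rwa [one_smul] at this
    · rwa [neg_smul, one_smul, neg_mem_iff] at this
  have hVK₁ : ∃ K, IsCompact K ∧ V \ K ⊆ Ω₁ᶜ := by
    refine ⟨_, hΩV.union hQ, fun x hx hxΩ => hx.2 ?_⟩
    rcases hΩ₁Q hxΩ with h | h
    · exact Or.inl (subset_closure (Or.inl ⟨h, fun h' => h' hx.1⟩))
    · exact Or.inr h
  have hsY₁ : restrict V Ω₁ᶜ hVK₁ 2 zY ∈ hurewiczImage Ω₁ᶜ := by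
    refine mem_hurewiczImage_of_biUnion hΩ₁.isOpen_compl hF hOF
      (fun s hs => disjoint_compl_left_iff_subset.2 (hB s hs).2.2.1)
      (fun s hs => ⟨(hB s hs).1, (hB s hs).2.1, (hB s hs).2.2.2⟩) (A' := Ω₂ᶜ) ?_
      (compl_subset_compl.2 sdiff_subset) ?_
    · rw [hΩ₂, Set.sdiff_eq, compl_inter, compl_compl]
    · rwa [relIncl_restrict _ hVK]
  rw [← relIncl_restrict hVK₁ _ (compl_subset_compl.2 hΩΩ₁)]
  exact relIncl_mem_hurewiczImage _ hsY₁

/-- The set `f⁻¹(V)` itself need not have compact frontier, as `f` is not proper over the limit set;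
`f⁻¹(Uᶜ)` does. -/
theorem HasDegree.exists_sysData (E : Type*) [NormedAddCommGroup E] [NormedSpace ℝ E] [ProperSpace E]
    [ChartedSpace E Y] {n : ℕ} (hn : 3 ≤ n) {f : C(X, Y)} {d : ℤ}
    (hd : d = 1 ∨ d = -1) {cX : EndHomology (univ : Set X) n} {cY : EndHomology (univ : Set Y) n}
    (hf : HasDegree n f cX cY d) {V : Set Y} {β₁ : EndCohomology Vᶜ 1}
    {β : Fin (n - 3) → Cohomology Y 1} (h : IsSYSData hn cY V β₁ β) :
    ∃ (W : Set X) (γ₁ : EndCohomology Wᶜ 1),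
      forgetEnds Wᶜ 1 γ₁ = pullback f 1 (forgetEnds Vᶜ 1 β₁) ∧
      IsSYSData hn cX W γ₁ fun i => pullback f 1 (β i) := by
  have hlc : LocallyCompactSpace Y := ChartedSpace.locallyCompactSpace E Y
  have hdisc := hf.1
  obtain ⟨hV, τ, ⟨aY, φ₁, φ, zY, rfl, rfl, hφβ, rfl, hzY⟩, hτ⟩ := h
  obtain ⟨aX, rfl⟩ := QuotientAddGroup.mk_surjective cX
  obtain ⟨K, hK, hφK⟩ := mem_endCochains.1 φ₁.2.1
  obtain ⟨U, hU, hUVK, ⟨L, hL, hVL⟩, hfU, hfUS⟩ :=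
    exists_open_near_infinity (isClosed_limitSet f) hV hK
  have hφ₁U : ∀ σ : Simplex X 1, range σ ⊆ (f ⁻¹' Uᶜ)ᶜ → pullCochain f 1 φ₁.1 σ = 0 := by
    intro σ hσ
    refine hφK _ ?_
    rintro _ ⟨t, rfl⟩
    exact hUVK (not_not.1 (hσ ⟨t, rfl⟩))
  have hcoc : ∀ ψ : Cochain Y 1, coboundary 1 ψ = 0 → coboundary 1 (pullCochain f 1 ψ) = 0 :=
    fun ψ hψ => by
      rw [coboundary_pullCochain, hψ, map_zero]
  -- Since `U` avoids `K`, the pulled-back cochain vanishes on all simplices of `Wᶜ`, and the empty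
  -- compact set suffices.
  let ψ₁ : endCocycles (f ⁻¹' Uᶜ)ᶜ 1 := ⟨pullCochain f 1 φ₁.1,
    ⟨∅, isCompact_empty, fun σ hσ => hφ₁U σ (hσ.trans sdiff_subset)⟩, hcoc _ φ₁.2.2⟩
  let ψ : Fin (n - 3) → endCocycles (∅ : Set X) 1 := fun i =>
    ⟨pullCochain f 1 (φ i).1, mem_endCochains_empty _, hcoc _ (φ i).2.2⟩
  set Φ : Cochain Y (1 + (n - 3)) := cup φ₁.1 (cupProd (n - 3) fun i => (φ i).1) with hΦ
  have hΦc : coboundary _ Φ = 0 := coboundary_cup φ₁.2.2 (coboundary_cupProd _ fun i => (φ i).2.2)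
  have hΦU : ∀ σ : Simplex Y (1 + (n - 3)), range σ ⊆ U → Φ σ = 0 := by
    intro σ hσ
    rw [hΦ, cup, hφK _ ((range_front_subset _ σ).trans (hσ.trans hUVK)), zero_mul]
  have hpull : cup ψ₁.1 (cupProd (n - 3) fun i => (ψ i).1) = pullCochain f _ Φ := by
    rw [hΦ, pullCochain_cup, pullCochain_cupProd]
  have hW : IsCompact (frontier (f ⁻¹' Uᶜ)) := by
    refine (isCompact_preimage_of_disjoint f hfU hfUS).of_isClosed_subset isClosed_frontier ?_
    rw [← frontier_compl U]
    exact f.continuous.frontier_preimage_subset _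
  have hzX : cap (q := 2) (by omega) aX.1 (pullCochain f _ Φ) ∈ endCycles (f ⁻¹' Uᶜ) 2 := by
    refine cap_mem_endCycles (q := 1) (by omega) aX.2 ?_ hW fun σ hσ => hΦU _ ?_
    · rw [coboundary_pullCochain, hΦc, map_zero]
    · rintro _ ⟨t, rfl⟩
      exact not_not.1 (hσ ⟨t, rfl⟩)
  -- The two classes in `H^1(X)` agree by `rfl`, because both are represented by the same
  -- pulled-back cochain.
  refine ⟨f ⁻¹' Uᶜ, ψ₁, rfl, hW, (⟨_, hzX⟩ : endCycles (f ⁻¹' Uᶜ) 2), ⟨aX, ψ₁, ψ, ⟨_, hzX⟩, rfl,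
    rfl, fun i => ?_, rfl, by rw [hpull]⟩, fun hs => hτ ?_⟩
  · exact congrArg (pullback f 1) (hφβ i)
  · obtain ⟨k, rfl⟩ : ∃ k, n = k + 1 := ⟨n - 1, by omega⟩
    exact hf.isSpherical E hd hU (hUVK.trans sdiff_subset) hL hVL hfUS (by omega) hΦc hΦU
      rfl hzY hs

end Main

end SYS

end

/-! ### The proposition for manifolds -/

theorem mainTheorem7 {n : ℕ} (hn : 3 ≤ n)
    {M N : Type*}
    [TopologicalSpace M] [T2Space M] [SecondCountableTopology M]
    [ChartedSpace (EuclideanSpace ℝ (Fin n)) M]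
    [TopologicalSpace N] [T2Space N] [SecondCountableTopology N]
    [ChartedSpace (EuclideanSpace ℝ (Fin n)) N]
    (cM : SYS.EndHomology (Set.univ : Set M) n) (hcM : SYS.IsFundamentalClass n cM)
    (cN : SYS.EndHomology (Set.univ : Set N) n) (hcN : SYS.IsFundamentalClass n cN)
    (f : C(M, N)) (d : ℤ) (hd : d = 1 ∨ d = -1) (hf : SYS.HasDegree n f cM cN d) :
    (SYS.IsSYS hn cN → SYS.IsSYS hn cM) ∧
    (NoncompactSpace N → NoncompactSpace M) ∧
    (∀ (V : Set N) (β₁ : SYS.EndCohomology Vᶜ 1) (β : Fin (n - 3) → SYS.Cohomology N 1),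
      SYS.IsSYSData hn cN V β₁ β →
      ∃ (W : Set M) (γ₁ : SYS.EndCohomology Wᶜ 1),
        SYS.forgetEnds Wᶜ 1 γ₁ = SYS.pullback f 1 (SYS.forgetEnds Vᶜ 1 β₁) ∧
        SYS.IsSYSData hn cM W γ₁ (fun i => SYS.pullback f 1 (β i))) := by
  have key : ∀ (V : Set N) (β₁ : SYS.EndCohomology Vᶜ 1) (β : Fin (n - 3) → SYS.Cohomology N 1),
      SYS.IsSYSData hn cN V β₁ β →
      ∃ (W : Set M) (γ₁ : SYS.EndCohomology Wᶜ 1),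
        SYS.forgetEnds Wᶜ 1 γ₁ = SYS.pullback f 1 (SYS.forgetEnds Vᶜ 1 β₁) ∧
        SYS.IsSYSData hn cM W γ₁ (fun i => SYS.pullback f 1 (β i)) :=
    fun _ _ _ h => hf.exists_sysData (EuclideanSpace ℝ (Fin n)) hn hd h
  refine ⟨?_, fun hN => ?_, key⟩
  · rintro ⟨V, β₁, β, h⟩
    obtain ⟨W, γ₁, -, hW⟩ := key V β₁ β h
    exact ⟨W, γ₁, _, hW⟩
  · rw [← not_compactSpace_iff] at hN ⊢
    intro hM
    obtain ⟨k, rfl⟩ : ∃ k, n = k + 1 := ⟨n - 1, by omega⟩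
    exact hN (hf.compactSpace hd hcN)
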